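/- Let $\Phi\subset\mathbb{R}^3$ be a smooth closed surface, that is, a compact subset in which every point has a relatively open neighbourhood that is the image of a $C^\infty$ embedding $\mathbb{R}^2\to\mathbb{R}^3$ with everywhere injective differential. Assume that $\Phi$ is homeomorphic to the sphere $S^2$ or to the torus $S^1\times S^1$. Suppose that through each point of $\Phi$ there pass at least $7$ distinct circles fully contained in $\Phi$ and depending continuously on the point, in the following (local) sense: every $p\in\Phi$ has a neighbourhood $W$ in $\Phi$ and, for each $x\in W$, there are $7$ pairwise distinct circles $\gamma_1(x),\dots,\gamma_7(x)$ of positive radius with $x\in\gamma_i(x)\subset\Phi$, such that for each $i$ the centre, the radius and a unit normal vector of the plane of $\gamma_i(x)$ can be chosen to depend continuously on $x\in W$. Then $\Phi$ is a round sphere: there are $c\in\mathbb{R}^3$ and $r>0$ with $\Phi=\{x\in\mathbb{R}^3 : |x-c|=r\}$. -/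

import Mathlib

open scoped ContDiff

/-- Euclidean three-space. -/
abbrev E3 : Type := EuclideanSpace ℝ (Fin 3)

/-- The Euclidean plane. -/
abbrev E2 : Type := EuclideanSpace ℝ (Fin 2)

/-- A smooth closed (compact, without boundary) surface embedded in `ℝ³`: a compact set in which
every point has a relatively open neighbourhood that is the image of a `C^∞` embedding
`ℝ² → ℝ³` whose differential is injective everywhere. -/
def IsSmoothClosedSurface (Φ : Set E3) : Prop :=
  IsCompact Φ ∧
    ∀ p ∈ Φ, ∃ V : Set E3, IsOpen V ∧ p ∈ V ∧
      ∃ φ : E2 → E3, ContDiff ℝ ∞ φ ∧ (∀ u, Function.Injective (fderiv ℝ φ u)) ∧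
        Topology.IsEmbedding φ ∧ Set.range φ = Φ ∩ V

/-- The circle with centre `c` and radius `r` in the plane through `c` orthogonal to `n`
(a genuine circle when `0 < r` and `‖n‖ = 1`). -/
def circleSet (c n : E3) (r : ℝ) : Set E3 :=
  {x | dist x c = r ∧ inner ℝ (x - c) n = 0}

/-- `γ` assigns to each point of `W` a circle of positive radius in `ℝ³`, depending continuously
on the point: centre, unit normal of the plane and radius are continuous on `W`. -/
def IsContinuousCircleFamily (W : Set E3) (γ : E3 → Set E3) : Prop :=
  ∃ (c n : E3 → E3) (r : E3 → ℝ),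
    ContinuousOn c W ∧ ContinuousOn n W ∧ ContinuousOn r W ∧
      ∀ x ∈ W, 0 < r x ∧ ‖n x‖ = 1 ∧ γ x = circleSet (c x) (n x) (r x)

/-- Through each point of `Φ` there pass (at least) `k` distinct circles contained in `Φ`,
depending continuously on the point. The continuous choice is required only locally, near each
point of `Φ`: on a topological sphere there is no global one, since the tangent lines of the chosen
circles would form a continuous line field. -/
def HasCirclesThroughEachPoint (k : ℕ) (Φ : Set E3) : Prop :=
  ∀ p ∈ Φ, ∃ V : Set E3, IsOpen V ∧ p ∈ V ∧
    ∃ γ : Fin k → E3 → Set E3,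
      (∀ i, IsContinuousCircleFamily (Φ ∩ V) (γ i)) ∧
      ∀ x ∈ Φ ∩ V, (∀ i, x ∈ γ i x ∧ γ i x ⊆ Φ) ∧ Function.Injective (fun i => γ i x)

/-! Call two circles through `p` even if they touch at `p` or meet again (`Circ.EvenAt`). The
topological half finds three pairwise even circles among seven. A circle `C` on the surface is the
zero set of the complex function `Circ.side`. Near `C` the values of this function on the surface
lie almost on a real line, so its squared direction extends to a continuous map from the surface to
the unit circle (`Circ.exists_sideMap`). The winding number of this map along `D`, mod 2, plays the
role of the intersection number of `C` and `D`: a single transversal crossing makes it odd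
(`not_evenWinding_of_simple_zero`). On a sphere it is always even. On a torus each circle gives a
class in (ℤ/2)², and self-intersection is even (`even_self_period`). Hence two circles are even if
their classes agree or one class vanishes. There are three nonzero classes and 7 > 2 · 3.

The geometric half is `sphericalNear_of_three`. Even circles have equal normal curvature at `p`, so
the three lie in one sphere or plane `S` tangent to the surface at `p`. Nearby members of the family
of one of them still cross the other two, hence meet `S` in three points (or touch it and meet it
once more) and lie in `S`. If all three touch at `p`, the one with extreme geodesic curvature is
moved, and only towards points beyond the other two.

So points with a spherical or planar neighbourhood are dense. On such pieces the curvature and a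
vector built from the unit normal are locally constant; by smoothness their differentials vanish
everywhere, and one sphere or plane contains the surface. The surface is open and closed in it, and
compactness excludes the plane. -/

open Filter Topology

/-! ### Vector algebra of three-space. -/

/-- The cross product on Euclidean three-space. -/
noncomputable def crossE (a b : E3) : E3 :=
  !₂[a 1 * b 2 - a 2 * b 1, a 2 * b 0 - a 0 * b 2, a 0 * b 1 - a 1 * b 0]

theorem inner_E3 (a b : E3) : inner ℝ a b = a 0 * b 0 + a 1 * b 1 + a 2 * b 2 := by
  simp [PiLp.inner_apply, Fin.sum_univ_three]; ring

theorem norm_sq_E3 (a : E3) : ‖a‖ ^ 2 = a 0 ^ 2 + a 1 ^ 2 + a 2 ^ 2 := by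
  simp [EuclideanSpace.norm_sq_eq, Fin.sum_univ_three]

theorem inner_crossE_left (a b : E3) : inner ℝ (crossE a b) a = 0 := by
  simp [inner_E3, crossE]; ring

theorem inner_crossE_right (a b : E3) : inner ℝ (crossE a b) b = 0 := by
  simp [inner_E3, crossE]; ring

theorem crossE_crossE (a b c : E3) :
    crossE a (crossE b c) = (inner ℝ a c : ℝ) • b - (inner ℝ a b : ℝ) • c := by
  ext i
  fin_cases i <;> simp [inner_E3, crossE] <;> ring

theorem norm_sq_crossE (a b : E3) :
    ‖crossE a b‖ ^ 2 = ‖a‖ ^ 2 * ‖b‖ ^ 2 - (inner ℝ a b : ℝ) ^ 2 := by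
  simp [norm_sq_E3, inner_E3, crossE]; ring

theorem crossE_add_right (a b c : E3) : crossE a (b + c) = crossE a b + crossE a c := by
  ext i
  fin_cases i <;> simp [crossE] <;> ring

theorem crossE_smul_right (k : ℝ) (a b : E3) : crossE a (k • b) = k • crossE a b := by
  ext i
  fin_cases i <;> simp [crossE] <;> ring

theorem continuous_crossE : Continuous fun p : E3 × E3 => crossE p.1 p.2 := by
  unfold crossE
  fun_prop

/-- A vector orthogonal to two vectors is parallel to their cross product. -/
theorem smul_eq_of_inner_eq_zero {a b v : E3} (ha : inner ℝ v a = 0) (hb : inner ℝ v b = 0) :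
    ‖crossE a b‖ ^ 2 • v = (inner ℝ (crossE a b) v : ℝ) • crossE a b := by
  have h1 : crossE v (crossE a b) = 0 := by rw [crossE_crossE, ha, hb]; simp
  have h2 := crossE_crossE (crossE a b) v (crossE a b)
  rw [h1, real_inner_self_eq_norm_sq] at h2
  have h3 : crossE (crossE a b) (0 : E3) = 0 := by
    simpa using crossE_smul_right 0 (crossE a b) 0
  rw [h3] at h2
  exact sub_eq_zero.1 h2.symm

/-! ### Circles and their parametrization by angle. -/

/-- A circle in three-space: centre, unit normal of its plane, and positive radius. -/
structure Circ where
  c : E3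
  n : E3
  r : ℝ
  r_pos : 0 < r
  norm_n : ‖n‖ = 1

namespace Circ

/-- The set of points of a circle. -/
def carrier (C : Circ) : Set E3 := circleSet C.c C.n C.r

/-- The velocity at `x` of the rotation along the circle. -/
noncomputable def tan (C : Circ) (x : E3) : E3 := crossE C.n (x - C.c)

/-- The rotation of the point `x` by the angle `t` along the circle. -/
noncomputable def pt (C : Circ) (x : E3) (t : ℝ) : E3 :=
  C.c + Real.cos t • (x - C.c) + Real.sin t • C.tan x

variable (C : Circ) {x y : E3}

theorem mem_carrier : x ∈ C.carrier ↔ ‖x - C.c‖ = C.r ∧ inner ℝ (x - C.c) C.n = 0 := by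
  simp [carrier, circleSet, dist_eq_norm]

variable {C}

theorem norm_tan (hx : x ∈ C.carrier) : ‖C.tan x‖ = C.r := by
  obtain ⟨h1, h2⟩ := C.mem_carrier.1 hx
  have : ‖C.tan x‖ ^ 2 = C.r ^ 2 := by
    rw [tan, norm_sq_crossE, C.norm_n, h1, real_inner_comm, h2]; ring
  exact (sq_eq_sq₀ (norm_nonneg _) C.r_pos.le).1 this

theorem tan_ne_zero (hx : x ∈ C.carrier) : C.tan x ≠ 0 := by
  rw [← norm_pos_iff, norm_tan hx]; exact C.r_pos

variable (C)

theorem inner_tan_n : inner ℝ (C.tan x) C.n = 0 := inner_crossE_left _ _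

theorem inner_tan_sub : inner ℝ (C.tan x) (x - C.c) = 0 := inner_crossE_right _ _

theorem pt_zero : C.pt x 0 = x := by simp [pt]

theorem pt_add_two_pi (t : ℝ) : C.pt x (t + 2 * Real.pi) = C.pt x t := by simp [pt]

theorem pt_sub_c (t : ℝ) : C.pt x t - C.c = Real.cos t • (x - C.c) + Real.sin t • C.tan x := by
  simp [pt, add_assoc]

theorem pt_sub (t : ℝ) : C.pt x t - x = (Real.cos t - 1) • (x - C.c) + Real.sin t • C.tan x := by
  simp only [pt]; module

theorem continuous_pt : Continuous (C.pt x) := by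
  unfold pt
  fun_prop

variable {C}

theorem crossE_tan (hx : x ∈ C.carrier) : crossE C.n (C.tan x) = -(x - C.c) := by
  obtain ⟨-, h2⟩ := C.mem_carrier.1 hx
  rw [tan, crossE_crossE, real_inner_comm, h2, real_inner_self_eq_norm_sq, C.norm_n]; simp

theorem tan_pt (hx : x ∈ C.carrier) (t : ℝ) :
    C.tan (C.pt x t) = -Real.sin t • (x - C.c) + Real.cos t • C.tan x := by
  rw [tan, pt_sub_c, crossE_add_right, crossE_smul_right, crossE_smul_right, crossE_tan hx]
  rw [show crossE C.n (x - C.c) = C.tan x from rfl]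
  module

theorem hasDerivAt_pt (hx : x ∈ C.carrier) (t : ℝ) : HasDerivAt (C.pt x) (C.tan (C.pt x t)) t := by
  rw [tan_pt hx]
  exact (((Real.hasDerivAt_cos t).smul_const (x - C.c)).const_add C.c).add
    ((Real.hasDerivAt_sin t).smul_const (C.tan x))

theorem norm_sq_pt_sub (hx : x ∈ C.carrier) (t : ℝ) :
    ‖C.pt x t - x‖ ^ 2 = 2 * C.r ^ 2 * (1 - Real.cos t) := by
  obtain ⟨h1, -⟩ := C.mem_carrier.1 hx
  rw [pt_sub, norm_add_sq_real, norm_smul, norm_smul, inner_smul_left, inner_smul_right,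
    real_inner_comm, inner_tan_sub, norm_tan hx, h1, mul_pow, mul_pow]
  simp only [Real.norm_eq_abs, sq_abs]
  have := Real.sin_sq_add_cos_sq t
  simp
  linear_combination C.r ^ 2 * this

theorem pt_mem (hx : x ∈ C.carrier) (t : ℝ) : C.pt x t ∈ C.carrier := by
  obtain ⟨h1, h2⟩ := C.mem_carrier.1 hx
  refine C.mem_carrier.2 ⟨?_, ?_⟩
  · rw [pt_sub_c, ← sq_eq_sq₀ (norm_nonneg _) C.r_pos.le, norm_add_sq_real, norm_smul, norm_smul,
      inner_smul_left, inner_smul_right, real_inner_comm, inner_tan_sub, norm_tan hx, h1, mul_pow,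
      mul_pow]
    simp only [Real.norm_eq_abs, sq_abs]
    have := Real.sin_sq_add_cos_sq t
    simp
    linear_combination C.r ^ 2 * this
  · rw [pt_sub_c, inner_add_left, inner_smul_left, inner_smul_left, h2, inner_tan_n]; simp

theorem exists_pt_eq (hx : x ∈ C.carrier) (hy : y ∈ C.carrier) :
    ∃ t ∈ Set.Ioc (-Real.pi) Real.pi, C.pt x t = y := by
  obtain ⟨h1, h2⟩ := C.mem_carrier.1 hx
  obtain ⟨h3, h4⟩ := C.mem_carrier.1 hy
  have hr := C.r_pos
  -- Coordinates of `y - C.c` in the orthogonal frame `x - C.c`, `C.tan x`, whose vectors both have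
  -- length `C.r`: the cosine and sine of the angle sought.
  set a : ℝ := inner ℝ (y - C.c) (x - C.c) / C.r ^ 2 with ha
  set b : ℝ := inner ℝ (y - C.c) (C.tan x) / C.r ^ 2 with hb
  have hv : y - C.c = a • (x - C.c) + b • C.tan x := by
    set v := y - C.c - a • (x - C.c) with hv
    have h5 : inner ℝ v C.n = 0 := by
      simp only [hv, inner_sub_left, inner_smul_left, h4, h2]; simp
    have h6 : inner ℝ v (x - C.c) = 0 := by
      rw [hv, inner_sub_left, inner_smul_left, real_inner_self_eq_norm_sq, h1, ha]
      simp; field_simp; ring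
    have h7 := smul_eq_of_inner_eq_zero h5 h6
    rw [show crossE C.n (x - C.c) = C.tan x from rfl, norm_tan hx] at h7
    have h8 : inner ℝ (C.tan x) v = C.r ^ 2 * b := by
      rw [hv, inner_sub_right, inner_smul_right, inner_tan_sub, real_inner_comm, hb]
      field_simp; ring
    rw [h8, mul_smul] at h7
    have h9 : v = b • C.tan x := smul_right_injective E3 (pow_pos hr 2).ne' h7
    rw [← h9, hv]; module
  have hab : a ^ 2 + b ^ 2 = 1 := by
    have h := congrArg (fun z => ‖z‖ ^ 2) hv
    simp only [norm_add_sq_real, norm_smul, inner_smul_left, inner_smul_right, mul_pow,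
      Real.norm_eq_abs, sq_abs, h3, h1, norm_tan hx, real_inner_comm (C.tan x) (x - C.c),
      inner_tan_sub] at h
    simp at h
    have h2 : C.r ^ 2 * (a ^ 2 + b ^ 2) = C.r ^ 2 * 1 := by linarith
    exact mul_left_cancel₀ (pow_pos hr 2).ne' h2
  have hz : ‖(⟨a, b⟩ : ℂ)‖ = 1 := by
    rw [← sq_eq_sq₀ (norm_nonneg _) zero_le_one, Complex.sq_norm, Complex.normSq_mk]; linarith
  have hz0 : (⟨a, b⟩ : ℂ) ≠ 0 := by
    intro h; rw [h] at hz; simp at hz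
  refine ⟨Complex.arg ⟨a, b⟩, ⟨Complex.neg_pi_lt_arg _, Complex.arg_le_pi _⟩, ?_⟩
  rw [pt, Complex.cos_arg hz0, Complex.sin_arg, hz]
  simp only [div_one]
  rw [add_assoc, ← hv]; simp

theorem pt_injOn (hx : x ∈ C.carrier) {s t : ℝ} (h : C.pt x s = C.pt x t) :
    Real.cos s = Real.cos t ∧ Real.sin s = Real.sin t := by
  have h1 : C.pt x s - C.c = C.pt x t - C.c := by rw [h]
  rw [pt_sub_c, pt_sub_c] at h1
  obtain ⟨h2, -⟩ := C.mem_carrier.1 hx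
  have hr := (pow_pos C.r_pos 2).ne'
  constructor
  · have := congrArg (fun z => inner ℝ z (x - C.c)) h1
    simp only [inner_add_left, inner_smul_left, inner_tan_sub, real_inner_self_eq_norm_sq, h2] at this
    simp at this
    rcases this with h | h
    · exact h
    · exact absurd h C.r_pos.ne'
  · have := congrArg (fun z => inner ℝ (C.tan x) z) h1
    simp only [inner_add_right, inner_smul_right, inner_tan_sub, real_inner_self_eq_norm_sq,
      norm_tan hx] at this
    simp at this
    rcases this with h | h
    · exact h
    · exact absurd h C.r_pos.ne'

end Circ

/-! ### Intersections of circles with spheres, planes and other circles. -/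

/-- The general equation of a sphere or plane through `p`. -/
noncomputable def quad (w : E3) (b : ℝ) (p x : E3) : ℝ := inner ℝ w (x - p) + b * ‖x - p‖ ^ 2

theorem quad_self (w : E3) (b : ℝ) (p : E3) : quad w b p p = 0 := by simp [quad]

theorem continuous_quad (w : E3) (b : ℝ) (p : E3) : Continuous (quad w b p) := by
  unfold quad; fun_prop

/-- The new vector is the gradient at `q`. Moving the base point lets every intersection argument
start from a common point of circle and sphere. -/
theorem quad_rebase {w : E3} {b : ℝ} {p q : E3} (hq : quad w b p q = 0) (x : E3) :
    quad w b p x = quad (w + (2 * b) • (q - p)) b q x := by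
  have h : x - p = (x - q) + (q - p) := by abel
  unfold quad at *
  rw [h, norm_add_sq_real, inner_add_right, inner_add_left, inner_smul_left,
    real_inner_comm (x - q) (q - p)]
  simp only [conj_trivial]
  linear_combination hq

namespace Circ
variable {C D : Circ} {p q x y z w : E3} {b : ℝ}

/-- On a circle through the base point the equation has only two coefficients, so two further zeros,
or tangency and one further zero, kill it. -/
theorem quad_pt (hp : p ∈ C.carrier) (w : E3) (b t : ℝ) :
    quad w b p (C.pt p t) = Real.sin t * inner ℝ w (C.tan p) +
      (1 - Real.cos t) * (2 * b * C.r ^ 2 - inner ℝ w (p - C.c)) := by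
  rw [quad, norm_sq_pt_sub hp, pt_sub, inner_add_right, inner_smul_right, inner_smul_right]
  ring

theorem hasDerivAt_quad_pt (hx : x ∈ C.carrier) {t : ℝ} (h : C.pt x t = p) :
    HasDerivAt (fun s => quad w b p (C.pt x s)) (inner ℝ w (C.tan p)) t := by
  have h1 := (hasDerivAt_pt hx t).sub_const p
  rw [h] at h1
  have h2 := ((hasDerivAt_const t w).inner ℝ h1).add ((h1.norm_sq).const_mul b)
  convert! h2 using 1
  simp [h]

/-- The ratio s / (1 - c) is cot(t/2), which determines the point; different points therefore give
independent linear equations. -/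
theorem trig_eq_zero {S K c₁ s₁ c₂ s₂ : ℝ} (h₁ : s₁ * S + (1 - c₁) * K = 0)
    (h₂ : s₂ * S + (1 - c₂) * K = 0) (e₁ : s₁ ^ 2 + c₁ ^ 2 = 1) (e₂ : s₂ ^ 2 + c₂ ^ 2 = 1)
    (n₁ : c₁ ≠ 1) (n₂ : c₂ ≠ 1) (n : ¬ (c₁ = c₂ ∧ s₁ = s₂)) : S = 0 ∧ K = 0 := by
  have hdet : s₁ * (1 - c₂) - s₂ * (1 - c₁) ≠ 0 := by
    intro h
    have a₁ : 1 - c₁ ≠ 0 := sub_ne_zero.2 n₁.symm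
    have a₂ : 1 - c₂ ≠ 0 := sub_ne_zero.2 n₂.symm
    have h3 : (1 - c₁) * (1 - c₂) * ((1 + c₁) * (1 - c₂) - (1 + c₂) * (1 - c₁)) = 0 := by
      have : s₁ ^ 2 * (1 - c₂) ^ 2 = s₂ ^ 2 * (1 - c₁) ^ 2 := by
        linear_combination (s₁ * (1 - c₂) + s₂ * (1 - c₁)) * h
      linear_combination this - (1 - c₂) ^ 2 * e₁ + (1 - c₁) ^ 2 * e₂
    have h4 : (1 + c₁) * (1 - c₂) - (1 + c₂) * (1 - c₁) = 0 := by
      rcases mul_eq_zero.1 h3 with h | h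
      · exact absurd h (mul_ne_zero a₁ a₂)
      · exact h
    have h5 : c₁ = c₂ := by linarith
    refine n ⟨h5, ?_⟩
    subst h5
    have h6 : (s₁ - s₂) * (1 - c₁) = 0 := by linarith
    rcases mul_eq_zero.1 h6 with h | h
    · linarith
    · exact absurd h a₁
  constructor
  · have : (s₁ * (1 - c₂) - s₂ * (1 - c₁)) * S = 0 := by
      linear_combination (1 - c₂) * h₁ - (1 - c₁) * h₂
    exact (mul_eq_zero.1 this).resolve_left hdet
  · have : (s₁ * (1 - c₂) - s₂ * (1 - c₁)) * K = 0 := by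
      linear_combination - s₂ * h₁ + s₁ * h₂
    exact (mul_eq_zero.1 this).resolve_left hdet

theorem cos_ne_one (hp : p ∈ C.carrier) {t : ℝ} (h : C.pt p t ≠ p) : Real.cos t ≠ 1 := by
  intro h1
  apply h
  rw [← sub_eq_zero, ← norm_eq_zero, ← sq_eq_zero_iff, norm_sq_pt_sub hp, h1]; simp

/-- A circle meeting a sphere or plane in three points lies in it. -/
theorem quad_eq_zero_of_three (hx : x ∈ C.carrier) (hy : y ∈ C.carrier) (hz : z ∈ C.carrier)
    (hxy : x ≠ y) (hxz : x ≠ z) (hyz : y ≠ z) (h1 : quad w b p x = 0) (h2 : quad w b p y = 0)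
    (h3 : quad w b p z = 0) {v : E3} (hv : v ∈ C.carrier) : quad w b p v = 0 := by
  rw [quad_rebase h1] at h2 h3 ⊢
  obtain ⟨s, -, rfl⟩ := exists_pt_eq hx hy
  obtain ⟨t, -, rfl⟩ := exists_pt_eq hx hz
  obtain ⟨u, -, rfl⟩ := exists_pt_eq hx hv
  rw [quad_pt hx] at h2 h3 ⊢
  obtain ⟨h4, h5⟩ := trig_eq_zero h2 h3 (Real.sin_sq_add_cos_sq s) (Real.sin_sq_add_cos_sq t)
    (cos_ne_one hx hxy.symm) (cos_ne_one hx hxz.symm) (by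
      rintro ⟨h6, h7⟩
      apply hyz
      rw [pt, pt, h6, h7])
  rw [h4, h5]; ring

/-- A circle tangent to a sphere or plane at `p` and meeting it in a further point lies in it. -/
theorem quad_eq_zero_of_tangent (hp : p ∈ C.carrier) (hy : y ∈ C.carrier) (hyp : y ≠ p)
    (ht : inner ℝ w (C.tan p) = 0) (h : quad w b p y = 0) {v : E3} (hv : v ∈ C.carrier) :
    quad w b p v = 0 := by
  obtain ⟨s, -, rfl⟩ := exists_pt_eq hp hy
  obtain ⟨u, -, rfl⟩ := exists_pt_eq hp hv
  rw [quad_pt hp, ht] at h ⊢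
  have h1 : 1 - Real.cos s ≠ 0 := sub_ne_zero.2 (cos_ne_one hp hyp).symm
  rw [mul_zero, zero_add] at h
  have h2 := (mul_eq_zero.1 h).resolve_left h1
  rw [h2]; ring

/-- The two equations are the plane of the circle and its diametral sphere, so inclusions of circles
reduce to statements on `quad`. -/
theorem mem_iff_quad (hp : p ∈ C.carrier) :
    x ∈ C.carrier ↔ quad C.n 0 p x = 0 ∧ quad ((2 : ℝ) • (p - C.c)) 1 p x = 0 := by
  obtain ⟨h1, h2⟩ := C.mem_carrier.1 hp
  have h : x - C.c = (x - p) + (p - C.c) := by abel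
  have hr := C.r_pos.le
  rw [mem_carrier, quad, quad, ← sq_eq_sq₀ (norm_nonneg _) hr, h, norm_add_sq_real,
    inner_add_left, h1, h2, inner_smul_left, real_inner_comm (x - p) C.n,
    real_inner_comm (x - p) (p - C.c)]
  simp only [conj_trivial]
  constructor
  · rintro ⟨h3, h4⟩; constructor <;> linarith
  · rintro ⟨h3, h4⟩; constructor <;> linarith

theorem subset_of_three (hx : x ∈ C.carrier) (hy : y ∈ C.carrier) (hz : z ∈ C.carrier)
    (hxy : x ≠ y) (hxz : x ≠ z) (hyz : y ≠ z) (hx' : x ∈ D.carrier) (hy' : y ∈ D.carrier)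
    (hz' : z ∈ D.carrier) : C.carrier ⊆ D.carrier := fun v hv => by
  have h1 := (mem_iff_quad hx').1 hx'
  have h2 := (mem_iff_quad hx').1 hy'
  have h3 := (mem_iff_quad hx').1 hz'
  exact (mem_iff_quad hx').2
    ⟨quad_eq_zero_of_three hx hy hz hxy hxz hyz h1.1 h2.1 h3.1 hv,
     quad_eq_zero_of_three hx hy hz hxy hxz hyz h1.2 h2.2 h3.2 hv⟩

/-- Two circles with three common points coincide. -/
theorem eq_of_three (hx : x ∈ C.carrier) (hy : y ∈ C.carrier) (hz : z ∈ C.carrier)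
    (hxy : x ≠ y) (hxz : x ≠ z) (hyz : y ≠ z) (hx' : x ∈ D.carrier) (hy' : y ∈ D.carrier)
    (hz' : z ∈ D.carrier) : C.carrier = D.carrier :=
  (subset_of_three hx hy hz hxy hxz hyz hx' hy' hz').antisymm
    (subset_of_three hx' hy' hz' hxy hxz hyz hx hy hz)

/-- Two circles through `p` are tangent at `p`. -/
def Tangent (C D : Circ) (p : E3) : Prop := ∃ k : ℝ, k ≠ 0 ∧ D.tan p = k • C.tan p

theorem Tangent.symm (h : Tangent C D p) : Tangent D C p := by
  obtain ⟨k, hk, h⟩ := h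
  exact ⟨k⁻¹, inv_ne_zero hk, by rw [h, smul_smul, inv_mul_cancel₀ hk, one_smul]⟩

theorem Tangent.trans {E : Circ} (h : Tangent C D p) (h' : Tangent D E p) : Tangent C E p := by
  obtain ⟨k, hk, h⟩ := h
  obtain ⟨l, hl, h'⟩ := h'
  exact ⟨l * k, mul_ne_zero hl hk, by rw [h', h, smul_smul]⟩

theorem tangent_of_inner (hC : p ∈ C.carrier) (hD : p ∈ D.carrier)
    (h1 : inner ℝ (D.tan p) C.n = 0) (h2 : inner ℝ (D.tan p) (p - C.c) = 0) :
    Tangent C D p := by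
  have h := smul_eq_of_inner_eq_zero h1 h2
  rw [show crossE C.n (p - C.c) = C.tan p from rfl, norm_tan hC] at h
  have hr := (pow_pos C.r_pos 2).ne'
  have h3 : D.tan p = ((inner ℝ (C.tan p) (D.tan p) : ℝ) / C.r ^ 2) • C.tan p := by
    rw [div_eq_inv_mul, mul_smul, ← h, smul_smul, inv_mul_cancel₀ hr, one_smul]
  refine ⟨_, ?_, h3⟩
  intro h4
  rw [h4, zero_smul] at h3
  exact tan_ne_zero hD h3

theorem subset_of_tangent (hC : p ∈ C.carrier) (hD : p ∈ D.carrier) (ht : Tangent C D p)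
    (hyC : y ∈ C.carrier) (hyD : y ∈ D.carrier) (hy : y ≠ p) : D.carrier ⊆ C.carrier :=
  fun v hv => by
  obtain ⟨k, -, hk⟩ := ht
  have h2 := (mem_iff_quad hC).1 hyC
  refine (mem_iff_quad hC).2 ⟨quad_eq_zero_of_tangent hD hyD hy ?_ h2.1 hv,
    quad_eq_zero_of_tangent hD hyD hy ?_ h2.2 hv⟩
  · rw [hk, inner_smul_right, real_inner_comm, inner_tan_n, mul_zero]
  · rw [hk, inner_smul_right, inner_smul_left, real_inner_comm, inner_tan_sub]; simp

/-- Two circles tangent at a point and sharing another point coincide. -/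
theorem eq_of_tangent (hC : p ∈ C.carrier) (hD : p ∈ D.carrier) (ht : Tangent C D p)
    (hyC : y ∈ C.carrier) (hyD : y ∈ D.carrier) (hy : y ≠ p) : C.carrier = D.carrier :=
  (subset_of_tangent hD hC ht.symm hyD hyC hy).antisymm (subset_of_tangent hC hD ht hyC hyD hy)

end Circ

/-! ### Charts, normals and Meusnier's theorem. -/

/-- `N` is a unit normal of `Φ` at `p`, in the strict sense: chords of `Φ` near `p` are almost
orthogonal to `N`. -/
def IsNormalAt (Φ : Set E3) (p N : E3) : Prop :=
  ‖N‖ = 1 ∧ ∀ ε : ℝ, 0 < ε → ∀ᶠ z : E3 × E3 in 𝓝[Φ] p ×ˢ 𝓝[Φ] p,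
    |inner ℝ N (z.1 - z.2)| ≤ ε * ‖z.1 - z.2‖

/-- Relative openness of the chart is recast as an equality of filters, which carries eventual and
frequent statements between chart and surface. -/
theorem IsSmoothClosedSurface.exists_chart {Φ : Set E3} (hΦ : IsSmoothClosedSurface Φ) {p : E3}
    (hp : p ∈ Φ) : ∃ (φ : E2 → E3) (u₀ : E2), ContDiff ℝ ∞ φ ∧
      (∀ u, Function.Injective (fderiv ℝ φ u)) ∧ (∀ u, map φ (𝓝 u) = 𝓝[Φ] (φ u)) ∧
      (∀ u, φ u ∈ Φ) ∧ φ u₀ = p := by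
  obtain ⟨V, hV, hpV, φ, h1, h2, h3, h4⟩ := hΦ.2 p hp
  have hm : ∀ u, φ u ∈ Φ ∩ V := fun u => h4 ▸ Set.mem_range_self u
  obtain ⟨u₀, hu₀⟩ : p ∈ Set.range φ := h4 ▸ ⟨hp, hpV⟩
  refine ⟨φ, u₀, h1, h2, fun u => ?_, fun u => (hm u).1, hu₀⟩
  rw [h3.map_nhds_eq, h4, nhdsWithin_inter_of_mem']
  exact mem_nhdsWithin_of_mem_nhds (hV.mem_nhds (hm u).2)

theorem E2_eq (v : E2) :
    v = v 0 • EuclideanSpace.single (0 : Fin 2) (1 : ℝ) +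
      v 1 • EuclideanSpace.single (1 : Fin 2) (1 : ℝ) := by
  ext i
  fin_cases i <;> simp

theorem crossE_ne_zero_of_injective {L : E2 →L[ℝ] E3} (hL : Function.Injective L) :
    crossE (L (EuclideanSpace.single 0 1)) (L (EuclideanSpace.single 1 1)) ≠ 0 := by
  intro h
  have h1 := crossE_crossE (L (EuclideanSpace.single 0 1)) (L (EuclideanSpace.single 0 1))
    (L (EuclideanSpace.single 1 1))
  rw [h, show crossE (L (EuclideanSpace.single 0 1)) (0 : E3) = 0 by
    simpa using crossE_smul_right 0 (L (EuclideanSpace.single 0 1)) 0, ← map_smul, ← map_smul,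
    ← map_sub, eq_comm, map_eq_zero_iff L hL] at h1
  have h2 := congrArg (fun v : E2 => v 1) h1
  simp at h2
  rw [map_eq_zero_iff L hL] at h2
  simpa using congrArg (fun v : E2 => v 0) h2

theorem inner_crossE_apply (L : E2 →L[ℝ] E3) (v : E2) :
    inner ℝ (crossE (L (EuclideanSpace.single 0 1)) (L (EuclideanSpace.single 1 1))) (L v) = 0 := by
  conv_lhs => rw [E2_eq v]
  rw [map_add, map_smul, map_smul, inner_add_right, inner_smul_right, inner_smul_right,
    inner_crossE_left, inner_crossE_right]
  simp

/-- Expansion of `v` in the basis a × b, a, b, multiplied by the Gram determinant to avoid division.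
-/
theorem norm_sq_crossE_smul (a b v : E3) : ‖crossE a b‖ ^ 2 • v =
    (inner ℝ (crossE a b) v : ℝ) • crossE a b +
      ((inner ℝ v a * inner ℝ b b - inner ℝ v b * inner ℝ a b : ℝ) • a +
       (inner ℝ v b * inner ℝ a a - inner ℝ v a * inner ℝ a b : ℝ) • b) := by
  ext i
  fin_cases i <;> simp [norm_sq_E3, inner_E3, crossE] <;> ring

theorem exists_eq_apply_of_inner_eq_zero {L : E2 →L[ℝ] E3} (hL : Function.Injective L) {v : E3}
    (hv : inner ℝ (crossE (L (EuclideanSpace.single 0 1)) (L (EuclideanSpace.single 1 1))) v = 0) :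
    ∃ d, L d = v := by
  have h := norm_sq_crossE_smul (L (EuclideanSpace.single 0 1)) (L (EuclideanSpace.single 1 1)) v
  have h0 : ‖crossE (L (EuclideanSpace.single 0 1)) (L (EuclideanSpace.single 1 1))‖ ^ 2 ≠ 0 := by
    simpa using crossE_ne_zero_of_injective hL
  rw [hv, zero_smul, zero_add, ← map_smul, ← map_smul, ← map_add] at h
  exact ⟨_, by rw [map_smul, ← h, smul_smul, inv_mul_cancel₀ h0, one_smul]⟩

/-- Strict differentiability of the chart controls chords with both ends moving, and injectivity of
the differential bounds parameter differences by chords. -/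
theorem IsSmoothClosedSurface.exists_normal {Φ : Set E3} (hΦ : IsSmoothClosedSurface Φ) {p : E3}
    (hp : p ∈ Φ) : ∃ N : E3, IsNormalAt Φ p N ∧ ∀ v : E3, inner ℝ N v = 0 →
      ∃ σ : ℝ → E3, HasDerivAt σ v 0 ∧ σ 0 = p ∧ ∀ t, σ t ∈ Φ := by
  obtain ⟨φ, u₀, h1, h2, h3, h4, rfl⟩ := hΦ.exists_chart hp
  set L := fderiv ℝ φ u₀ with hLdef
  have hL : Function.Injective L := h2 u₀
  have hs : HasStrictFDerivAt φ L u₀ := h1.contDiffAt.hasStrictFDerivAt (by simp)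
  set m := crossE (L (EuclideanSpace.single 0 1)) (L (EuclideanSpace.single 1 1)) with hm
  have hm0 : m ≠ 0 := crossE_ne_zero_of_injective hL
  have hmn : ‖m‖ ≠ 0 := norm_ne_zero_iff.2 hm0
  refine ⟨‖m‖⁻¹ • m, ⟨?_, ?_⟩, ?_⟩
  · rw [norm_smul, norm_inv, norm_norm, inv_mul_cancel₀ hmn]
  · intro ε hε
    obtain ⟨K, hK0, hK⟩ := (L : E2 →ₗ[ℝ] E3).exists_antilipschitzWith
      (LinearMap.ker_eq_bot.2 hL)
    have hK' : (0 : ℝ) < K := hK0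
    rw [← h3 u₀, prod_map_map_eq, eventually_map, ← nhds_prod_eq]
    -- The first bound absorbs the linearization error, so that parameter differences are at most `2
    -- * K` times chords; the second turns this into `ε`.
    set δ : ℝ := min (1 / (2 * K)) (ε / (2 * K)) with hδ
    have hδ0 : 0 < δ := by positivity
    filter_upwards [hs.isLittleO.def hδ0] with z hz
    set d := φ z.1 - φ z.2 with hd
    have e1 : ‖z.1 - z.2‖ ≤ K * ‖L (z.1 - z.2)‖ := by
      have := hK.le_mul_dist z.1 z.2
      simpa [dist_eq_norm, ← map_sub] using this
    have e2 : ‖L (z.1 - z.2)‖ ≤ ‖d‖ + δ * ‖z.1 - z.2‖ := by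
      calc ‖L (z.1 - z.2)‖ = ‖d - (d - L (z.1 - z.2))‖ := by congr 1; abel
        _ ≤ ‖d‖ + ‖d - L (z.1 - z.2)‖ := norm_sub_le _ _
        _ ≤ _ := by gcongr
    have e3 : ‖z.1 - z.2‖ ≤ 2 * K * ‖d‖ := by
      have h5 : K * (δ * ‖z.1 - z.2‖) ≤ 1 / 2 * ‖z.1 - z.2‖ := by
        have : K * δ ≤ 1 / 2 := by
          calc K * δ ≤ K * (1 / (2 * K)) := by gcongr; exact min_le_left _ _
            _ = 1 / 2 := by field_simp
        calc K * (δ * ‖z.1 - z.2‖) = K * δ * ‖z.1 - z.2‖ := by ring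
          _ ≤ _ := by gcongr
      have h6 : (K : ℝ) * ‖L (z.1 - z.2)‖ ≤ K * (‖d‖ + δ * ‖z.1 - z.2‖) := by gcongr
      linarith
    have e4 : inner ℝ (‖m‖⁻¹ • m) d = inner ℝ (‖m‖⁻¹ • m) (d - L (z.1 - z.2)) := by
      rw [inner_sub_right (‖m‖⁻¹ • m) d, inner_smul_left m (L _), inner_crossE_apply]; simp
    change |inner ℝ (‖m‖⁻¹ • m) d| ≤ ε * ‖d‖
    rw [e4]
    calc |inner ℝ (‖m‖⁻¹ • m) (d - L (z.1 - z.2))|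
        ≤ ‖‖m‖⁻¹ • m‖ * ‖d - L (z.1 - z.2)‖ := abs_real_inner_le_norm _ _
      _ = ‖d - L (z.1 - z.2)‖ := by
        rw [norm_smul, norm_inv, norm_norm, inv_mul_cancel₀ hmn, one_mul]
      _ ≤ δ * ‖z.1 - z.2‖ := hz
      _ ≤ (ε / (2 * K)) * (2 * K * ‖d‖) := by gcongr; exact min_le_right _ _
      _ = ε * ‖d‖ := by field_simp
  · intro v hv
    rw [inner_smul_left] at hv
    obtain ⟨d, hd⟩ := exists_eq_apply_of_inner_eq_zero hL (v := v) (by simpa [hmn] using hv)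
    refine ⟨fun t => φ (u₀ + t • d), ?_, by simp, fun t => h4 _⟩
    rw [← hd]
    have h5 : HasDerivAt (fun t : ℝ => u₀ + t • d) d 0 := by
      simpa using ((hasDerivAt_id (0 : ℝ)).smul_const d).const_add u₀
    have h6 : HasFDerivAt φ L (u₀ + (0 : ℝ) • d) := by simpa using hs.hasFDerivAt
    exact h6.comp_hasDerivAt (0 : ℝ) h5

namespace IsNormalAt
variable {Φ : Set E3} {p N : E3}

/-- The scaling `s` is arbitrary, so the lemma also applies to chords of second order. -/
theorem inner_eq_zero_of_tendsto (h : IsNormalAt Φ p N) {ι : Type*} {l : Filter ι} [l.NeBot]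
    {x y : ι → E3} {s : ι → ℝ} {d : E3} (hx : Tendsto x l (𝓝[Φ] p)) (hy : Tendsto y l (𝓝[Φ] p))
    (hd : Tendsto (fun i => s i • (x i - y i)) l (𝓝 d)) : inner ℝ N d = 0 := by
  have h1 : ∀ ε : ℝ, 0 < ε → |inner ℝ N d| ≤ ε * ‖d‖ := by
    intro ε hε
    have h2 : Tendsto (fun i => |inner ℝ N (s i • (x i - y i))|) l (𝓝 |inner ℝ N d|) :=
      (tendsto_const_nhds.inner hd).abs
    have h3 : Tendsto (fun i => ε * ‖s i • (x i - y i)‖) l (𝓝 (ε * ‖d‖)) := hd.norm.const_mul ε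
    refine le_of_tendsto_of_tendsto h2 h3 ?_
    filter_upwards [(hx.prodMk hy).eventually (h.2 ε hε)] with i hi
    rw [inner_smul_right, abs_mul, norm_smul, Real.norm_eq_abs]
    nlinarith [abs_nonneg (s i)]
  by_contra h4
  have h5 : 0 < |inner ℝ N d| := abs_pos.2 h4
  have h6 := h1 (|inner ℝ N d| / (2 * (‖d‖ + 1))) (by positivity)
  have h7 : |inner ℝ N d| / (2 * (‖d‖ + 1)) * ‖d‖ ≤ |inner ℝ N d| / 2 := by
    rw [div_mul_eq_mul_div, div_le_div_iff₀ (by positivity) (by norm_num)]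
    nlinarith [norm_nonneg d]
  linarith

end IsNormalAt

theorem Circ.tendsto_pt {Φ : Set E3} {C : Circ} {p : E3} (hC : C.carrier ⊆ Φ) (hp : p ∈ C.carrier)
    {ι : Type*} {l : Filter ι} {f : ι → ℝ} (hf : Tendsto f l (𝓝 0)) :
    Tendsto (fun i => C.pt p (f i)) l (𝓝[Φ] p) := by
  refine tendsto_nhdsWithin_iff.2 ⟨?_, Eventually.of_forall fun i => hC (Circ.pt_mem hp _)⟩
  have := (C.continuous_pt (x := p)).tendsto 0
  rw [C.pt_zero] at this
  exact this.comp hf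

theorem IsNormalAt.inner_tan {Φ : Set E3} {C : Circ} {p N : E3} (h : IsNormalAt Φ p N)
    (hC : C.carrier ⊆ Φ) (hp : p ∈ C.carrier) : inner ℝ N (C.tan p) = 0 := by
  have h1 := hasDerivAt_iff_tendsto_slope_zero.1 (Circ.hasDerivAt_pt hp 0)
  simp only [C.pt_zero, zero_add] at h1
  have h0 : Tendsto (fun t : ℝ => t) (𝓝[≠] 0) (𝓝 0) := tendsto_id.mono_left nhdsWithin_le_nhds
  refine h.inner_eq_zero_of_tendsto (Circ.tendsto_pt hC hp h0) ?_ h1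
  exact tendsto_nhdsWithin_iff.2 ⟨tendsto_const_nhds, Eventually.of_forall fun _ => hC hp⟩

theorem tendsto_cos_mul_sub_one (k : ℝ) :
    Tendsto (fun t : ℝ => (t⁻¹) ^ 2 * (Real.cos (k * t) - 1)) (𝓝[≠] 0) (𝓝 (-(k ^ 2 / 2))) := by
  have h1 : HasDerivAt (fun t : ℝ => Real.sin (k / 2 * t)) (k / 2) 0 := by
    have := (Real.hasDerivAt_sin (k / 2 * 0)).comp (0 : ℝ) ((hasDerivAt_id (0 : ℝ)).const_mul (k / 2))
    simpa [Function.comp_def] using this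
  have h2 := hasDerivAt_iff_tendsto_slope_zero.1 h1
  simp only [zero_add, mul_zero, Real.sin_zero, sub_zero, smul_eq_mul] at h2
  have h3 := (h2.pow 2).const_mul (-2)
  rw [show -(k ^ 2 / 2) = -2 * (k / 2) ^ 2 by ring]
  refine h3.congr fun t => ?_
  have h4 := Real.cos_two_mul (k / 2 * t)
  have h5 := Real.sin_sq_add_cos_sq (k / 2 * t)
  rw [show 2 * (k / 2 * t) = k * t by ring] at h4
  rw [h4]
  linear_combination -2 * (t⁻¹) ^ 2 * h5

theorem tendsto_sin_mul_sub (k : ℝ) :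
    Tendsto (fun t : ℝ => (t⁻¹) ^ 2 * (Real.sin (k * t) - k * Real.sin t)) (𝓝[≠] 0) (𝓝 0) := by
  have hb : ∀ x : ℝ, |x| ≤ 1 → |Real.sin x - x| ≤ |x| ^ 3 := by
    intro x hx
    have h1 := Real.sin_bound hx
    have h2 : |x| ^ 5 ≤ |x| ^ 3 := pow_le_pow_of_le_one (abs_nonneg x) hx (by norm_num)
    calc |Real.sin x - x| = |(Real.sin x - (x - x ^ 3 / 6)) + (-(x ^ 3 / 6))| := by congr 1; ring
      _ ≤ |Real.sin x - (x - x ^ 3 / 6)| + |-(x ^ 3 / 6)| := abs_add_le _ _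
      _ ≤ |x| ^ 5 / 100 + |x| ^ 3 / 6 := by
        refine add_le_add h1 (le_of_eq ?_)
        rw [abs_neg, abs_div, abs_pow]; norm_num
      _ ≤ |x| ^ 3 := by linarith [pow_nonneg (abs_nonneg x) 3]
  have hlim : Tendsto (fun t : ℝ => (|k| ^ 3 + |k|) * |t|) (𝓝[≠] 0) (𝓝 0) := by
    have : Tendsto (fun t : ℝ => (|k| ^ 3 + |k|) * |t|) (𝓝 0) (𝓝 ((|k| ^ 3 + |k|) * |0|)) :=
      (by fun_prop : Continuous fun t : ℝ => (|k| ^ 3 + |k|) * |t|).tendsto 0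
    simp only [abs_zero, mul_zero] at this
    exact this.mono_left nhdsWithin_le_nhds
  refine squeeze_zero_norm' ?_ hlim
  have e1 : ∀ᶠ t : ℝ in 𝓝[≠] 0, |k * t| ≤ 1 := by
    have : Tendsto (fun t : ℝ => |k * t|) (𝓝 0) (𝓝 (|k * 0|)) :=
      (by fun_prop : Continuous fun t : ℝ => |k * t|).tendsto 0
    simp only [mul_zero, abs_zero] at this
    exact ((this.eventually_lt_const zero_lt_one).mono fun t h => h.le).filter_mono
      nhdsWithin_le_nhds
  have e2 : ∀ᶠ t : ℝ in 𝓝[≠] 0, |t| ≤ 1 := by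
    have : Tendsto (fun t : ℝ => |t|) (𝓝 0) (𝓝 (|(0 : ℝ)|)) :=
      (by fun_prop : Continuous fun t : ℝ => |t|).tendsto 0
    simp only [abs_zero] at this
    exact ((this.eventually_lt_const zero_lt_one).mono fun t h => h.le).filter_mono
      nhdsWithin_le_nhds
  filter_upwards [e1, e2, self_mem_nhdsWithin] with t h1 h2 h3
  have ht : |t| ≠ 0 := abs_ne_zero.2 h3
  have h4 : |Real.sin (k * t) - k * Real.sin t| ≤ (|k| ^ 3 + |k|) * |t| ^ 3 := by
    calc |Real.sin (k * t) - k * Real.sin t|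
        = |(Real.sin (k * t) - k * t) + (-(k * (Real.sin t - t)))| := by congr 1; ring
      _ ≤ |Real.sin (k * t) - k * t| + |-(k * (Real.sin t - t))| := abs_add_le _ _
      _ ≤ |k * t| ^ 3 + |k| * |t| ^ 3 := by
        rw [abs_neg, abs_mul k]
        gcongr
        · exact hb _ h1
        · exact hb _ h2
      _ = (|k| ^ 3 + |k|) * |t| ^ 3 := by rw [abs_mul]; ring
  rw [Real.norm_eq_abs, abs_mul, abs_pow, abs_inv]
  calc (|t|⁻¹) ^ 2 * |Real.sin (k * t) - k * Real.sin t|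
      ≤ (|t|⁻¹) ^ 2 * ((|k| ^ 3 + |k|) * |t| ^ 3) := by gcongr
    _ = (|k| ^ 3 + |k|) * |t| := by field_simp

/-- Meusnier: tangent circles on a surface have the same normal curvature. -/
theorem IsNormalAt.normal_curvature_eq {Φ : Set E3} {C D : Circ} {p N : E3}
    (h : IsNormalAt Φ p N) (hC : C.carrier ⊆ Φ) (hD : D.carrier ⊆ Φ) (hpC : p ∈ C.carrier)
    (hpD : p ∈ D.carrier) (ht : C.Tangent D p) :
    inner ℝ N (p - C.c) / C.r ^ 2 = inner ℝ N (p - D.c) / D.r ^ 2 := by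
  obtain ⟨k, hk, hkt⟩ := ht
  have hr : D.r ^ 2 = k ^ 2 * C.r ^ 2 := by
    have := congrArg (fun v => ‖v‖ ^ 2) hkt
    simpa [norm_smul, mul_pow, Circ.norm_tan hpC, Circ.norm_tan hpD] using this
  have h0 : Tendsto (fun t : ℝ => t) (𝓝[≠] 0) (𝓝 0) := tendsto_id.mono_left nhdsWithin_le_nhds
  have h0k : Tendsto (fun t : ℝ => k * t) (𝓝[≠] 0) (𝓝 0) := by simpa using h0.const_mul k
  -- Running `C` at `k` times the parameter makes the velocities at `p` agree. The chord between the
  -- two curves is then of second order, and divided by t² it tends to the difference of the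
  -- accelerations.
  have h1 := h.inner_eq_zero_of_tendsto (s := fun t : ℝ => (t⁻¹) ^ 2)
    (d := -(k ^ 2 / 2) • (p - C.c) + (0 : ℝ) • C.tan p - (-(1 ^ 2 / 2 : ℝ)) • (p - D.c))
    (Circ.tendsto_pt hC hpC h0k) (Circ.tendsto_pt hD hpD h0) (by
      have := (((tendsto_cos_mul_sub_one k).smul_const (p - C.c)).add
        ((tendsto_sin_mul_sub k).smul_const (C.tan p))).sub
        ((tendsto_cos_mul_sub_one 1).smul_const (p - D.c))
      refine this.congr fun t => ?_
      rw [show C.pt p (k * t) - D.pt p t = (C.pt p (k * t) - p) - (D.pt p t - p) by abel,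
        Circ.pt_sub, Circ.pt_sub, hkt, one_mul]
      module)
  rw [inner_sub_right, inner_add_right, inner_smul_right, inner_smul_right, inner_smul_right] at h1
  have hC0 := C.r_pos.ne'
  rw [hr]
  field_simp
  linarith

/-! ### The squared direction of the equations of a circle, along the surface. -/

namespace Circ

/-- The equations of the plane and of the diametral sphere of a circle, as one complex-valued
function whose zero set is the circle. -/
noncomputable def side (C : Circ) (x : E3) : ℂ :=
  ⟨inner ℝ (x - C.c) C.n, ‖x - C.c‖ ^ 2 - C.r ^ 2⟩

/-- The differential of `Circ.side` at `q`. -/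
noncomputable def sideD (C : Circ) (q v : E3) : ℂ :=
  ⟨inner ℝ v C.n, 2 * inner ℝ v (q - C.c)⟩

variable {C D : Circ} {q x y v w N ν : E3} {Φ : Set E3}

theorem side_eq_zero_iff : C.side x = 0 ↔ x ∈ C.carrier := by
  rw [mem_carrier, side, Complex.ext_iff]
  simp only [Complex.zero_re, Complex.zero_im, sub_eq_zero]
  rw [sq_eq_sq₀ (norm_nonneg _) C.r_pos.le, and_comm]

theorem continuous_side : Continuous C.side := by
  have h1 : Continuous fun x : E3 => (inner ℝ (x - C.c) C.n : ℝ) := by fun_prop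
  have h2 : Continuous fun x : E3 => ‖x - C.c‖ ^ 2 - C.r ^ 2 := by fun_prop
  have : C.side = fun x => Complex.equivRealProdCLM.symm
      ((inner ℝ (x - C.c) C.n : ℝ), ‖x - C.c‖ ^ 2 - C.r ^ 2) := by
    funext x
    apply Complex.ext <;> simp [side]
  rw [this]
  exact Complex.equivRealProdCLM.symm.continuous.comp (h1.prodMk h2)

theorem sideD_add (q v w : E3) : C.sideD q (v + w) = C.sideD q v + C.sideD q w := by
  apply Complex.ext <;> simp [sideD, inner_add_left, mul_add]

theorem sideD_smul (q v : E3) (k : ℝ) : C.sideD q (k • v) = k * C.sideD q v := by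
  apply Complex.ext <;> simp [sideD, inner_smul_left, mul_left_comm]

/-- An exact expansion, as `side` is quadratic; the last term is o(|x - y|) as both points tend to
`q`. -/
theorem side_sub_side (q x y : E3) :
    C.side x - C.side y = C.sideD q (x - y) + (inner ℝ (x - y) ((x - q) + (y - q)) : ℝ) * Complex.I := by
  have h1 : x - C.c = (x - y) + (y - C.c) := by abel
  have h2 : (x - q) + (y - q) = (x - y) + (2 : ℝ) • (y - q) := by module
  have h3 : y - C.c = (y - q) + (q - C.c) := by abel
  apply Complex.ext
  · simp [side, sideD, ← inner_sub_left]
  · simp only [side, sideD, Complex.sub_im, Complex.add_im, Complex.mul_im, Complex.ofReal_re,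
      Complex.I_im, Complex.ofReal_im, Complex.I_re]
    rw [h2, h1, norm_add_sq_real, h3, inner_add_right, inner_add_right, inner_smul_right,
      real_inner_self_eq_norm_sq]
    ring

/-- The kernel of the differential is the tangent line of the circle. -/
theorem sideD_ne_zero (hq : q ∈ C.carrier) (h1 : inner ℝ v (C.tan q) = 0) (hv : v ≠ 0) :
    C.sideD q v ≠ 0 := by
  intro h
  rw [sideD, Complex.ext_iff] at h
  have h2 := smul_eq_of_inner_eq_zero h.1 (by simpa using h.2 : inner ℝ v (q - C.c) = 0)
  rw [show crossE C.n (q - C.c) = C.tan q from rfl, norm_tan hq, real_inner_comm, h1, zero_smul]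
    at h2
  exact hv ((smul_eq_zero.1 h2).resolve_left (pow_pos C.r_pos 2).ne')

/-- A point of the circle close to `x`, with the same coordinate along the tangent at `q`. -/
noncomputable def foot (C : Circ) (q x : E3) : E3 :=
  C.pt q (Real.arcsin (inner ℝ (x - q) (C.tan q) / C.r ^ 2))

theorem continuous_foot : Continuous (C.foot q) := by
  unfold foot
  exact C.continuous_pt.comp (Real.continuous_arcsin.comp (by fun_prop))

theorem foot_self : C.foot q q = q := by simp [foot, C.pt_zero]

theorem foot_mem (hq : q ∈ C.carrier) : C.foot q x ∈ C.carrier := pt_mem hq _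

theorem eventually_inner_sub_foot (hq : q ∈ C.carrier) :
    ∀ᶠ x in 𝓝 q, inner ℝ (x - C.foot q x) (C.tan q) = 0 := by
  have h1 : Tendsto (fun x : E3 => (inner ℝ (x - q) (C.tan q) / C.r ^ 2 : ℝ)) (𝓝 q) (𝓝 0) := by
    have : Continuous fun x : E3 => (inner ℝ (x - q) (C.tan q) / C.r ^ 2 : ℝ) := by fun_prop
    simpa using this.tendsto q
  filter_upwards [h1.eventually (Icc_mem_nhds (show (-1 : ℝ) < 0 by norm_num) zero_lt_one)] with x hx
  rw [show x - C.foot q x = (x - q) - (C.foot q x - q) by abel, foot, pt_sub, inner_sub_left,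
    inner_add_left, inner_smul_left, inner_smul_left, real_inner_comm (C.tan q) (q - C.c),
    inner_tan_sub, real_inner_self_eq_norm_sq, norm_tan hq, Real.sin_arcsin hx.1 hx.2]
  have := C.r_pos.ne'
  simp
  field_simp
  ring

/-- Near a point of a circle on a surface, the directions of `Circ.side` on the surface tend, up to
sign, to the direction of its differential along the conormal. -/
theorem tendsto_side_sq (hN : IsNormalAt Φ q N) (hC : C.carrier ⊆ Φ) (hq : q ∈ C.carrier)
    (hντ : inner ℝ ν (C.tan q) = 0) (hνN : inner ℝ ν N = 0) (hν : ν ≠ 0) :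
    Tendsto (fun x => C.side x ^ 2 / (‖C.side x‖ ^ 2 : ℝ)) (𝓝[Φ \ C.carrier] q)
      (𝓝 (C.sideD q ν ^ 2 / (‖C.sideD q ν‖ ^ 2 : ℝ))) := by
  set l := 𝓝[Φ \ C.carrier] q with hl
  -- The chord `δ` to the foot is orthogonal to the tangent of the circle near `q`; `k` and `η` are
  -- the coordinates of δ / |δ| along `ν` and `N`.
  set δ : E3 → E3 := fun x => x - C.foot q x with hδ
  set k : E3 → ℝ := fun x => inner ℝ ν (δ x) / (‖ν‖ ^ 2 * ‖δ x‖) with hk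
  set η : E3 → ℝ := fun x => inner ℝ N (δ x) / ‖δ x‖ with hη
  have hν2 : ‖ν‖ ^ 2 ≠ 0 := pow_ne_zero 2 (norm_ne_zero_iff.2 hν)
  have hνp : 0 < ‖ν‖ ^ 2 := lt_of_le_of_ne (sq_nonneg _) hν2.symm
  have hlΦ : l ≤ 𝓝[Φ] q := nhdsWithin_mono _ Set.sdiff_subset
  have hlq : l ≤ 𝓝 q := nhdsWithin_le_nhds
  have tx : Tendsto (fun x : E3 => x) l (𝓝[Φ] q) := hlΦ
  have ty : Tendsto (C.foot q) l (𝓝[Φ] q) := by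
    refine tendsto_nhdsWithin_iff.2 ⟨?_, Eventually.of_forall fun x => hC (foot_mem hq)⟩
    have := (C.continuous_foot (q := q)).tendsto q
    rw [foot_self] at this
    exact this.mono_left hlq
  have eδ : ∀ᶠ x in l, δ x ≠ 0 := by
    filter_upwards [self_mem_nhdsWithin] with x hx h0
    apply hx.2
    rw [sub_eq_zero.1 h0]
    exact foot_mem hq
  have eτ : ∀ᶠ x in l, inner ℝ (δ x) (C.tan q) = 0 :=
    (eventually_inner_sub_foot hq).filter_mono hlq
  have tη : Tendsto η l (𝓝 0) := by
    rw [Metric.tendsto_nhds]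
    intro ε hε
    filter_upwards [(tx.prodMk ty).eventually (hN.2 (ε / 2) (by positivity)), eδ] with x h1 h2
    have h3 : 0 < ‖δ x‖ := norm_pos_iff.2 h2
    rw [Real.dist_eq, sub_zero, hη, abs_div, abs_norm, div_lt_iff₀ h3]
    refine lt_of_le_of_lt h1 ?_
    gcongr
    linarith
  have eexp : ∀ᶠ x in l, δ x = ‖δ x‖ • (k x • ν + η x • N) := by
    filter_upwards [eδ, eτ] with x h1 h2
    have h3 : ‖δ x‖ ≠ 0 := norm_ne_zero_iff.2 h1
    set z := δ x - (‖δ x‖ * k x) • ν - (‖δ x‖ * η x) • N with hz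
    have e1 : ‖δ x‖ * k x = inner ℝ ν (δ x) / ‖ν‖ ^ 2 := by simp only [hk]; field_simp
    have e2 : ‖δ x‖ * η x = inner ℝ N (δ x) := by simp only [hη]; field_simp
    have hNτ : inner ℝ N (C.tan q) = 0 := hN.inner_tan hC hq
    have z1 : inner ℝ z ν = 0 := by
      rw [hz, e1, e2, inner_sub_left, inner_sub_left, inner_smul_left, inner_smul_left,
        real_inner_self_eq_norm_sq, real_inner_comm ν N, hνN, real_inner_comm]
      simp only [conj_trivial]
      field_simp; ring
    have z2 : inner ℝ z N = 0 := by
      rw [hz, e1, e2, inner_sub_left, inner_sub_left, inner_smul_left, inner_smul_left,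
        real_inner_self_eq_norm_sq, hνN, real_inner_comm, hN.1]
      simp
    have z3 : inner ℝ z (C.tan q) = 0 := by
      rw [hz, inner_sub_left, inner_sub_left, inner_smul_left, inner_smul_left, h2, hντ, hNτ]
      simp
    have h4 := smul_eq_of_inner_eq_zero z1 z2
    have h5 : C.tan q = ((inner ℝ (crossE ν N) (C.tan q) : ℝ) / ‖crossE ν N‖ ^ 2) • crossE ν N := by
      have h6 := smul_eq_of_inner_eq_zero (a := ν) (b := N) (v := C.tan q)
        (by rw [real_inner_comm, hντ]) (by rw [real_inner_comm, hNτ])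
      have h7 : ‖crossE ν N‖ ^ 2 ≠ 0 := by
        rw [norm_sq_crossE, hνN, hN.1]; simpa using hν2
      rw [div_eq_inv_mul, mul_smul, ← h6, smul_smul, inv_mul_cancel₀ h7, one_smul]
    have h8 : inner ℝ (crossE ν N) (C.tan q) ≠ 0 := by
      intro h
      rw [h, zero_div, zero_smul] at h5
      exact tan_ne_zero hq h5
    have h9 : inner ℝ (crossE ν N) z = 0 := by
      rw [h5, inner_smul_right, real_inner_comm _ z] at z3
      refine (mul_eq_zero.1 z3).resolve_left (div_ne_zero h8 ?_)
      rw [norm_sq_crossE, hνN, hN.1]; simpa using hν2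
    rw [h9, zero_smul, norm_sq_crossE, hνN, hN.1] at h4
    have h10 : z = 0 := (smul_eq_zero.1 h4).resolve_left (by simpa using hν2)
    rw [smul_add, smul_smul, smul_smul]
    rw [hz, sub_sub, sub_eq_zero] at h10
    exact h10
  -- Since η → 0, only the sign of `k` stays undetermined. It records the side of `C` on which `x`
  -- lies and disappears on squaring.
  have ek : ∀ᶠ x in l, k x ^ 2 = (1 - η x ^ 2) / ‖ν‖ ^ 2 := by
    filter_upwards [eδ, eexp] with x h1 h2
    have h3 : ‖δ x‖ ≠ 0 := norm_ne_zero_iff.2 h1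
    have h4 := congrArg (fun z => ‖z‖ ^ 2) h2
    simp only [norm_smul, mul_pow, norm_add_sq_real, inner_smul_left, inner_smul_right, hνN, hN.1,
      Real.norm_eq_abs, sq_abs] at h4
    have h5 : ‖δ x‖ ^ 2 * (k x ^ 2 * ‖ν‖ ^ 2 + η x ^ 2) = ‖δ x‖ ^ 2 * 1 := by
      rw [mul_one]; simp at h4; linarith
    have h6 := mul_left_cancel₀ (pow_ne_zero 2 h3) h5
    field_simp
    linarith
  have tk : Tendsto (fun x => k x ^ 2) l (𝓝 (1 / ‖ν‖ ^ 2)) := by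
    have h1 : Tendsto (fun x => (1 - η x ^ 2) / ‖ν‖ ^ 2) l (𝓝 ((1 - 0 ^ 2) / ‖ν‖ ^ 2)) :=
      (tendsto_const_nhds.sub (tη.pow 2)).div_const _
    rw [show (1 - 0 ^ 2 : ℝ) = 1 by norm_num] at h1
    refine h1.congr' ?_
    filter_upwards [ek] with x h using h.symm
  set s : E3 → ℂ := fun x => C.side x / (‖δ x‖ : ℝ) with hs
  set A : E3 → ℂ := fun x => s x - k x * C.sideD q ν with hA
  set err : E3 → ℝ := fun x => inner ℝ (δ x) ((x - q) + (C.foot q x - q)) / ‖δ x‖ with herr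
  have terr : Tendsto err l (𝓝 0) := by
    have h1 : Tendsto (fun x : E3 => ‖(x - q) + (C.foot q x - q)‖) l (𝓝 0) := by
      have : Continuous fun x : E3 => ‖(x - q) + (C.foot q x - q)‖ := by
        have := C.continuous_foot (q := q)
        fun_prop
      have h2 := this.tendsto q
      simp only [foot_self, sub_self, add_zero, norm_zero] at h2
      exact h2.mono_left hlq
    refine squeeze_zero_norm' ?_ h1
    filter_upwards [eδ] with x h2
    have h3 : 0 < ‖δ x‖ := norm_pos_iff.2 h2
    rw [herr, Real.norm_eq_abs, abs_div, abs_norm, div_le_iff₀ h3, mul_comm]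
    exact abs_real_inner_le_norm _ _
  have eA : ∀ᶠ x in l, A x = η x * C.sideD q N + err x * Complex.I := by
    filter_upwards [eδ, eexp] with x h1 h2
    have h3 : (‖δ x‖ : ℂ) ≠ 0 := by exact_mod_cast norm_ne_zero_iff.2 h1
    have h4 := C.side_sub_side q x (C.foot q x)
    rw [side_eq_zero_iff.2 (foot_mem hq), sub_zero] at h4
    have h5 : C.sideD q (x - C.foot q x) =
        ‖δ x‖ * (k x * C.sideD q ν + η x * C.sideD q N) := by
      rw [← sideD_smul, ← sideD_smul, ← sideD_add, ← sideD_smul, ← h2]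
    rw [h5] at h4
    have h6 : (inner ℝ (x - C.foot q x) ((x - q) + (C.foot q x - q)) : ℝ) = ‖δ x‖ * err x := by
      simp only [herr]
      rw [mul_div_cancel₀ _ (norm_ne_zero_iff.2 h1)]
    rw [h6] at h4
    simp only [hA, hs, h4]
    push_cast
    field_simp
    ring
  have tA : Tendsto A l (𝓝 0) := by
    have h1 : Tendsto (fun x => (η x : ℂ) * C.sideD q N + err x * Complex.I) l
        (𝓝 (((0 : ℝ) : ℂ) * C.sideD q N + ((0 : ℝ) : ℂ) * Complex.I)) :=
      (((Complex.continuous_ofReal.tendsto 0).comp tη).mul_const _).add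
        (((Complex.continuous_ofReal.tendsto 0).comp terr).mul_const _)
    simp only [Complex.ofReal_zero, zero_mul, add_zero] at h1
    exact h1.congr' (by filter_upwards [eA] with x h using h.symm)
  have tkA : Tendsto (fun x => (k x : ℂ) * A x) l (𝓝 0) := by
    have h1 : Tendsto (fun x => (1 / ‖ν‖ ^ 2 + 1 + 1) * ‖A x‖) l (𝓝 0) := by
      have := tA.norm.const_mul (1 / ‖ν‖ ^ 2 + 1 + 1)
      rwa [norm_zero, mul_zero] at this
    refine squeeze_zero_norm' ?_ h1
    filter_upwards [tk.eventually_lt_const (show 1 / ‖ν‖ ^ 2 < 1 / ‖ν‖ ^ 2 + 1 by linarith)] with x hx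
    rw [norm_mul, Complex.norm_real, Real.norm_eq_abs]
    gcongr
    nlinarith [sq_abs (k x), sq_nonneg (|k x| - 1), abs_nonneg (k x)]
  have ts : Tendsto (fun x => s x ^ 2) l (𝓝 (((1 / ‖ν‖ ^ 2 : ℝ) : ℂ) * C.sideD q ν ^ 2)) := by
    have h1 : Tendsto (fun x => ((k x ^ 2 : ℝ) : ℂ) * C.sideD q ν ^ 2 +
        (2 * (k x * A x) * C.sideD q ν + A x ^ 2)) l
        (𝓝 (((1 / ‖ν‖ ^ 2 : ℝ) : ℂ) * C.sideD q ν ^ 2 + (2 * 0 * C.sideD q ν + 0 ^ 2))) :=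
      (((Complex.continuous_ofReal.tendsto _).comp tk).mul_const _).add
        (((tkA.const_mul 2).mul_const _).add (tA.pow 2))
    rw [show (2 * 0 * C.sideD q ν + 0 ^ 2) = (0 : ℂ) by ring, add_zero] at h1
    refine h1.congr fun x => ?_
    simp only [hA]
    push_cast
    ring
  have he := sideD_ne_zero hq hντ hν
  have hlim : ((1 / ‖ν‖ ^ 2 : ℝ) : ℂ) * C.sideD q ν ^ 2 ≠ 0 :=
    mul_ne_zero (by exact_mod_cast one_div_ne_zero hν2) (pow_ne_zero 2 he)
  have hn : (‖((1 / ‖ν‖ ^ 2 : ℝ) : ℂ) * C.sideD q ν ^ 2‖ : ℂ) ≠ 0 := by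
    exact_mod_cast norm_ne_zero_iff.2 hlim
  have h1 := ts.div ((Complex.continuous_ofReal.tendsto _).comp ts.norm) hn
  have h2 : ((1 / ‖ν‖ ^ 2 : ℝ) : ℂ) * C.sideD q ν ^ 2 /
      (‖((1 / ‖ν‖ ^ 2 : ℝ) : ℂ) * C.sideD q ν ^ 2‖ : ℂ) =
      C.sideD q ν ^ 2 / (‖C.sideD q ν‖ ^ 2 : ℝ) := by
    rw [norm_mul, norm_pow, Complex.norm_real, Real.norm_of_nonneg (by positivity),
      Complex.ofReal_mul, mul_div_mul_left]
    exact_mod_cast one_div_ne_zero hν2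
  rw [← h2]
  refine h1.congr' ?_
  filter_upwards [eδ] with x hx
  have h3 : (‖δ x‖ : ℂ) ≠ 0 := by exact_mod_cast norm_ne_zero_iff.2 hx
  simp only [hs, Function.comp_def, Pi.div_apply]
  rw [norm_pow, norm_div, Complex.norm_real, norm_norm, div_pow, div_pow, Complex.ofReal_div,
    Complex.ofReal_pow ‖δ x‖, div_div_div_cancel_right₀ (pow_ne_zero 2 h3)]

end Circ

theorem isEmbedding_circle_coe : IsEmbedding (fun z : Circle => (z : ℂ)) :=
  IsEmbedding.subtypeVal

namespace Circ
variable {C D : Circ} {p q x y v w N ν : E3} {Φ : Set E3}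

/-- Real linear combinations of the two components of `side` form the pencil of spheres and planes
through the circle. -/
theorem quad_eq_re (hq : q ∈ C.carrier) (e : ℂ) (x : E3) :
    quad (e.re • C.n + (2 * e.im) • (q - C.c)) e.im q x =
      e.re * (C.side x).re + e.im * (C.side x).im := by
  obtain ⟨h1, h2⟩ := C.mem_carrier.1 hq
  have h : x - C.c = (x - q) + (q - C.c) := by abel
  rw [quad, side, inner_add_left, inner_smul_left, inner_smul_left, h, norm_add_sq_real,
    inner_add_left, h1, h2, real_inner_comm (x - q) C.n, real_inner_comm (x - q) (q - C.c)]
  simp only [conj_trivial]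
  ring

/-- Orthogonality makes `z` a real multiple of i · e, and squaring turns i into -1. -/
theorem sq_div_eq_neg {e z : ℂ} (he : e ≠ 0) (hz : z ≠ 0) (h : e.re * z.re + e.im * z.im = 0) :
    z ^ 2 / (‖z‖ ^ 2 : ℝ) = -(e ^ 2 / (‖e‖ ^ 2 : ℝ)) := by
  have h1 : (‖z‖ ^ 2 : ℝ) ≠ 0 := pow_ne_zero 2 (norm_ne_zero_iff.2 hz)
  have h2 : (‖e‖ ^ 2 : ℝ) ≠ 0 := pow_ne_zero 2 (norm_ne_zero_iff.2 he)
  have h1' : ((‖z‖ ^ 2 : ℝ) : ℂ) ≠ 0 := by exact_mod_cast h1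
  have h2' : ((‖e‖ ^ 2 : ℝ) : ℂ) ≠ 0 := by exact_mod_cast h2
  rw [div_eq_iff h1', neg_mul, div_mul_eq_mul_div, eq_comm, neg_eq_iff_eq_neg, div_eq_iff h2']
  rw [Complex.sq_norm, Complex.sq_norm, Complex.normSq_apply, Complex.normSq_apply]
  apply Complex.ext
  · simp [pow_two]
    linear_combination (2 * (e.re * z.re - e.im * z.im)) * h
  · simp [pow_two]
    linear_combination (2 * (e.re * z.im + e.im * z.re)) * h

/-- Near a point `q` of a circle `C` on a surface there is a sphere or plane through `C` that meets
the surface only in `C`; its gradient at `q` is on the side of the given conormal `ν`. -/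
theorem exists_side_quad (hN : IsNormalAt Φ q N) (hC : C.carrier ⊆ Φ) (hq : q ∈ C.carrier)
    (hντ : inner ℝ ν (C.tan q) = 0) (hνN : inner ℝ ν N = 0) (hν : ν ≠ 0) :
    ∃ (w : E3) (b : ℝ), (∀ x ∈ C.carrier, quad w b q x = 0) ∧ 0 < inner ℝ w ν ∧
      inner ℝ w (C.tan q) = 0 ∧ ∀ᶠ x in 𝓝[Φ] q, quad w b q x = 0 → x ∈ C.carrier := by
  set e := C.sideD q ν with he
  have he0 : e ≠ 0 := sideD_ne_zero hq hντ hν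
  refine ⟨e.re • C.n + (2 * e.im) • (q - C.c), e.im, fun x hx => ?_, ?_, ?_, ?_⟩
  · rw [quad_eq_re hq, side_eq_zero_iff.2 hx]; simp
  · have h1 : inner ℝ (e.re • C.n + (2 * e.im) • (q - C.c)) ν = e.re ^ 2 + e.im ^ 2 := by
      rw [inner_add_left, inner_smul_left, inner_smul_left, real_inner_comm ν C.n,
        real_inner_comm ν (q - C.c)]
      simp only [he, sideD, conj_trivial]
      ring
    rw [h1]
    have h2 := Complex.normSq_pos.2 he0
    rw [Complex.normSq_apply] at h2
    linarith
  · rw [inner_add_left, inner_smul_left, inner_smul_left, real_inner_comm, inner_tan_n,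
      real_inner_comm, inner_tan_sub]
    simp
  -- A point of the surface on this sphere but off `C` would have squared direction opposite to the
  -- limit, hence at distance 2 from it.
  · have h1 := (Metric.tendsto_nhds.1 (tendsto_side_sq hN hC hq hντ hνN hν)) 1 zero_lt_one
    rw [Set.sdiff_eq, nhdsWithin_inter', eventually_inf_principal] at h1
    filter_upwards [h1] with x hx h2
    by_contra h3
    have h4 := hx h3
    rw [quad_eq_re hq] at h2
    rw [sq_div_eq_neg he0 (fun h => h3 (side_eq_zero_iff.1 h)) h2, dist_eq_norm, ← neg_add',
      norm_neg, ← two_mul, norm_mul, norm_div, norm_pow, Complex.norm_real, norm_pow, norm_norm,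
      div_self (pow_ne_zero 2 (norm_ne_zero_iff.2 he0))] at h4
    norm_num at h4

/-- The tangent plane is spanned by the tangent and the conormal of `C`; as `w` kills only the
first, its kernel there is the tangent line of `C`. -/
theorem inner_ne_zero_of_not_tangent (hN : IsNormalAt Φ q N) (hC : C.carrier ⊆ Φ)
    (hD : D.carrier ⊆ Φ) (hqC : q ∈ C.carrier) (hqD : q ∈ D.carrier) (ht : ¬ C.Tangent D q)
    (hw : inner ℝ w (C.tan q) = 0) (hwν : inner ℝ w (crossE N (C.tan q)) ≠ 0) :
    inner ℝ w (D.tan q) ≠ 0 := by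
  intro h0
  have h1 := norm_sq_crossE_smul N (C.tan q) (D.tan q)
  have hNC := hN.inner_tan hC hqC
  have hND := hN.inner_tan hD hqD
  rw [norm_sq_crossE, hNC, hN.1, norm_tan hqC, real_inner_comm N (D.tan q), hND, real_inner_self_eq_norm_sq,
    real_inner_self_eq_norm_sq, hN.1, norm_tan hqC] at h1
  simp only [mul_zero, sub_zero, zero_mul, zero_smul, zero_add, one_pow, mul_one, one_mul,
    ne_eq, OfNat.ofNat_ne_zero, not_false_eq_true, zero_pow] at h1
  have h2 := congrArg (fun z => inner ℝ w z) h1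
  simp only [inner_smul_right, inner_add_right, h0, hw, mul_zero, add_zero] at h2
  have h3 := (mul_eq_zero.1 h2.symm).resolve_right hwν
  rw [h3, zero_smul, zero_add] at h1
  have hr := (pow_pos C.r_pos 2).ne'
  have h4 : D.tan q = ((C.r ^ 2)⁻¹ * inner ℝ (D.tan q) (C.tan q)) • C.tan q := by
    rw [mul_smul, ← h1, smul_smul, inv_mul_cancel₀ hr, one_smul]
  refine ht ⟨_, fun h5 => ?_, h4⟩
  rw [h5, zero_smul] at h4
  exact tan_ne_zero hqD h4

theorem crossE_conormal (hN : IsNormalAt Φ q N) (hC : C.carrier ⊆ Φ) (hq : q ∈ C.carrier) :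
    inner ℝ (crossE N (C.tan q)) (C.tan q) = 0 ∧ inner ℝ (crossE N (C.tan q)) N = 0 ∧
      crossE N (C.tan q) ≠ 0 := by
  refine ⟨inner_crossE_right _ _, inner_crossE_left _ _, fun h => ?_⟩
  have h1 := norm_sq_crossE N (C.tan q)
  rw [h, hN.inner_tan hC hq, hN.1, norm_tan hq] at h1
  have := C.r_pos
  simp at h1
  nlinarith

/-- A different circle through `b` shares at most two points with `C`, so it leaves `C` arbitrarily
close to `b`. This density is what allows extension by limits across `C`. -/
theorem subset_closure_sdiff (h : ∀ b ∈ C.carrier, ∃ D : Circ, b ∈ D.carrier ∧ D.carrier ⊆ Φ ∧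
    D.carrier ≠ C.carrier) : Φ ⊆ closure (Φ \ C.carrier) := by
  intro b hb
  by_cases hbC : b ∈ C.carrier
  swap
  · exact subset_closure ⟨hb, hbC⟩
  obtain ⟨D, hbD, hD, hne⟩ := h b hbC
  rw [mem_closure_iff_frequently]
  have ht : Tendsto (D.pt b) (𝓝[>] 0) (𝓝 b) := by
    have := (D.continuous_pt (x := b)).tendsto 0
    rw [D.pt_zero] at this
    exact this.mono_left nhdsWithin_le_nhds
  refine ht.frequently ?_
  by_contra hcon
  rw [not_frequently] at hcon
  have h2 : ∀ᶠ t in 𝓝[>] (0 : ℝ), D.pt b t ∈ C.carrier := by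
    filter_upwards [hcon] with t ht'
    by_contra h3
    exact ht' ⟨hD (pt_mem hbD t), h3⟩
  obtain ⟨u, hu, hu'⟩ := mem_nhdsGT_iff_exists_Ioo_subset.1 h2
  have hu0 : 0 < u := hu
  set s := min u Real.pi with hs
  have hs0 : 0 < s := lt_min hu0 Real.pi_pos
  have hsu : s ≤ u := min_le_left _ _
  have hsp : s ≤ Real.pi := min_le_right _ _
  have m1 : D.pt b (s / 2) ∈ C.carrier := hu' ⟨by linarith, by linarith⟩
  have m2 : D.pt b (s / 3) ∈ C.carrier := hu' ⟨by linarith, by linarith⟩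
  have key : ∀ s' t' : ℝ, 0 ≤ s' → s' ≤ Real.pi → 0 ≤ t' → t' ≤ Real.pi →
      D.pt b s' = D.pt b t' → s' = t' := fun s' t' a1 a2 a3 a4 h =>
    Real.injOn_cos ⟨a1, a2⟩ ⟨a3, a4⟩ (pt_injOn hbD h).1
  refine hne (eq_of_three (pt_mem hbD 0) (pt_mem hbD (s / 2)) (pt_mem hbD (s / 3)) ?_ ?_ ?_
    (by rwa [D.pt_zero]) m1 m2)
  · intro h; have := key _ _ (by linarith) (by linarith) (by linarith) (by linarith) h; linarith
  · intro h; have := key _ _ (by linarith) (by linarith) (by linarith) (by linarith) h; linarith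
  · intro h; have := key _ _ (by linarith) (by linarith) (by linarith) (by linarith) h; linarith

theorem coe_exp_two_mul_arg {z : ℂ} (hz : z ≠ 0) :
    (Circle.exp (2 * z.arg) : ℂ) = z ^ 2 / (‖z‖ ^ 2 : ℝ) := by
  have h : (‖z‖ : ℂ) ≠ 0 := by exact_mod_cast norm_ne_zero_iff.2 hz
  conv_rhs => rw [← Complex.norm_mul_exp_arg_mul_I z]
  rw [Circle.coe_exp, mul_pow, ← Complex.exp_nat_mul, norm_mul, Complex.norm_exp_ofReal_mul_I,
    Complex.norm_real, norm_norm, mul_one]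
  push_cast
  rw [mul_div_cancel_left₀ _ (pow_ne_zero 2 h), mul_assoc]

/-- The squared direction of `Circ.side` extends to a continuous map from the surface to the unit
circle. -/
theorem exists_sideMap (hΦ : IsSmoothClosedSurface Φ) (hC : C.carrier ⊆ Φ)
    (hd : Φ ⊆ closure (Φ \ C.carrier)) :
    ∃ m : Φ → Circle, Continuous m ∧
      ∀ x : Φ, (m x : ℂ) * (‖C.side x‖ ^ 2 : ℝ) = C.side x ^ 2 := by
  set f : E3 → Circle := fun x => Circle.exp (2 * (C.side x).arg) with hf
  have hfx : ∀ x, C.side x ≠ 0 → (f x : ℂ) = C.side x ^ 2 / (‖C.side x‖ ^ 2 : ℝ) :=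
    fun x hx => coe_exp_two_mul_arg hx
  have hfe : ∀ x, (fun x => (f x : ℂ)) =ᶠ[𝓝[Φ \ C.carrier] x]
      fun x => C.side x ^ 2 / (‖C.side x‖ ^ 2 : ℝ) := by
    intro x
    filter_upwards [self_mem_nhdsWithin] with y hy
    exact hfx y fun h => hy.2 (side_eq_zero_iff.1 h)
  have h1 : ∀ x, x ∉ C.carrier → Tendsto f (𝓝[Φ \ C.carrier] x) (𝓝 (f x)) := by
    intro x hx
    have hx0 : C.side x ≠ 0 := fun h => hx (side_eq_zero_iff.1 h)
    rw [isEmbedding_circle_coe.tendsto_nhds_iff]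
    change Tendsto (fun x => (f x : ℂ)) _ (𝓝 (f x : ℂ))
    rw [hfx x hx0]
    refine Tendsto.congr' (hfe x).symm ?_
    have hs := (C.continuous_side).tendsto x
    have h3 : ((‖C.side x‖ ^ 2 : ℝ) : ℂ) ≠ 0 := by
      exact_mod_cast pow_ne_zero 2 (norm_ne_zero_iff.2 hx0)
    exact ((hs.pow 2).div ((Complex.continuous_ofReal.tendsto _).comp (hs.norm.pow 2)) h3).mono_left
      nhdsWithin_le_nhds
  have h2 : ∀ x ∈ Φ, ∃ y, Tendsto f (𝓝[Φ \ C.carrier] x) (𝓝 y) := by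
    intro x hx
    by_cases hxC : x ∈ C.carrier
    swap
    · exact ⟨_, h1 x hxC⟩
    obtain ⟨N, hN, -⟩ := hΦ.exists_normal hx
    obtain ⟨a1, a2, a3⟩ := crossE_conormal hN hC hxC
    refine ⟨Circle.exp (2 * (C.sideD x (crossE N (C.tan x))).arg), ?_⟩
    rw [isEmbedding_circle_coe.tendsto_nhds_iff]
    simp only [Function.comp_def]
    rw [coe_exp_two_mul_arg (sideD_ne_zero hxC a1 a3)]
    exact Tendsto.congr' (hfe x).symm (tendsto_side_sq hN hC hxC a1 a2 a3)
  -- On `C` the required identity reads 0 = 0, whatever the limit value.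
  refine ⟨fun x => extendFrom (Φ \ C.carrier) f x, ?_, fun x => ?_⟩
  · exact continuousOn_iff_continuous_domRestrict.1 (continuousOn_extendFrom hd h2)
  · by_cases hxC : (x : E3) ∈ C.carrier
    · rw [side_eq_zero_iff.2 hxC]; simp
    · have hx0 : C.side x ≠ 0 := fun h => hxC (side_eq_zero_iff.1 h)
      have h3 : ((‖C.side x‖ ^ 2 : ℝ) : ℂ) ≠ 0 := by
        exact_mod_cast pow_ne_zero 2 (norm_ne_zero_iff.2 hx0)
      have h4 : extendFrom (Φ \ C.carrier) f x = f x := extendFrom_eq (hd x.2) (h1 x hxC)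
      simp only [h4]
      rw [hfx _ hx0, div_mul_cancel₀ _ h3]

end Circ

/-! ### Lifting of angles and winding numbers mod 2. -/

section Winding
open Real

theorem exists_circle_lift {X : Type*} [TopologicalSpace X] [SimplyConnectedSpace X]
    [LocallyPathConnectedSpace X] {m : X → Circle} (hm : Continuous m) :
    ∃ θ : X → ℝ, Continuous θ ∧ ∀ x, Circle.exp (θ x) = m x := by
  have : Fact (0 < 2 * π) := ⟨Real.two_pi_pos⟩
  obtain ⟨x₀⟩ : Nonempty X := inferInstance
  set f : C(X, AddCircle (2 * π)) :=
    ⟨fun x => AddCircle.homeomorphCircle'.symm (m x), by fun_prop⟩ with hf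
  obtain ⟨e₀, he₀⟩ := QuotientAddGroup.mk_surjective (f x₀)
  obtain ⟨F, ⟨-, hF⟩, -⟩ :=
    (AddCircle.isCoveringMap_coe (2 * π)).existsUnique_continuousMap_lifts f x₀ e₀ he₀
  refine ⟨F, F.continuous, fun x => ?_⟩
  have h1 : ((F x : ℝ) : AddCircle (2 * π)) = AddCircle.homeomorphCircle'.symm (m x) :=
    congrFun hF x
  rw [← AddCircle.homeomorphCircle'_apply_mk, h1, Homeomorph.apply_symm_apply]

theorem circle_lift_unique {X : Type*} [TopologicalSpace X] [PreconnectedSpace X] {θ θ' : X → ℝ}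
    (h : Continuous θ) (h' : Continuous θ') (he : ∀ x, Circle.exp (θ' x) = Circle.exp (θ x)) :
    ∃ k : ℤ, ∀ x, θ' x = θ x + k * (2 * π) := by
  choose k hk using fun x => Circle.exp_eq_exp.1 (he x)
  have hc : Continuous k := by
    rw [Int.isClosedEmbedding_coe_real.isEmbedding.continuous_iff]
    have : ((fun n : ℤ => (n : ℝ)) ∘ k) = fun x => (θ' x - θ x) / (2 * π) := by
      funext x
      rw [Function.comp_apply, hk x]
      field_simp
      ring
    rw [this]
    fun_prop
  rcases isEmpty_or_nonempty X with hX | ⟨⟨x₀⟩⟩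
  · exact ⟨0, fun x => (hX.false x).elim⟩
  · refine ⟨k x₀, fun x => ?_⟩
    rw [PreconnectedSpace.constant inferInstance hc (x := x₀) (y := x)]
    exact hk x

/-- The winding number of the restriction of `f : ℝ → Circle` to a period is even. -/
def EvenWinding (f : ℝ → Circle) : Prop :=
  ∃ θ : ℝ → ℝ, Continuous θ ∧ (∀ t, Circle.exp (θ t) = f t) ∧
    ∃ k : ℤ, Even k ∧ θ (2 * π) = θ 0 + k * (2 * π)

theorem im_eq_zero_of_sq_eq {z : ℂ} {s : ℝ} (hs : 0 ≤ s) (h : z ^ 2 = s) : z.im = 0 := by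
  rw [Complex.ext_iff] at h
  simp [pow_two] at h
  obtain ⟨h1, h2⟩ := h
  have h3 : z.re * z.im = 0 := by linarith
  rcases mul_eq_zero.1 h3 with h4 | h4
  · rw [h4] at h1
    nlinarith
  · exact h4

/-- Rotation by minus half the angle of the squared direction puts `z` on the real line. A
continuous angle thus gives a continuous real function with the same zeros, to which sign arguments
apply. -/
theorem eq_re_mul_of_circle {z : ℂ} {θ : ℝ}
    (h : (Circle.exp θ : ℂ) * (‖z‖ ^ 2 : ℝ) = z ^ 2) :
    ((z * (Circle.exp (-(θ / 2)) : ℂ)).re : ℂ) = z * (Circle.exp (-(θ / 2)) : ℂ) := by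
  have h1 : (z * (Circle.exp (-(θ / 2)) : ℂ)) ^ 2 = (‖z‖ ^ 2 : ℝ) := by
    rw [mul_pow, ← h]
    have : (Circle.exp θ : ℂ) * (Circle.exp (-(θ / 2)) : ℂ) ^ 2 = 1 := by
      rw [pow_two, ← Circle.coe_mul, ← Circle.coe_mul, ← Circle.exp_add, ← Circle.exp_add]
      rw [show θ + (-(θ / 2) + -(θ / 2)) = 0 by ring]
      simp
    linear_combination (‖z‖ ^ 2 : ℝ) * this
  have h2 := im_eq_zero_of_sq_eq (sq_nonneg _) h1
  apply Complex.ext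
  · simp
  · rw [h2]; simp

/-- A closed curve with values in `ℂ` that vanishes exactly once in a period, with nonzero velocity,
and whose squared direction extends continuously, has odd winding number of squared directions. -/
theorem not_evenWinding_of_simple_zero {f : ℝ → ℂ} {μ : ℝ → Circle} {v : ℂ} (hf : Continuous f)
    (hper : ∀ t, f (t + 2 * π) = f t) (hμ : ∀ t, (μ t : ℂ) * (‖f t‖ ^ 2 : ℝ) = f t ^ 2)
    (h0 : f 0 = 0) (hv : HasDerivAt f v 0) (hv0 : v ≠ 0) (hne : ∀ t ∈ Set.Ioo 0 (2 * π), f t ≠ 0) :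
    ¬ EvenWinding μ := by
  rintro ⟨θ, hθ, hθμ, k, hk, hk'⟩
  set e : ℝ → ℂ := fun t => (Circle.exp (-(θ t / 2)) : ℂ) with he
  have hec : Continuous e := by
    have h1 : Continuous fun t => Circle.exp (-(θ t / 2)) := by fun_prop
    exact isEmbedding_circle_coe.continuous.comp h1
  have hen : ∀ t, ‖e t‖ = 1 := fun t => Circle.norm_coe _
  have hene : ∀ t, e t ≠ 0 := fun t => Circle.coe_ne_zero _
  set ρ : ℝ → ℝ := fun t => (f t * e t).re with hρ
  have hρc : Continuous ρ := Complex.continuous_re.comp (hf.mul hec)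
  have hρe : ∀ t, (ρ t : ℂ) = f t * e t := fun t =>
    eq_re_mul_of_circle (by rw [hθμ]; exact hμ t)
  have hρne : ∀ t ∈ Set.Ioo 0 (2 * π), ρ t ≠ 0 := by
    intro t ht h1
    have h2 := hρe t
    rw [h1, Complex.ofReal_zero, eq_comm] at h2
    exact (mul_ne_zero (hne t ht) (hene t)) h2
  have hpos : ∀ s ∈ Set.Ioo 0 (2 * π), ∀ t ∈ Set.Ioo 0 (2 * π), 0 < ρ s * ρ t := by
    intro s hs t ht
    by_contra hcon
    have h1 : ρ s * ρ t < 0 := lt_of_le_of_ne (not_lt.1 hcon) (mul_ne_zero (hρne s hs) (hρne t ht))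
    have h2 : (0 : ℝ) ∈ Set.uIcc (ρ s) (ρ t) := by
      rcases mul_neg_iff.1 h1 with ⟨a, b⟩ | ⟨a, b⟩
      · exact Set.mem_uIcc.2 (Or.inr ⟨b.le, a.le⟩)
      · exact Set.mem_uIcc.2 (Or.inl ⟨a.le, b.le⟩)
    obtain ⟨r, hr, hr0⟩ := intermediate_value_uIcc (hρc.continuousOn) h2
    exact hρne r ((Set.ordConnected_Ioo.uIcc_subset hs ht) hr) hr0
  -- Evenness enters here: half of the angle changes by a multiple of 2π.
  have he2 : e (2 * π) = e 0 := by
    obtain ⟨j, hj⟩ := hk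
    simp only [he]
    rw [hk', show -((θ 0 + k * (2 * π)) / 2) = -(θ 0 / 2) + ((-j : ℤ) : ℝ) * (2 * π) by
      rw [hj]; push_cast; ring, Circle.exp_add, Circle.exp_int_mul_two_pi, mul_one]
  set l := 𝓝[>] (0 : ℝ) with hl
  have hl' : l ≤ 𝓝[≠] 0 := nhdsWithin_mono _ fun t ht => ne_of_gt ht
  have hl0 : Tendsto (fun t : ℝ => t) l (𝓝 0) := tendsto_id.mono_left nhdsWithin_le_nhds
  have s1 : Tendsto (fun t : ℝ => t⁻¹ • f t) l (𝓝 v) := by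
    have := hasDerivAt_iff_tendsto_slope_zero.1 hv
    simp only [zero_add, h0, sub_zero] at this
    exact this.mono_left hl'
  have s2 : Tendsto (fun t : ℝ => (-t)⁻¹ • f (2 * π - t)) l (𝓝 v) := by
    have := hasDerivAt_iff_tendsto_slope_zero.1 hv
    simp only [zero_add, h0, sub_zero] at this
    have hneg : Tendsto (fun t : ℝ => -t) l (𝓝[≠] 0) := by
      refine tendsto_nhdsWithin_iff.2 ⟨by simpa using hl0.neg, ?_⟩
      filter_upwards [self_mem_nhdsWithin] with t ht
      exact neg_ne_zero.2 (ne_of_gt ht)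
    refine (this.comp hneg).congr fun t => ?_
    rw [Function.comp_apply, ← hper (-t), show -t + 2 * π = 2 * π - t by ring]
  have t1 : Tendsto (fun t : ℝ => ((t⁻¹ * ρ t : ℝ) : ℂ)) l (𝓝 (v * e 0)) := by
    refine (s1.mul ((hec.tendsto 0).comp hl0)).congr fun t => ?_
    rw [Complex.ofReal_mul, hρe, Function.comp_apply, Complex.real_smul, mul_assoc]
  have t2 : Tendsto (fun t : ℝ => (((-t)⁻¹ * ρ (2 * π - t) : ℝ) : ℂ)) l (𝓝 (v * e 0)) := by
    have h3 : Tendsto (fun t : ℝ => 2 * π - t) l (𝓝 (2 * π)) := by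
      simpa using hl0.const_sub (2 * π)
    have h4 := (hec.tendsto (2 * π)).comp h3
    rw [he2] at h4
    refine (s2.mul h4).congr fun t => ?_
    rw [Complex.ofReal_mul, hρe, Function.comp_apply, Complex.real_smul, mul_assoc]
  have r1 := (Complex.continuous_re.tendsto _).comp t1
  have r2 := (Complex.continuous_re.tendsto _).comp t2
  have i1 := (Complex.continuous_im.tendsto _).comp t1
  simp only [Function.comp_def, Complex.ofReal_re, Complex.ofReal_im] at r1 r2 i1
  have him : (v * e 0).im = 0 := tendsto_nhds_unique i1 tendsto_const_nhds
  have hL : (v * e 0).re ≠ 0 := fun h =>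
    mul_ne_zero hv0 (hene 0) (Complex.ext h him)
  -- `ρ` keeps one sign inside the period, but equal nonzero slopes at its two ends would force
  -- opposite signs.
  have hle : (v * e 0).re * (v * e 0).re ≤ 0 := by
    refine le_of_tendsto (r1.mul r2) ?_
    have hev : ∀ᶠ t in l, t ∈ Set.Ioo (0 : ℝ) (2 * π) := Ioo_mem_nhdsGT Real.two_pi_pos
    filter_upwards [hev] with t ht
    have h5 := hpos t ht (2 * π - t) ⟨by linarith [ht.2], by linarith [ht.1]⟩
    have h6 : 0 < (t⁻¹) ^ 2 := pow_pos (inv_pos.2 ht.1) 2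
    rw [inv_neg]
    nlinarith [mul_pos h6 h5]
  exact hL (by nlinarith [mul_self_nonneg (v * e 0).re] : (v * e 0).re = 0)

/-- On a sphere minus a point every circle-valued map is null-homotopic. -/
theorem evenWinding_of_sphere {X : Type*} [TopologicalSpace X]
    (H : X ≃ₜ Metric.sphere (0 : E3) 1) {m : X → Circle} (hm : Continuous m) {g : ℝ → X}
    (hg : Continuous g) (hper : ∀ t, g (t + 2 * π) = g t) {x₀ : X} (hx₀ : ∀ t, g t ≠ x₀) :
    EvenWinding (m ∘ g) := by
  have : Fact (Module.finrank ℝ E3 = 2 + 1) := ⟨by simp⟩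
  set S := stereographic' 2 (H x₀) with hS
  have hSs : Continuous S.symm := by
    have := S.continuousOn_symm
    rw [hS, stereographic'_target] at this
    exact continuousOn_univ.1 this
  obtain ⟨θ, hθ, hθm⟩ := exists_circle_lift (hm.comp (H.symm.continuous.comp hSs))
  have hmem : ∀ t, H (g t) ∈ S.source := by
    intro t
    rw [hS, stereographic'_source]
    exact fun h => hx₀ t (H.injective h)
  refine ⟨fun t => θ (S (H (g t))), ?_, fun t => ?_, 0, by simp, ?_⟩
  · refine hθ.comp ?_
    exact S.continuousOn.comp_continuous (H.continuous.comp hg) hmem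
  · rw [hθm, Function.comp_apply, Function.comp_apply, S.left_inv (hmem t),
      Homeomorph.symm_apply_apply]
    rfl
  · have := hper 0
    rw [zero_add] at this
    simp [this]

end Winding

/-! ### Closed curves on the torus and their self-intersection. -/

section Torus
open Real

/-- The universal covering of the torus. -/
noncomputable def torusProj (z : ℝ × ℝ) : Circle × Circle := (Circle.exp z.1, Circle.exp z.2)

/-- The lattice of deck transformations of `torusProj`. -/
noncomputable def lat (σ : ℤ × ℤ) : ℝ × ℝ := (σ.1 * (2 * π), σ.2 * (2 * π))

theorem continuous_torusProj : Continuous torusProj := by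
  unfold torusProj; fun_prop

theorem lat_add (σ τ : ℤ × ℤ) : lat (σ + τ) = lat σ + lat τ := by
  simp [lat, add_mul]

theorem lat_injective : Function.Injective lat := by
  intro σ τ h
  simp only [lat, Prod.mk.injEq] at h
  have := Real.two_pi_pos.ne'
  exact Prod.ext (by exact_mod_cast mul_right_cancel₀ this h.1)
    (by exact_mod_cast mul_right_cancel₀ this h.2)

theorem torusProj_add_lat (z : ℝ × ℝ) (σ : ℤ × ℤ) : torusProj (z + lat σ) = torusProj z := by
  simp [torusProj, lat, Circle.exp_add]

theorem exists_lat_of_torusProj_eq {z w : ℝ × ℝ} (h : torusProj z = torusProj w) :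
    ∃ σ, z = w + lat σ := by
  simp only [torusProj, Prod.mk.injEq, Circle.exp_eq_exp] at h
  obtain ⟨⟨i, hi⟩, ⟨j, hj⟩⟩ := h
  exact ⟨(i, j), Prod.ext hi hj⟩

/-- The periods of a lift to the universal covering of a circle-valued map on the torus. -/
theorem exists_torus_periods {m : Circle × Circle → Circle} (hm : Continuous m) :
    ∃ (θ : ℝ × ℝ → ℝ) (κ : ℤ × ℤ →+ ℤ), Continuous θ ∧
      (∀ z, Circle.exp (θ z) = m (torusProj z)) ∧
      ∀ z σ, θ (z + lat σ) = θ z + κ σ * (2 * π) := by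
  obtain ⟨θ, hθ, hθm⟩ := exists_circle_lift (hm.comp continuous_torusProj)
  have h1 : ∀ σ : ℤ × ℤ, ∃ k : ℤ, ∀ z, θ (z + lat σ) = θ z + k * (2 * π) := fun σ =>
    circle_lift_unique hθ (by fun_prop) fun z => by
      rw [hθm, hθm, Function.comp_apply, Function.comp_apply, torusProj_add_lat]
  choose κ hκ using h1
  refine ⟨θ, AddMonoidHom.mk' κ fun σ τ => ?_, hθ, hθm, fun z σ => hκ σ z⟩
  have h2 := hκ (σ + τ) 0
  rw [lat_add, ← add_assoc, hκ, hκ] at h2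
  have h3 : ((κ (σ + τ) : ℤ) : ℝ) * (2 * π) = ((κ σ + κ τ : ℤ) : ℝ) * (2 * π) := by
    push_cast; linarith
  exact_mod_cast mul_right_cancel₀ Real.two_pi_pos.ne' h3

/-- The lift of a closed curve on the torus to the universal covering. -/
theorem exists_torus_loop_lift {g : ℝ → Circle × Circle} (hg : Continuous g)
    (hper : ∀ t, g (t + 2 * π) = g t) :
    ∃ (γ : ℝ → ℝ × ℝ) (τ : ℤ × ℤ), Continuous γ ∧ (∀ t, torusProj (γ t) = g t) ∧
      ∀ t, γ (t + 2 * π) = γ t + lat τ := by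
  obtain ⟨a, ha, ha'⟩ := exists_circle_lift (continuous_fst.comp hg)
  obtain ⟨b, hb, hb'⟩ := exists_circle_lift (continuous_snd.comp hg)
  obtain ⟨i, hi⟩ := circle_lift_unique ha (θ' := fun t => a (t + 2 * π)) (by fun_prop) fun t => by
    rw [ha', ha', Function.comp_apply, Function.comp_apply, hper]
  obtain ⟨j, hj⟩ := circle_lift_unique hb (θ' := fun t => b (t + 2 * π)) (by fun_prop) fun t => by
    rw [hb', hb', Function.comp_apply, Function.comp_apply, hper]
  refine ⟨fun t => (a t, b t), (i, j), by fun_prop, fun t => ?_, fun t => ?_⟩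
  · simp [torusProj, ha', hb']
  · simp [lat, hi, hj]

theorem lift_add_int {γ : ℝ → ℝ × ℝ} {τ : ℤ × ℤ} (h : ∀ t, γ (t + 2 * π) = γ t + lat τ) (k : ℤ)
    (t : ℝ) : γ (t + k * (2 * π)) = γ t + lat (k • τ) := by
  induction k using Int.induction_on generalizing t with
  | zero => simp [lat]
  | succ n ih =>
    rw [show t + ((n + 1 : ℤ) : ℝ) * (2 * π) = (t + ((n : ℤ) : ℝ) * (2 * π)) + 2 * π by
      push_cast; ring, h, ih, add_smul, one_smul, lat_add, add_assoc]
  | pred n ih =>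
    have h1 := h (t + ((-n - 1 : ℤ) : ℝ) * (2 * π))
    rw [show t + ((-n - 1 : ℤ) : ℝ) * (2 * π) + 2 * π = t + ((-n : ℤ) : ℝ) * (2 * π) by
      push_cast; ring, ih] at h1
    rw [show (-(n : ℤ)) • τ = (-(n : ℤ) - 1) • τ + τ by rw [sub_smul, one_smul, sub_add_cancel],
      lat_add, ← add_assoc] at h1
    exact (add_right_cancel h1).symm

theorem isClosed_add_lat {K : Set (ℝ × ℝ)} (hK : IsCompact K) (S : Set (ℤ × ℤ)) :
    IsClosed {z | ∃ x ∈ K, ∃ σ ∈ S, z = x + lat σ} := by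
  have hl : IsClosedEmbedding lat := by
    have h1 : IsClosedEmbedding fun n : ℤ => (n : ℝ) * (2 * π) :=
      ((Homeomorph.mulRight₀ (2 * π) Real.two_pi_pos.ne').isClosedEmbedding).comp
        Int.isClosedEmbedding_coe_real
    exact h1.prodMap h1
  have h2 : IsClosed (lat '' S) := hl.isClosedMap S (isClosed_discrete S)
  have h3 : {z | ∃ x ∈ K, ∃ σ ∈ S, z = x + lat σ} = {z | ∃ x ∈ K, ∃ y ∈ lat '' S, x + y = z} := by
    ext z
    constructor
    · rintro ⟨x, hx, σ, hσ, rfl⟩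
      exact ⟨x, hx, _, ⟨σ, hσ, rfl⟩, rfl⟩
    · rintro ⟨x, hx, _, ⟨σ, hσ, rfl⟩, rfl⟩
      exact ⟨x, hx, σ, hσ, rfl⟩
  rw [h3]
  exact h2.add_left_of_isCompact hK

/-- ℤ² is not cyclic; hence a simple closed curve has more than one lift to the plane. -/
theorem exists_notMem_zmultiples (τ : ℤ × ℤ) : ∃ σ, σ ∉ AddSubgroup.zmultiples τ := by
  by_contra! h
  obtain ⟨k, hk⟩ := AddSubgroup.mem_zmultiples_iff.1 (h (1, 0))
  obtain ⟨l, hl⟩ := AddSubgroup.mem_zmultiples_iff.1 (h (0, 1))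
  simp only [Prod.ext_iff, Prod.smul_fst, Prod.smul_snd, smul_eq_mul] at hk hl
  have h1 : k ≠ 0 := by rintro rfl; simp at hk
  have h2 : τ.2 = 0 := (mul_eq_zero.1 hk.2).resolve_left h1
  rw [h2] at hl
  simp at hl

/-- Simple closed curves on the torus are two-sided: if the zero set of `f` is a simple closed curve
and the squared direction of `f` extends continuously to the torus, then it has even winding number
along the curve. -/
theorem even_self_period {f : Circle × Circle → ℂ} (hf : Continuous f)
    {m : Circle × Circle → Circle} (hfm : ∀ x, (m x : ℂ) * (‖f x‖ ^ 2 : ℝ) = f x ^ 2)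
    {g : ℝ → Circle × Circle} (hginj : ∀ s t, g s = g t → ∃ k : ℤ, s = t + k * (2 * π))
    (hzero : ∀ x, f x = 0 ↔ ∃ t, g t = x)
    {θ : ℝ × ℝ → ℝ} {κ : ℤ × ℤ →+ ℤ} (hθ : Continuous θ)
    (hθm : ∀ z, Circle.exp (θ z) = m (torusProj z))
    (hκ : ∀ z σ, θ (z + lat σ) = θ z + κ σ * (2 * π))
    {γ : ℝ → ℝ × ℝ} {τ : ℤ × ℤ} (hγ : Continuous γ) (hγg : ∀ t, torusProj (γ t) = g t)
    (hγτ : ∀ t, γ (t + 2 * π) = γ t + lat τ) : Even (κ τ) := by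
  classical
  by_contra hodd
  rw [Int.not_even_iff_odd] at hodd
  set e : ℝ × ℝ → ℂ := fun z => (Circle.exp (-(θ z / 2)) : ℂ) with he
  have hec : Continuous e := by
    have h1 : Continuous fun t => Circle.exp (-(θ t / 2)) := by fun_prop
    exact isEmbedding_circle_coe.continuous.comp h1
  set ρ : ℝ × ℝ → ℝ := fun z => (f (torusProj z) * e z).re with hρ
  have hρc : Continuous ρ := Complex.continuous_re.comp ((hf.comp continuous_torusProj).mul hec)
  have hρe : ∀ z, (ρ z : ℂ) = f (torusProj z) * e z := fun z =>
    eq_re_mul_of_circle (by rw [hθm]; exact hfm _)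
  -- An odd period turns the half-angle factor by π.
  have hρτ : ∀ z, ρ (z + lat τ) = -ρ z := by
    intro z
    obtain ⟨j, hj⟩ := hodd
    have h1 : e (z + lat τ) = -e z := by
      simp only [he]
      rw [hκ, show -((θ z + κ τ * (2 * π)) / 2) = -(θ z / 2) + (((-j - 1 : ℤ) : ℝ) * (2 * π) + π) by
        rw [hj]; push_cast; ring, Circle.exp_add, Circle.exp_add, Circle.exp_int_mul_two_pi, one_mul,
        Circle.coe_mul]
      simp
    have h2 : (ρ (z + lat τ) : ℂ) = ((-ρ z : ℝ) : ℂ) := by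
      rw [hρe, torusProj_add_lat, h1, Complex.ofReal_neg, hρe]; ring
    exact_mod_cast h2
  set T := AddSubgroup.zmultiples τ with hT
  set K : Set (ℝ × ℝ) := γ '' Set.Icc 0 (2 * π) with hK
  have hKc : IsCompact K := isCompact_Icc.image hγ
  -- `A` is the whole lift γ(ℝ), and `B` is the union of the other lifts of the curve.
  set A : Set (ℝ × ℝ) := {z | ∃ x ∈ K, ∃ σ ∈ (T : Set (ℤ × ℤ)), z = x + lat σ} with hA
  set B : Set (ℝ × ℝ) := {z | ∃ x ∈ K, ∃ σ ∈ (T : Set (ℤ × ℤ))ᶜ, z = x + lat σ} with hB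
  have hAc : IsClosed A := isClosed_add_lat hKc _
  have hBc : IsClosed B := isClosed_add_lat hKc _
  have hred : ∀ t : ℝ, ∃ s ∈ Set.Icc 0 (2 * π), ∃ k : ℤ, t = s + k * (2 * π) := by
    intro t
    refine ⟨toIcoMod Real.two_pi_pos 0 t, ?_, toIcoDiv Real.two_pi_pos 0 t, ?_⟩
    · have := toIcoMod_mem_Ico Real.two_pi_pos 0 t
      rw [zero_add] at this
      exact Set.Ico_subset_Icc_self this
    · have := toIcoMod_add_toIcoDiv_zsmul Real.two_pi_pos 0 t
      rw [zsmul_eq_mul] at this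
      exact this.symm
  have hmemA : ∀ t, ∀ σ ∈ T, γ t + lat σ ∈ A := by
    intro t σ hσ
    obtain ⟨s, hs, k, rfl⟩ := hred t
    refine ⟨γ s, ⟨s, hs, rfl⟩, k • τ + σ,
      T.add_mem (AddSubgroup.zsmul_mem_zmultiples τ k) hσ, ?_⟩
    rw [lift_add_int hγτ, lat_add, add_assoc]
  have hmemB : ∀ t, ∀ σ ∉ T, γ t + lat σ ∈ B := by
    intro t σ hσ
    obtain ⟨s, hs, k, rfl⟩ := hred t
    refine ⟨γ s, ⟨s, hs, rfl⟩, k • τ + σ, fun h => hσ ?_, ?_⟩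
    · exact (T.add_mem_cancel_left (AddSubgroup.zsmul_mem_zmultiples τ k)).1 h
    · rw [lift_add_int hγτ, lat_add, add_assoc]
  have hdisj : ∀ z, z ∈ A → z ∈ B → False := by
    rintro z ⟨_, ⟨s, -, rfl⟩, σ, hσ, rfl⟩ ⟨_, ⟨s', -, rfl⟩, σ', hσ', h⟩
    have h1 := congrArg torusProj h
    rw [torusProj_add_lat, torusProj_add_lat, hγg, hγg] at h1
    obtain ⟨k, rfl⟩ := hginj _ _ h1
    rw [lift_add_int hγτ, add_assoc, add_right_inj, ← lat_add] at h
    rw [← lat_injective h] at hσ'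
    exact hσ' (T.add_mem (AddSubgroup.zsmul_mem_zmultiples τ k) hσ)
  have hcover : ∀ z, ρ z = 0 → z ∈ A ∨ z ∈ B := by
    intro z hz
    have h1 := hρe z
    rw [hz, Complex.ofReal_zero, eq_comm, mul_eq_zero, or_iff_left (Circle.coe_ne_zero _)] at h1
    obtain ⟨t, ht⟩ := (hzero _).1 h1
    rw [← hγg] at ht
    obtain ⟨σ, rfl⟩ := exists_lat_of_torusProj_eq ht.symm
    by_cases hσ : σ ∈ T
    · exact Or.inl (hmemA t σ hσ)
    · exact Or.inr (hmemB t σ hσ)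
  have hAτ : (fun z => z + lat τ) '' A = A := by
    have hτ : τ ∈ T := AddSubgroup.mem_zmultiples τ
    ext z
    constructor
    · rintro ⟨_, ⟨x, hx, σ, hσ, rfl⟩, rfl⟩
      exact ⟨x, hx, σ + τ, T.add_mem hσ hτ, by simp only [lat_add, add_assoc]⟩
    · rintro ⟨x, hx, σ, hσ, rfl⟩
      refine ⟨x + lat (σ - τ), ⟨x, hx, σ - τ, T.sub_mem hσ hτ, rfl⟩, ?_⟩
      simp only [add_assoc, ← lat_add, sub_add_cancel]
  have hBτ : (fun z => z + lat τ) '' B = B := by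
    have hτ : τ ∈ T := AddSubgroup.mem_zmultiples τ
    ext z
    constructor
    · rintro ⟨_, ⟨x, hx, σ, hσ, rfl⟩, rfl⟩
      exact ⟨x, hx, σ + τ, fun h => hσ ((T.add_mem_cancel_right hτ).1 h),
        by simp only [lat_add, add_assoc]⟩
    · rintro ⟨x, hx, σ, hσ, rfl⟩
      refine ⟨x + lat (σ - τ), ⟨x, hx, σ - τ, fun h => hσ ?_, rfl⟩, ?_⟩
      · simpa using T.add_mem h hτ
      · simp only [add_assoc, ← lat_add, sub_add_cancel]
  have hiso : Isometry fun z : ℝ × ℝ => z + lat τ := isometry_add_right _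
  obtain ⟨σ₁, hσ₁⟩ := exists_notMem_zmultiples τ
  have hAne : A.Nonempty := ⟨_, hmemA 0 0 T.zero_mem⟩
  have hBne : B.Nonempty := ⟨_, hmemB 0 σ₁ hσ₁⟩
  -- A separating function made of distances inherits the invariance of `A` and `B` under
  -- translation by `lat τ`.
  set u : ℝ × ℝ → ℝ := fun z =>
    Metric.infDist z A / (Metric.infDist z A + Metric.infDist z B) with hu
  have hden : ∀ z, Metric.infDist z A + Metric.infDist z B ≠ 0 := by
    intro z h
    have h1 : 0 ≤ Metric.infDist z A := Metric.infDist_nonneg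
    have h2 : 0 ≤ Metric.infDist z B := Metric.infDist_nonneg
    exact hdisj z ((hAc.mem_iff_infDist_zero hAne).2 (by linarith))
      ((hBc.mem_iff_infDist_zero hBne).2 (by linarith))
  have huc : Continuous u :=
    (Metric.continuous_infDist_pt A).div
      ((Metric.continuous_infDist_pt A).add (Metric.continuous_infDist_pt B)) hden
  have huA : ∀ z ∈ A, u z = 0 := by
    intro z hz
    simp only [hu, Metric.infDist_zero_of_mem hz, zero_div]
  have huB : ∀ z ∈ B, u z = 1 := by
    intro z hz
    have := hden z
    simp only [Metric.infDist_zero_of_mem hz, add_zero] at this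
    simp only [hu, Metric.infDist_zero_of_mem hz, add_zero, div_self this]
  have huτ : ∀ z, u (z + lat τ) = u z := by
    intro z
    have h1 := Metric.infDist_image hiso (x := z) (t := A)
    have h2 := Metric.infDist_image hiso (x := z) (t := B)
    rw [hAτ] at h1
    rw [hBτ] at h2
    simp only [hu, h1, h2]
  have hexp : ∀ z, ρ z = 0 → Circle.exp (π * u z) = Circle.exp (-(π * u z)) := by
    intro z hz
    rcases hcover z hz with h | h
    · simp [huA z h]
    · rw [huB z h, Circle.exp_eq_exp]
      exact ⟨1, by push_cast; ring⟩
  -- The branches agree where `ρ` vanishes, because `u` is 0 or 1 there. As translation by `lat τ`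
  -- reverses `ρ` and preserves `u`, it inverts `M`.
  set M : ℝ × ℝ → Circle := fun z =>
    if 0 ≤ ρ z then Circle.exp (π * u z) else Circle.exp (-(π * u z)) with hM
  have hMc : Continuous M := by
    refine Continuous.if_le (by fun_prop) (by fun_prop) continuous_const hρc ?_
    intro z hz
    exact hexp z hz.symm
  have hMτ : ∀ z, M (z + lat τ) * M z = 1 := by
    intro z
    simp only [hM, hρτ, huτ]
    rcases lt_trichotomy (ρ z) 0 with h | h | h
    · rw [if_pos (by linarith), if_neg (by linarith), ← Circle.exp_add]; simp
    · rw [h, neg_zero, if_pos le_rfl]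
      nth_rewrite 2 [hexp z h]
      rw [← Circle.exp_add]; simp
    · rw [if_neg (by linarith), if_pos (by linarith), ← Circle.exp_add]; simp
  obtain ⟨Θ, hΘ, hΘM⟩ := exists_circle_lift hMc
  obtain ⟨k, hk⟩ := circle_lift_unique (θ := fun _ : ℝ × ℝ => (0 : ℝ))
    (θ' := fun z => Θ (z + lat τ) + Θ z) continuous_const (by fun_prop) fun z => by
      rw [Circle.exp_add, hΘM, hΘM, hMτ, Circle.exp_zero]
  have hMconst : ∀ σ : ℤ × ℤ, ∀ t, M (γ t + lat σ) = if σ ∈ T then 1 else Circle.exp π := by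
    intro σ t
    by_cases hσ : σ ∈ T
    · simp [hM, huA _ (hmemA t σ hσ), hσ]
    · have h2 : Circle.exp (-π) = Circle.exp π := Circle.exp_eq_exp.2 ⟨-1, by push_cast; ring⟩
      simp only [hM, huB _ (hmemB t σ hσ), mul_one, h2, ite_self, if_neg hσ]
  -- `Θ` is constant along each lift, and translation by `lat τ` stays on the lift, so 2Θ = 2kπ
  -- there. Then `M` has one value on all lifts, although it is 1 on `A` and -1 on `B`.
  have hΘτ : ∀ σ : ℤ × ℤ, Θ (γ 0 + lat σ) = k * π := by
    intro σ
    obtain ⟨j, hj⟩ := circle_lift_unique (θ := fun _ : ℝ => Θ (γ 0 + lat σ))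
      (θ' := fun t => Θ (γ t + lat σ)) continuous_const (by fun_prop) fun t => by
        rw [hΘM, hΘM, hMconst, hMconst]
    have h1 := hj 0
    have hj0 : (j : ℝ) * (2 * π) = 0 := by linarith
    have h2 := hj (0 + 2 * π)
    rw [hj0, add_zero, hγτ, add_assoc, add_comm (lat τ), ← add_assoc] at h2
    have h3 := hk (γ 0 + lat σ)
    rw [h2] at h3
    linarith
  have h1 := hΘM (γ 0 + lat 0)
  have h2 := hΘM (γ 0 + lat σ₁)
  rw [hΘτ, hMconst, if_pos T.zero_mem] at h1
  rw [hΘτ, hMconst, if_neg hσ₁, h1] at h2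
  exact Circle.exp_pi_ne_one h2.symm

end Torus

/-! ### Parity of intersection of circles through a point. -/

namespace Circ
open Real
variable {C D : Circ} {p q x y v w N ν : E3} {Φ : Set E3}

/-- Two circles through `p` are tangent at `p` or meet in a further point. -/
def EvenAt (C D : Circ) (p : E3) : Prop :=
  C.Tangent D p ∨ ∃ q, q ≠ p ∧ q ∈ C.carrier ∧ q ∈ D.carrier

theorem EvenAt.symm (h : C.EvenAt D p) : D.EvenAt C p := by
  rcases h with h | ⟨q, h1, h2, h3⟩
  · exact Or.inl h.symm
  · exact Or.inr ⟨q, h1, h3, h2⟩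

/-- A circle on `Φ` as a closed curve in `Φ`. -/
noncomputable def loop (D : Circ) (hD : D.carrier ⊆ Φ) (hp : p ∈ D.carrier) (t : ℝ) : Φ :=
  ⟨D.pt p t, hD (pt_mem hp t)⟩

theorem continuous_loop (hD : D.carrier ⊆ Φ) (hp : p ∈ D.carrier) : Continuous (D.loop hD hp) :=
  D.continuous_pt.subtype_mk _

theorem loop_add_two_pi (hD : D.carrier ⊆ Φ) (hp : p ∈ D.carrier) (t : ℝ) :
    D.loop hD hp (t + 2 * π) = D.loop hD hp t := Subtype.ext (D.pt_add_two_pi t)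

theorem hasDerivAt_side_pt (hx : x ∈ D.carrier) (t : ℝ) :
    HasDerivAt (fun s => C.side (D.pt x s)) (C.sideD (D.pt x t) (D.tan (D.pt x t))) t := by
  have h1 := (hasDerivAt_pt hx t).sub_const C.c
  have h2 : HasDerivAt (fun s => (inner ℝ (D.pt x s - C.c) C.n : ℝ))
      (inner ℝ (D.tan (D.pt x t)) C.n) t := by
    simpa using h1.inner ℝ (hasDerivAt_const t C.n)
  have h3 : HasDerivAt (fun s => ‖D.pt x s - C.c‖ ^ 2 - C.r ^ 2)
      (2 * inner ℝ (D.tan (D.pt x t)) (D.pt x t - C.c)) t := by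
    rw [real_inner_comm]
    exact h1.norm_sq.sub_const _
  have h4 := h2.ofReal_comp.add (h3.ofReal_comp.mul_const Complex.I)
  convert! h4 using 1
  · funext s
    apply Complex.ext <;> simp [side, -Complex.ofReal_pow, -Complex.ofReal_sub]
  · apply Complex.ext <;> simp [sideD]

/-- Otherwise `C` and `D` cross only at `p`, transversally, and `C.side` has one simple zero per
turn of `D`. -/
theorem evenAt_of_evenWinding (hpC : p ∈ C.carrier) (hD : D.carrier ⊆ Φ) (hpD : p ∈ D.carrier)
    {m : Φ → Circle} (hm : ∀ x : Φ, (m x : ℂ) * (‖C.side x‖ ^ 2 : ℝ) = C.side x ^ 2)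
    (h : EvenWinding (m ∘ D.loop hD hpD)) : C.EvenAt D p := by
  by_contra hcon
  simp only [EvenAt, not_or, not_exists, not_and] at hcon
  obtain ⟨ht, hq⟩ := hcon
  have hder := hasDerivAt_side_pt (C := C) hpD 0
  rw [D.pt_zero] at hder
  refine not_evenWinding_of_simple_zero (f := fun t => C.side (D.pt p t))
    (C.continuous_side.comp D.continuous_pt) (fun t => by rw [D.pt_add_two_pi])
    (fun t => hm (D.loop hD hpD t)) (by rw [D.pt_zero]; exact side_eq_zero_iff.2 hpC) hder
    (fun h0 => ?_) (fun t ht0 h0 => ?_) h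
  · rw [sideD, Complex.ext_iff] at h0
    exact ht (tangent_of_inner hpC hpD h0.1 (by simpa using h0.2))
  · rw [side_eq_zero_iff] at h0
    refine hq (D.pt p t) (fun h1 => ?_) h0 (pt_mem hpD t)
    rw [← sub_eq_zero, ← norm_eq_zero, ← sq_eq_zero_iff, norm_sq_pt_sub hpD, mul_eq_zero,
      or_iff_right (by have := D.r_pos; positivity), sub_eq_zero, eq_comm] at h1
    obtain ⟨k, hk⟩ := (Real.cos_eq_one_iff t).1 h1
    rw [← hk] at ht0
    have hpi := Real.two_pi_pos
    have h2 : (0 : ℝ) < k := by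
      by_contra h3
      nlinarith [ht0.1]
    have h3 : (k : ℝ) < 1 := by
      by_contra h3
      nlinarith [ht0.2]
    have h4 : 0 < k := by exact_mod_cast h2
    have h5 : k < 1 := by exact_mod_cast h3
    omega

theorem loop_injective (hD : D.carrier ⊆ Φ) (hp : p ∈ D.carrier) {s t : ℝ}
    (h : D.loop hD hp s = D.loop hD hp t) : ∃ k : ℤ, s = t + k * (2 * π) := by
  obtain ⟨h1, h2⟩ := pt_injOn hp (congrArg Subtype.val h)
  rw [← Circle.exp_eq_exp]
  apply Circle.ext
  rw [Circle.coe_exp, Circle.coe_exp, Complex.exp_mul_I, Complex.exp_mul_I]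
  simp only [← Complex.ofReal_cos, ← Complex.ofReal_sin, h1, h2]

theorem side_eq_zero_iff_loop (hD : D.carrier ⊆ Φ) (hp : p ∈ D.carrier) (x : Φ) :
    D.side x = 0 ↔ ∃ t, D.loop hD hp t = x := by
  rw [side_eq_zero_iff]
  constructor
  · intro h
    obtain ⟨t, -, ht⟩ := exists_pt_eq hp h
    exact ⟨t, Subtype.ext ht⟩
  · rintro ⟨t, rfl⟩
    exact pt_mem hp t

/-- The zero class is compatible with every class, so it may be counted with the class (1, 0); seven
indices then fall into three boxes. -/
theorem exists_three_of_class {E : Fin 7 → Fin 7 → Prop} (cls : Fin 7 → ZMod 2 × ZMod 2)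
    (h : ∀ i j, cls i = cls j ∨ cls i = 0 ∨ cls j = 0 → E i j) :
    ∃ i j k, i ≠ j ∧ i ≠ k ∧ j ≠ k ∧ E i j ∧ E i k ∧ E j k := by
  classical
  set f : Fin 7 → ZMod 2 × ZMod 2 := fun i => if cls i = 0 then (1, 0) else cls i with hf
  have hmaps : ∀ i ∈ (Finset.univ : Finset (Fin 7)),
      f i ∈ (Finset.univ.erase 0 : Finset (ZMod 2 × ZMod 2)) := by
    intro i _
    rw [Finset.mem_erase]
    refine ⟨?_, Finset.mem_univ _⟩
    by_cases h0 : cls i = 0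
    · simp [hf, h0]
    · simp [hf, h0]
  have hcard : (Finset.univ.erase 0 : Finset (ZMod 2 × ZMod 2)).card * 2 <
      (Finset.univ : Finset (Fin 7)).card := by decide
  obtain ⟨y, -, hy⟩ := Finset.exists_lt_card_fiber_of_mul_lt_card_of_maps_to hmaps hcard
  obtain ⟨i, hi, j, hj, k, hk, h1, h2, h3⟩ := Finset.two_lt_card.1 hy
  simp only [Finset.mem_filter, Finset.mem_univ, true_and] at hi hj hk
  have key : ∀ a b, f a = y → f b = y → E a b := by
    intro a b ha hb
    apply h
    by_cases h4 : cls a = 0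
    · exact Or.inr (Or.inl h4)
    by_cases h5 : cls b = 0
    · exact Or.inr (Or.inr h5)
    left
    simp only [hf, if_neg h4] at ha
    simp only [hf, if_neg h5] at hb
    rw [ha, hb]
  exact ⟨i, j, k, h1, h2, h3, key _ _ hi hj, key _ _ hi hk, key _ _ hj hk⟩

/-- Among seven circles through a point of a sphere or torus, three are pairwise tangent or meet
again. -/
theorem exists_three_evenAt (hΦ : IsSmoothClosedSurface Φ)
    (htop : Nonempty (Φ ≃ₜ Metric.sphere (0 : E3) 1) ∨ Nonempty (Φ ≃ₜ Circle × Circle))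
    (C : Fin 7 → Circ) (hp : ∀ i, p ∈ (C i).carrier) (hC : ∀ i, (C i).carrier ⊆ Φ)
    (hd : ∀ i, Φ ⊆ closure (Φ \ (C i).carrier)) :
    ∃ i j k, i ≠ j ∧ i ≠ k ∧ j ≠ k ∧ (C i).EvenAt (C j) p ∧ (C i).EvenAt (C k) p ∧
      (C j).EvenAt (C k) p := by
  choose m hm hmC using fun i => exists_sideMap hΦ (hC i) (hd i)
  have hne : ∀ i, ∃ x : Φ, ∀ t, (C i).loop (hC i) (hp i) t ≠ x := by
    intro i
    obtain ⟨y, hy⟩ : (Φ \ (C i).carrier).Nonempty := closure_nonempty_iff.1 ⟨p, hd i (hC i (hp i))⟩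
    refine ⟨⟨y, hy.1⟩, fun t ht => hy.2 ?_⟩
    have h := pt_mem (hp i) t
    rwa [show (C i).pt p t = y from congrArg Subtype.val ht] at h
  rcases htop with ⟨⟨H⟩⟩ | ⟨⟨H⟩⟩
  · have key : ∀ i j, (C i).EvenAt (C j) p := by
      intro i j
      obtain ⟨x, hx⟩ := hne j
      exact evenAt_of_evenWinding (hp i) (hC j) (hp j) (hmC i)
        (evenWinding_of_sphere H (hm i) (continuous_loop _ _) (loop_add_two_pi _ _) hx)
    exact ⟨0, 1, 2, by decide, by decide, by decide, key _ _, key _ _, key _ _⟩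
  · choose θ κ hθ hθm hκ using fun i =>
      exists_torus_periods ((hm i).comp H.symm.continuous)
    choose γ τ hγ hγg hγτ using fun i =>
      exists_torus_loop_lift (g := fun t => H ((C i).loop (hC i) (hp i) t))
        (H.continuous.comp (continuous_loop _ _)) (fun t => by rw [loop_add_two_pi])
    -- Mod 2, `κ i` is the class dual to the circle `C i`, and `κ i (τ j)` is the intersection
    -- number of `C i` and `C j`.
    have hself : ∀ i, Even (κ i (τ i)) := fun i =>
      even_self_period (f := fun x => (C i).side (H.symm x))
        ((C i).continuous_side.comp (continuous_subtype_val.comp H.symm.continuous))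
        (fun x => hmC i (H.symm x))
        (fun s t h => loop_injective (hC i) (hp i) (H.injective h))
        (fun x => by
          rw [side_eq_zero_iff_loop (hC i) (hp i)]
          refine exists_congr fun t => ?_
          rw [H.eq_symm_apply])
        (hθ i) (hθm i) (hκ i) (hγ i) (hγg i) (hγτ i)
    have heven : ∀ i j, Even (κ i (τ j)) → (C i).EvenAt (C j) p := by
      intro i j h
      refine evenAt_of_evenWinding (hp i) (hC j) (hp j) (hmC i)
        ⟨fun t => θ i (γ j t), (hθ i).comp (hγ j), fun t => ?_, κ i (τ j), h, ?_⟩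
      · rw [hθm, hγg, Function.comp_apply, Homeomorph.symm_apply_apply, Function.comp_apply]
      · have h1 := hγτ j 0
        rw [zero_add] at h1
        simp only [h1, hκ]
    have hlin : ∀ i (σ : ℤ × ℤ), κ i σ = σ.1 * κ i (1, 0) + σ.2 * κ i (0, 1) := by
      intro i σ
      have : σ = σ.1 • ((1, 0) : ℤ × ℤ) + σ.2 • ((0, 1) : ℤ × ℤ) := by
        apply Prod.ext <;> simp
      conv_lhs => rw [this]
      rw [map_add, map_zsmul, map_zsmul, smul_eq_mul, smul_eq_mul]
    have hcast : ∀ i (σ : ℤ × ℤ), ((κ i σ : ℤ) : ZMod 2) =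
        σ.1 * (κ i (1, 0) : ZMod 2) + σ.2 * (κ i (0, 1) : ZMod 2) := by
      intro i σ
      rw [hlin i σ]; push_cast; ring
    refine exists_three_of_class (E := fun i j => (C i).EvenAt (C j) p)
      (fun i => ((κ i (1, 0) : ZMod 2), (κ i (0, 1) : ZMod 2))) ?_
    have hz : ∀ i j, ((κ i (1, 0) : ZMod 2), (κ i (0, 1) : ZMod 2)) = 0 → (C i).EvenAt (C j) p := by
      intro i j h
      simp only [Prod.ext_iff, Prod.fst_zero, Prod.snd_zero] at h
      apply heven
      rw [← ZMod.intCast_eq_zero_iff_even, hcast, h.1, h.2]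
      simp
    rintro i j (h | h | h)
    · simp only [Prod.ext_iff] at h
      apply heven
      rw [← ZMod.intCast_eq_zero_iff_even, hcast, h.1, h.2, ← hcast,
        ZMod.intCast_eq_zero_iff_even]
      exact hself j
    · exact hz i j h
    · exact (hz j i h).symm

end Circ

/-! ### Continuous families and persistence of transversal crossings. -/

/-- A family of circles on `Φ`, the circle with index `x` passing through `x`, that is continuous
at `p`. -/
structure IsCircFamilyAt (Φ : Set E3) (p : E3) (Γ : E3 → Circ) : Prop where
  tendsto_c : Tendsto (fun x => (Γ x).c) (𝓝[Φ] p) (𝓝 (Γ p).c)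
  tendsto_n : Tendsto (fun x => (Γ x).n) (𝓝[Φ] p) (𝓝 (Γ p).n)
  mem : ∀ᶠ x in 𝓝[Φ] p, x ∈ (Γ x).carrier ∧ (Γ x).carrier ⊆ Φ

namespace IsCircFamilyAt
variable {Φ : Set E3} {p q N ν : E3} {Γ : E3 → Circ} {C D : Circ} {a : ℝ}

theorem tendsto_pt (h : IsCircFamilyAt Φ p Γ) (t₀ : ℝ) :
    Tendsto (fun z : E3 × ℝ => (Γ z.1).pt z.1 z.2) (𝓝[Φ] p ×ˢ 𝓝 t₀) (𝓝 ((Γ p).pt p t₀)) := by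
  have hx : Tendsto (fun z : E3 × ℝ => z.1) (𝓝[Φ] p ×ˢ 𝓝 t₀) (𝓝 p) :=
    tendsto_fst.mono_right nhdsWithin_le_nhds
  have ht : Tendsto (fun z : E3 × ℝ => z.2) (𝓝[Φ] p ×ˢ 𝓝 t₀) (𝓝 t₀) := tendsto_snd
  have hc : Tendsto (fun z : E3 × ℝ => (Γ z.1).c) (𝓝[Φ] p ×ˢ 𝓝 t₀) (𝓝 (Γ p).c) :=
    h.tendsto_c.comp tendsto_fst
  have hn : Tendsto (fun z : E3 × ℝ => (Γ z.1).n) (𝓝[Φ] p ×ˢ 𝓝 t₀) (𝓝 (Γ p).n) :=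
    h.tendsto_n.comp tendsto_fst
  have hcr : Tendsto (fun z : E3 × ℝ => crossE (Γ z.1).n (z.1 - (Γ z.1).c)) (𝓝[Φ] p ×ˢ 𝓝 t₀)
      (𝓝 (crossE (Γ p).n (p - (Γ p).c))) :=
    (continuous_crossE.tendsto ((Γ p).n, p - (Γ p).c)).comp (hn.prodMk_nhds (hx.sub hc))
  exact (hc.add (((Real.continuous_cos.tendsto t₀).comp ht).smul (hx.sub hc))).add
    (((Real.continuous_sin.tendsto t₀).comp ht).smul hcr)

theorem tendsto_pt_const (h : IsCircFamilyAt Φ p Γ) (t₀ : ℝ) :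
    Tendsto (fun x => (Γ x).pt x t₀) (𝓝[Φ] p) (𝓝 ((Γ p).pt p t₀)) := by
  have h1 : Tendsto (fun x : E3 => (x, t₀)) (𝓝[Φ] p) (𝓝[Φ] p ×ˢ 𝓝 t₀) :=
    tendsto_id.prodMk tendsto_const_nhds
  simpa only [Function.comp_def] using (h.tendsto_pt t₀).comp h1

/-- Persistence of a transversal zero of a function along the members of a family. -/
theorem eventually_exists_zero (h : IsCircFamilyAt Φ p Γ) {f : E3 → ℝ} (hf : Continuous f)
    {t₀ d : ℝ} (hd : HasDerivAt (fun t => f ((Γ p).pt p t)) d t₀) (hd0 : d ≠ 0)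
    (h0 : f ((Γ p).pt p t₀) = 0) {O : Set E3} (hO : O ∈ 𝓝 ((Γ p).pt p t₀)) :
    ∀ᶠ x in 𝓝[Φ] p, ∃ t, (Γ x).pt x t ∈ O ∧ f ((Γ x).pt x t) = 0 := by
  obtain ⟨pa, ha, pb, hb, hab⟩ := eventually_prod_iff.1 ((h.tendsto_pt t₀).eventually hO)
  obtain ⟨η, hη, hηb⟩ := Metric.eventually_nhds_iff.1 hb
  have hs := hasDerivAt_iff_tendsto_slope_zero.1 hd
  simp only [h0, sub_zero, smul_eq_mul] at hs
  have hs2 : Tendsto (fun t : ℝ => d * (t⁻¹ * f ((Γ p).pt p (t₀ + t)))) (𝓝[≠] 0) (𝓝 (d * d)) :=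
    hs.const_mul d
  have hs3 := hs2.eventually_const_lt (mul_self_pos.2 hd0)
  rw [eventually_nhdsWithin_iff] at hs3
  obtain ⟨δ, hδ, hδ'⟩ := Metric.eventually_nhds_iff.1 hs3
  set s := min η δ / 2 with hsdef
  have hspos : 0 < s := by positivity
  have hsη : s < η := by
    have := min_le_left η δ
    have := lt_min hη hδ
    linarith
  have hsδ : s < δ := by
    have := min_le_right η δ
    have := lt_min hη hδ
    linarith
  have p1 : 0 < d * f ((Γ p).pt p (t₀ + s)) := by
    have h1 := hδ' (y := s) (by rw [Real.dist_eq, sub_zero, abs_of_pos hspos]; exact hsδ) hspos.ne'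
    have h2 : d * f ((Γ p).pt p (t₀ + s)) = s * (d * (s⁻¹ * f ((Γ p).pt p (t₀ + s)))) := by
      field_simp
    rw [h2]
    exact mul_pos hspos h1
  have p2 : d * f ((Γ p).pt p (t₀ + -s)) < 0 := by
    have h1 := hδ' (y := -s) (by rw [Real.dist_eq, sub_zero, abs_neg, abs_of_pos hspos]; exact hsδ)
      (neg_ne_zero.2 hspos.ne')
    have h2 : d * f ((Γ p).pt p (t₀ + -s)) =
        -s * (d * ((-s)⁻¹ * f ((Γ p).pt p (t₀ + -s)))) := by
      field_simp
    rw [h2]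
    exact mul_neg_of_neg_of_pos (neg_lt_zero.2 hspos) h1
  -- The factor `d` normalizes the signs: negative at `t₀ - s`, positive at `t₀ + s`. Both signs
  -- persist for nearby members.
  have e1 := (((hf.tendsto _).comp (h.tendsto_pt_const (t₀ + s))).const_mul d).eventually_const_lt p1
  have e2 := (((hf.tendsto _).comp (h.tendsto_pt_const (t₀ + -s))).const_mul d).eventually_lt_const p2
  filter_upwards [ha, e1, e2] with x hx h1 h2
  simp only [Function.comp_apply] at h1 h2
  have hc : ContinuousOn (fun t => d * f ((Γ x).pt x t)) (Set.Icc (t₀ + -s) (t₀ + s)) :=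
    ((hf.comp (Γ x).continuous_pt).const_mul d).continuousOn
  obtain ⟨t, ht, ht0⟩ := intermediate_value_Icc (by linarith) hc ⟨h2.le, h1.le⟩
  refine ⟨t, hab hx (hηb ?_), (mul_eq_zero.1 ht0).resolve_left hd0⟩
  rw [Real.dist_eq, abs_lt]
  constructor <;> linarith [ht.1, ht.2]

/-- A transversal intersection of a member of the family with a circle persists. -/
theorem eventually_exists_mem (hΦ : IsSmoothClosedSurface Φ) (hp : p ∈ Φ)
    (h : IsCircFamilyAt Φ p Γ) (hC : C.carrier ⊆ Φ)
    (hqC : q ∈ C.carrier) (hq : q ∈ (Γ p).carrier) (ht : ¬ C.Tangent (Γ p) q) {O : Set E3}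
    (hO : O ∈ 𝓝 q) : ∀ᶠ x in 𝓝[Φ] p, ∃ y ∈ O, y ∈ (Γ x).carrier ∧ y ∈ C.carrier := by
  obtain ⟨hpm, hpΦ⟩ := h.mem.self_of_nhdsWithin hp
  obtain ⟨N, hN, -⟩ := hΦ.exists_normal (hC hqC)
  obtain ⟨n1, n2, n3⟩ := Circ.crossE_conormal hN hC hqC
  -- Near `q` the surface meets this sphere only in `C`, so zeros of a single real function detect
  -- points of `C`.
  obtain ⟨w, b, -, hw2, hw3, hw4⟩ := Circ.exists_side_quad hN hC hqC n1 n2 n3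
  obtain ⟨t₀, -, rfl⟩ := Circ.exists_pt_eq hpm hq
  have hd := Circ.hasDerivAt_quad_pt (w := w) (b := b) hpm (t := t₀) rfl
  have hd0 := Circ.inner_ne_zero_of_not_tangent hN hC hpΦ hqC hq ht hw3 hw2.ne'
  rw [eventually_nhdsWithin_iff] at hw4
  have := h.eventually_exists_zero (continuous_quad w b _) hd hd0 (quad_self _ _ _)
    (inter_mem hO hw4)
  filter_upwards [this, h.mem] with x hx hxm
  obtain ⟨t, ⟨ht1, ht2⟩, ht3⟩ := hx
  have hm := Circ.pt_mem hxm.1 t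
  exact ⟨_, ht1, hm, ht2 (hxm.2 hm) ht3⟩

/-- If the member through `p` of a family crosses two circles of a common sphere tangent to the
surface, each of them in two points, then the surface lies in this sphere near `p`. -/
theorem eventually_quad_eq_zero_of_transversal (hΦ : IsSmoothClosedSurface Φ) (hp : p ∈ Φ)
    (h : IsCircFamilyAt Φ p Γ) (hN : IsNormalAt Φ p N) (hC : C.carrier ⊆ Φ) (hD : D.carrier ⊆ Φ)
    (hpC : p ∈ C.carrier) (hpD : p ∈ D.carrier) (hCD : C.carrier ≠ D.carrier)
    (hΓC : C.carrier ≠ (Γ p).carrier) (hΓD : D.carrier ≠ (Γ p).carrier)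
    (htC : ¬ C.Tangent (Γ p) p) (htD : ¬ D.Tangent (Γ p) p)
    (heC : C.EvenAt (Γ p) p) (heD : D.EvenAt (Γ p) p)
    (hqC : ∀ x ∈ C.carrier, quad N a p x = 0) (hqD : ∀ x ∈ D.carrier, quad N a p x = 0) :
    ∀ᶠ x in 𝓝[Φ] p, quad N a p x = 0 := by
  obtain ⟨hpm, hpΦ⟩ := h.mem.self_of_nhdsWithin hp
  obtain ⟨q, hqp, hqC1, hqΓ⟩ := heC.resolve_left htC
  obtain ⟨q', hqp', hqD1, hqΓ'⟩ := heD.resolve_left htD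
  have htq : ¬ C.Tangent (Γ p) q := fun ht =>
    hΓC (Circ.eq_of_tangent hqC1 hqΓ ht hpC hpm hqp.symm)
  have htq' : ¬ D.Tangent (Γ p) q' := fun ht =>
    hΓD (Circ.eq_of_tangent hqD1 hqΓ' ht hpD hpm hqp'.symm)
  -- If both circles are met again at the same point `q`, the crossings near `p` and near `q` number
  -- four, with three distinct ones unless they coincide in pairs. Coincident ones lie on both `C`
  -- and `D`, hence are `p` and `q` themselves.
  by_cases hqq : q = q'
  · subst hqq
    obtain ⟨U, V, hU, hV, hpU, hqV, hUV⟩ := t2_separation hqp.symm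
    have hne : ∀ y ∈ U, ∀ z ∈ V, y ≠ z := fun y hy z hz hyz =>
      Set.disjoint_left.1 hUV hy (hyz ▸ hz)
    filter_upwards [h.mem,
      eventually_exists_mem hΦ hp h hC hpC hpm htC (hU.mem_nhds hpU),
      eventually_exists_mem hΦ hp h hD hpD hpm htD (hU.mem_nhds hpU),
      eventually_exists_mem hΦ hp h hC hqC1 hqΓ htq (hV.mem_nhds hqV),
      eventually_exists_mem hΦ hp h hD hqD1 hqΓ' htq' (hV.mem_nhds hqV)] with
      x ⟨hx, hxΦ⟩ ⟨y₁, o₁, m₁, c₁⟩ ⟨y₂, o₂, m₂, c₂⟩ ⟨z₁, o₃, m₃, c₃⟩ ⟨z₂, o₄, m₄, c₄⟩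
    by_cases hy : y₁ = y₂
    swap
    · exact Circ.quad_eq_zero_of_three m₁ m₂ m₃ hy (hne _ o₁ _ o₃) (hne _ o₂ _ o₃)
        (hqC _ c₁) (hqD _ c₂) (hqC _ c₃) hx
    by_cases hz : z₁ = z₂
    swap
    · exact Circ.quad_eq_zero_of_three m₁ m₃ m₄ (hne _ o₁ _ o₃) (hne _ o₁ _ o₄) hz
        (hqC _ c₁) (hqC _ c₃) (hqD _ c₄) hx
    subst hy hz
    have hy1 : y₁ = p := by
      by_contra hcon
      exact hCD (Circ.eq_of_three c₁ hpC hqC1 hcon (hne _ o₁ _ hqV) hqp.symm c₂ hpD hqD1)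
    have hz1 : z₁ = q := by
      by_contra hcon
      exact hCD (Circ.eq_of_three c₃ hqC1 hpC hcon (hne _ hpU _ o₃).symm hqp c₄ hqD1 hpD)
    subst hy1 hz1
    -- The member passes through `p`, where the sphere has gradient `N`; tangency to the surface
    -- replaces the third point.
    exact Circ.quad_eq_zero_of_tangent m₁ m₃ hqp (hN.inner_tan hxΦ m₁) (hqC _ c₃) hx
  · obtain ⟨U₁, V₁, hU₁, hV₁, hpU₁, hqV₁, hUV₁⟩ := t2_separation hqp.symm
    obtain ⟨U₂, V₂, hU₂, hV₂, hpU₂, hqV₂, hUV₂⟩ := t2_separation hqp'.symm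
    obtain ⟨U₃, V₃, hU₃, hV₃, hqU₃, hqV₃, hUV₃⟩ := t2_separation hqq
    filter_upwards [h.mem,
      eventually_exists_mem hΦ hp h hC hpC hpm htC
        (inter_mem (hU₁.mem_nhds hpU₁) (hU₂.mem_nhds hpU₂)),
      eventually_exists_mem hΦ hp h hC hqC1 hqΓ htq
        (inter_mem (hV₁.mem_nhds hqV₁) (hU₃.mem_nhds hqU₃)),
      eventually_exists_mem hΦ hp h hD hqD1 hqΓ' htq'
        (inter_mem (hV₂.mem_nhds hqV₂) (hV₃.mem_nhds hqV₃))] with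
      x ⟨hx, hxΦ⟩ ⟨y₁, o₁, m₁, c₁⟩ ⟨y₂, o₂, m₂, c₂⟩ ⟨y₃, o₃, m₃, c₃⟩
    refine Circ.quad_eq_zero_of_three m₁ m₂ m₃ ?_ ?_ ?_ (hqC _ c₁) (hqC _ c₂) (hqD _ c₃) hx
    · rintro rfl; exact Set.disjoint_left.1 hUV₁ o₁.1 o₂.1
    · rintro rfl; exact Set.disjoint_left.1 hUV₂ o₁.2 o₃.1
    · rintro rfl; exact Set.disjoint_left.1 hUV₃ o₂.2 o₃.2

end IsCircFamilyAt

/-! ### Touching circles and geodesic curvature. -/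

namespace Circ
variable {Φ : Set E3} {p q N ν w : E3} {Γ : E3 → Circ} {C D : Circ} {a b : ℝ}

/-- The curvature of a circle at `p` in the direction `-ν`. -/
noncomputable def curv (C : Circ) (ν p : E3) : ℝ := inner ℝ ν (p - C.c) / C.r ^ 2

theorem eq_smul_of_inner {τ δ : E3} (hN : ‖N‖ = 1) (hτ : τ ≠ 0) (hNτ : inner ℝ N τ = 0)
    (hντ : inner ℝ ν τ = 0) (hνN : inner ℝ ν N = 0) (hν : ν ≠ 0) (hδτ : inner ℝ δ τ = 0)
    (hδN : inner ℝ δ N = 0) : δ = (inner ℝ ν δ / ‖ν‖ ^ 2 : ℝ) • ν := by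
  have hc : ‖crossE N τ‖ ^ 2 ≠ 0 := by
    rw [norm_sq_crossE, hN, hNτ]; simpa using hτ
  have hν2 : ‖ν‖ ^ 2 ≠ 0 := by simpa using hν
  have h1 := smul_eq_of_inner_eq_zero hνN hντ
  have h2 := smul_eq_of_inner_eq_zero hδN hδτ
  set e := crossE N τ with he
  have h3 : inner ℝ e ν ≠ 0 := by
    intro h
    rw [h, zero_smul] at h1
    exact hν ((smul_eq_zero.1 h1).resolve_left hc)
  have h4 : e = (‖e‖ ^ 2 / inner ℝ e ν : ℝ) • ν := by
    rw [div_eq_inv_mul, mul_smul, h1, smul_smul, inv_mul_cancel₀ h3, one_smul]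
  have h5 : ∃ s : ℝ, δ = s • ν := by
    refine ⟨(‖e‖ ^ 2)⁻¹ * inner ℝ e δ * (‖e‖ ^ 2 / inner ℝ e ν), ?_⟩
    rw [mul_smul, ← h4, mul_smul, ← h2, smul_smul, inv_mul_cancel₀ hc, one_smul]
  obtain ⟨s, hs⟩ := h5
  rw [hs, inner_smul_right, real_inner_self_eq_norm_sq, mul_div_cancel_right₀ _ hν2]

/-- The difference of the curvature vectors has no tangential component, and no normal one by
Meusnier; only the geodesic part along the conormal remains. -/
theorem curvature_sub (hN : IsNormalAt Φ p N) (hC : C.carrier ⊆ Φ) (hD : D.carrier ⊆ Φ)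
    (hpC : p ∈ C.carrier) (hpD : p ∈ D.carrier) (ht : C.Tangent D p)
    (hντ : inner ℝ ν (C.tan p) = 0) (hνN : inner ℝ ν N = 0) (hν : ν ≠ 0) :
    (C.r ^ 2)⁻¹ • (p - C.c) - (D.r ^ 2)⁻¹ • (p - D.c) =
      ((C.curv ν p - D.curv ν p) / ‖ν‖ ^ 2) • ν := by
  have hm := hN.normal_curvature_eq hC hD hpC hpD ht
  obtain ⟨k, hk, hkt⟩ := ht
  set δ := (C.r ^ 2)⁻¹ • (p - C.c) - (D.r ^ 2)⁻¹ • (p - D.c) with hδ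
  have h1 : inner ℝ (p - D.c) (C.tan p) = 0 := by
    have h2 := D.inner_tan_sub (x := p)
    rw [hkt, inner_smul_left, real_inner_comm] at h2
    simpa [hk] using h2
  have hδτ : inner ℝ δ (C.tan p) = 0 := by
    rw [hδ, inner_sub_left, inner_smul_left, inner_smul_left, h1, real_inner_comm, inner_tan_sub]
    simp
  have hδN : inner ℝ δ N = 0 := by
    rw [hδ, inner_sub_left, inner_smul_left, inner_smul_left, real_inner_comm,
      real_inner_comm N (p - D.c)]
    simp only [conj_trivial]
    rw [div_eq_inv_mul, div_eq_inv_mul] at hm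
    linarith
  have h3 := eq_smul_of_inner hN.1 (tan_ne_zero hpC) (hN.inner_tan hC hpC) hντ hνN hν hδτ hδN
  rw [h3]
  congr 2
  rw [hδ, inner_sub_right, inner_smul_right, inner_smul_right, curv, curv]
  ring

/-- Tangent circles on a surface with the same geodesic curvature coincide. -/
theorem subset_of_curv_eq (hN : IsNormalAt Φ p N) (hC : C.carrier ⊆ Φ) (hD : D.carrier ⊆ Φ)
    (hpC : p ∈ C.carrier) (hpD : p ∈ D.carrier) (ht : C.Tangent D p)
    (hντ : inner ℝ ν (C.tan p) = 0) (hνN : inner ℝ ν N = 0) (hν : ν ≠ 0)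
    (h : C.curv ν p = D.curv ν p) : D.carrier ⊆ C.carrier := by
  have h1 := curvature_sub hN hC hD hpC hpD ht hντ hνN hν
  rw [h, sub_self, zero_div, zero_smul, sub_eq_zero] at h1
  have hr := (pow_pos C.r_pos 2).ne'
  have hr' := (pow_pos D.r_pos 2).ne'
  have h2 : p - D.c = (D.r ^ 2 / C.r ^ 2) • (p - C.c) := by
    rw [div_eq_mul_inv, mul_smul, h1, smul_smul, mul_inv_cancel₀ hr', one_smul]
  obtain ⟨c1, c2⟩ := C.mem_carrier.1 hpC
  obtain ⟨k, hk, hkt⟩ := ht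
  intro x hx
  obtain ⟨t, -, rfl⟩ := exists_pt_eq hpD hx
  refine (mem_iff_quad hpC).2 ⟨?_, ?_⟩
  · rw [quad_pt hpD, hkt, h2, inner_smul_right, inner_smul_right, real_inner_comm, inner_tan_n,
      real_inner_comm, c2]
    ring
  · rw [quad_pt hpD, hkt, h2, inner_smul_right, inner_smul_right, inner_smul_left, inner_smul_left,
      real_inner_comm, inner_tan_sub, real_inner_self_eq_norm_sq, c1]
    simp only [conj_trivial]
    have := C.r_pos.ne'
    field_simp
    ring

theorem tangent_conormal (ht : C.Tangent D p) (h : inner ℝ ν (C.tan p) = 0) :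
    inner ℝ ν (D.tan p) = 0 := by
  obtain ⟨k, -, hk⟩ := ht
  rw [hk, inner_smul_right, h, mul_zero]

theorem curv_ne (hN : IsNormalAt Φ p N) (hC : C.carrier ⊆ Φ) (hD : D.carrier ⊆ Φ)
    (hpC : p ∈ C.carrier) (hpD : p ∈ D.carrier) (ht : C.Tangent D p)
    (hντ : inner ℝ ν (C.tan p) = 0) (hνN : inner ℝ ν N = 0) (hν : ν ≠ 0)
    (hne : C.carrier ≠ D.carrier) : C.curv ν p ≠ D.curv ν p := fun h => hne <|
  (subset_of_curv_eq hN hD hC hpD hpC ht.symm (tangent_conormal ht hντ) hνN hν h.symm).antisymm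
    (subset_of_curv_eq hN hC hD hpC hpD ht hντ hνN hν h)

/-- A circle touching `C` from the negative side lies on the negative side of spheres through
`C`. -/
theorem quad_neg_of_curv_lt (hN : IsNormalAt Φ p N) (hC : C.carrier ⊆ Φ) (hD : D.carrier ⊆ Φ)
    (hpC : p ∈ C.carrier) (hpD : p ∈ D.carrier) (ht : C.Tangent D p)
    (hντ : inner ℝ ν (C.tan p) = 0) (hνN : inner ℝ ν N = 0) (hν : ν ≠ 0)
    (hq : ∀ x ∈ C.carrier, quad w b p x = 0) (hwν : 0 < inner ℝ w ν)
    (hwτ : inner ℝ w (C.tan p) = 0) (hlt : C.curv ν p < D.curv ν p) {t : ℝ}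
    (hc : Real.cos t ≠ 1) : quad w b p (D.pt p t) < 0 := by
  have h1 := curvature_sub hN hC hD hpC hpD ht hντ hνN hν
  -- One further point of `C` determines the coefficient of 1 - cos t on `C`, which is zero; the
  -- coefficient on `D` then has the sign of the curvature difference.
  have h2 := hq _ (pt_mem hpC Real.pi)
  rw [quad_pt hpC, Real.sin_pi, Real.cos_pi] at h2
  have h3 : (C.r ^ 2)⁻¹ * inner ℝ w (p - C.c) - (D.r ^ 2)⁻¹ * inner ℝ w (p - D.c) =
      (C.curv ν p - D.curv ν p) / ‖ν‖ ^ 2 * inner ℝ w ν := by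
    rw [← inner_smul_right, ← inner_smul_right, ← inner_sub_right, h1, inner_smul_right]
  have hr := pow_pos C.r_pos 2
  have hr' := pow_pos D.r_pos 2
  have hν2 : 0 < ‖ν‖ ^ 2 := by
    have := norm_pos_iff.2 hν
    positivity
  rw [quad_pt hpD, tangent_conormal ht hwτ, mul_zero, zero_add]
  have h4 : 2 * b * D.r ^ 2 - inner ℝ w (p - D.c) =
      D.r ^ 2 * ((C.curv ν p - D.curv ν p) / ‖ν‖ ^ 2 * inner ℝ w ν) := by
    have h5 : inner ℝ w (p - C.c) = 2 * b * C.r ^ 2 := by linarith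
    rw [← h3, h5]
    have := C.r_pos.ne'
    have := D.r_pos.ne'
    field_simp
  have h6 : 0 < 1 - Real.cos t := by
    have := Real.cos_le_one t
    have := lt_of_le_of_ne this hc
    linarith
  rw [h4]
  have h7 : (C.curv ν p - D.curv ν p) / ‖ν‖ ^ 2 < 0 := div_neg_of_neg_of_pos (by linarith) hν2
  exact mul_neg_of_pos_of_neg h6 (mul_neg_of_pos_of_neg hr' (mul_neg_of_neg_of_pos h7 hwν))

end Circ

namespace IsCircFamilyAt
variable {Φ : Set E3} {p q N ν : E3} {Γ : E3 → Circ} {C D : Circ} {a : ℝ}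

/-- A member of the family through a point beyond a circle `C`, touched at `p` by the member through
`p`, crosses `C` on both sides. -/
theorem eventually_cross_touching {f : E3 → ℝ} (h : IsCircFamilyAt Φ p Γ) (hf : Continuous f)
    (hfC : ∀ᶠ x in 𝓝[Φ] p, f x = 0 → x ∈ C.carrier)
    (hneg : ∀ t, Real.cos t ≠ 1 → f ((Γ p).pt p t) < 0) :
    ∀ᶠ x in 𝓝[Φ] p, 0 < f x →
      (∃ t ∈ Set.Ioo 0 Real.pi, (Γ x).pt x t ∈ C.carrier) ∧
      ∃ t ∈ Set.Ioo (-Real.pi) 0, (Γ x).pt x t ∈ C.carrier := by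
  rw [eventually_nhdsWithin_iff] at hfC
  have hO : {x | x ∈ Φ → f x = 0 → x ∈ C.carrier} ∈ 𝓝 ((Γ p).pt p 0) := by
    rw [(Γ p).pt_zero]; exact hfC
  obtain ⟨pa, ha, pb, hb, hab⟩ := eventually_prod_iff.1 ((h.tendsto_pt 0).eventually hO)
  obtain ⟨η, hη, hηb⟩ := Metric.eventually_nhds_iff.1 hb
  have hpi := Real.pi_pos
  set s := min η Real.pi / 2 with hsdef
  have hspos : 0 < s := by positivity
  have hsη : s < η := by
    have := min_le_left η Real.pi
    have := lt_min hη hpi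
    linarith
  have hsπ : s < Real.pi := by
    have := min_le_right η Real.pi
    have := lt_min hη hpi
    linarith
  have hcos : Real.cos s ≠ 1 := by
    have := Real.cos_lt_cos_of_nonneg_of_le_pi le_rfl hsπ.le hspos
    rw [Real.cos_zero] at this
    exact this.ne
  have e1 := ((hf.tendsto _).comp (h.tendsto_pt_const s)).eventually_lt_const (hneg s hcos)
  have e2 := ((hf.tendsto _).comp (h.tendsto_pt_const (-s))).eventually_lt_const
    (hneg (-s) (by rwa [Real.cos_neg]))
  filter_upwards [ha, e1, e2, h.mem] with x hx h1 h2 hm h0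
  simp only [Function.comp_apply] at h1 h2
  have hc : Continuous fun t => f ((Γ x).pt x t) := hf.comp (Γ x).continuous_pt
  have h0' : 0 < f ((Γ x).pt x 0) := by rwa [(Γ x).pt_zero]
  constructor
  · obtain ⟨t, ht, ht0⟩ := intermediate_value_Icc' hspos.le hc.continuousOn ⟨h1.le, h0'.le⟩
    have ht1 : t ≠ 0 := by rintro rfl; simp only at ht0; linarith
    refine ⟨t, ⟨lt_of_le_of_ne ht.1 ht1.symm, by linarith [ht.2]⟩,
      hab hx (hηb ?_) (hm.2 (Circ.pt_mem hm.1 t)) ht0⟩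
    rw [Real.dist_eq, abs_lt]
    constructor <;> linarith [ht.1, ht.2]
  · obtain ⟨t, ht, ht0⟩ := intermediate_value_Icc (neg_nonpos.2 hspos.le) hc.continuousOn
      ⟨h2.le, h0'.le⟩
    have ht1 : t ≠ 0 := by rintro rfl; simp only at ht0; linarith
    refine ⟨t, ⟨by linarith [ht.1], lt_of_le_of_ne ht.2 ht1⟩,
      hab hx (hηb ?_) (hm.2 (Circ.pt_mem hm.1 t)) ht0⟩
    rw [Real.dist_eq, abs_lt]
    constructor <;> linarith [ht.1, ht.2]

/-- A member meets both `C` and `D` at a positive and at a negative angle. Both pairs cannot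
coincide, since `C` and `D` share only `p`; so three distinct points remain. -/
theorem eventually_quad_eq_zero_of_touching (h : IsCircFamilyAt Φ p Γ) {f g : E3 → ℝ} (hf : Continuous f) (hg : Continuous g)
    (hfC : ∀ᶠ x in 𝓝[Φ] p, f x = 0 → x ∈ C.carrier)
    (hgD : ∀ᶠ x in 𝓝[Φ] p, g x = 0 → x ∈ D.carrier)
    (hfneg : ∀ t, Real.cos t ≠ 1 → f ((Γ p).pt p t) < 0)
    (hgneg : ∀ t, Real.cos t ≠ 1 → g ((Γ p).pt p t) < 0)
    (hCD : ∀ x ∈ C.carrier, x ∈ D.carrier → x = p)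
    (hqC : ∀ x ∈ C.carrier, quad N a p x = 0) (hqD : ∀ x ∈ D.carrier, quad N a p x = 0) :
    ∀ᶠ x in 𝓝[Φ] p, 0 < f x → 0 < g x → quad N a p x = 0 := by
  filter_upwards [h.mem, h.eventually_cross_touching hf hfC hfneg,
    h.eventually_cross_touching hg hgD hgneg] with x hm h1 h2 hfx hgx
  obtain ⟨⟨t₁, ht₁, m₁⟩, ⟨t₂, ht₂, m₂⟩⟩ := h1 hfx
  obtain ⟨⟨s₁, hs₁, n₁⟩, ⟨s₂, hs₂, n₂⟩⟩ := h2 hgx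
  have hne : ∀ t ∈ Set.Ioo 0 Real.pi, ∀ s ∈ Set.Ioo (-Real.pi) 0, (Γ x).pt x t ≠ (Γ x).pt x s := by
    intro t ht s hs heq
    have h3 := (Circ.pt_injOn hm.1 heq).2
    have h4 := Real.sin_pos_of_pos_of_lt_pi ht.1 ht.2
    have h5 := Real.sin_neg_of_neg_of_neg_pi_lt hs.2 hs.1
    linarith
  have hmem := fun t => Circ.pt_mem hm.1 t
  by_cases e1 : (Γ x).pt x t₁ = (Γ x).pt x s₁
  · by_cases e2 : (Γ x).pt x t₂ = (Γ x).pt x s₂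
    · have h3 := hCD _ m₁ (e1 ▸ n₁)
      have h4 := hCD _ m₂ (e2 ▸ n₂)
      exact absurd (h3.trans h4.symm) (hne _ ht₁ _ ht₂)
    · exact Circ.quad_eq_zero_of_three (hmem t₁) (hmem t₂) (hmem s₂) (hne _ ht₁ _ ht₂)
        (hne _ ht₁ _ hs₂) e2 (hqC _ m₁) (hqC _ m₂) (hqD _ n₂) hm.1
  · exact Circ.quad_eq_zero_of_three (hmem t₁) (hmem s₁) (hmem t₂) e1 (hne _ ht₁ _ ht₂)
      (hne _ hs₁ _ ht₂) (hqC _ m₁) (hqD _ n₁) (hqC _ m₂) hm.1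

end IsCircFamilyAt

/-! ### Spherical pieces accumulating at every point. -/

/-- Near `p` there are open pieces of `Φ` lying in a sphere or plane. -/
def SphericalNear (Φ : Set E3) (p : E3) : Prop :=
  ∃ (N q : E3) (a : ℝ), ‖N‖ = 1 ∧ ∃ P : E3 → Prop, IsOpen {x | P x} ∧ (∃ᶠ x in 𝓝[Φ] p, P x) ∧
    ∀ᶠ x in 𝓝[Φ] p, P x → quad N a q x = 0

namespace IsCircFamilyAt
variable {Φ : Set E3} {p q N ν : E3} {Γ : E3 → Circ} {C D : Circ} {a : ℝ}

theorem sphericalNear_of_transversal (hΦ : IsSmoothClosedSurface Φ) (hp : p ∈ Φ)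
    (h : IsCircFamilyAt Φ p Γ) (hN : IsNormalAt Φ p N) (hC : C.carrier ⊆ Φ) (hD : D.carrier ⊆ Φ)
    (hpC : p ∈ C.carrier) (hpD : p ∈ D.carrier) (hCD : C.carrier ≠ D.carrier)
    (hΓC : C.carrier ≠ (Γ p).carrier) (hΓD : D.carrier ≠ (Γ p).carrier)
    (htC : ¬ C.Tangent (Γ p) p) (htD : ¬ D.Tangent (Γ p) p)
    (heC : C.EvenAt (Γ p) p) (heD : D.EvenAt (Γ p) p)
    (hqC : ∀ x ∈ C.carrier, quad N a p x = 0) (hqD : ∀ x ∈ D.carrier, quad N a p x = 0) :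
    SphericalNear Φ p := by
  refine ⟨N, p, a, hN.1, fun _ => True, isOpen_univ, ?_, ?_⟩
  · have : (𝓝[Φ] p).NeBot := mem_closure_iff_nhdsWithin_neBot.1 (subset_closure hp)
    exact (Eventually.of_forall fun _ => trivial).frequently
  · filter_upwards [h.eventually_quad_eq_zero_of_transversal hΦ hp hN hC hD hpC hpD hCD hΓC hΓD htC
      htD heC heD hqC hqD] with x hx _ using hx

/-- The equations of suitable spheres through `C` and `D` increase in the direction `ν`, so a curve
on the surface with velocity `ν` enters the region beyond both circles. This region therefore
accumulates at `p`. -/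
theorem sphericalNear_of_touching (hp : p ∈ Φ)
    (h : IsCircFamilyAt Φ p Γ) (hN : IsNormalAt Φ p N) (hC : C.carrier ⊆ Φ) (hD : D.carrier ⊆ Φ)
    (hpC : p ∈ C.carrier) (hpD : p ∈ D.carrier) (hCD : C.carrier ≠ D.carrier)
    (htC : C.Tangent (Γ p) p) (htD : D.Tangent (Γ p) p)
    (hντ : inner ℝ ν ((Γ p).tan p) = 0) (hνN : inner ℝ ν N = 0) (hν : ν ≠ 0)
    (hltC : C.curv ν p < (Γ p).curv ν p) (hltD : D.curv ν p < (Γ p).curv ν p)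
    (hσ : ∃ σ : ℝ → E3, HasDerivAt σ ν 0 ∧ σ 0 = p ∧ ∀ t, σ t ∈ Φ)
    (hqC : ∀ x ∈ C.carrier, quad N a p x = 0) (hqD : ∀ x ∈ D.carrier, quad N a p x = 0) :
    SphericalNear Φ p := by
  obtain ⟨hpm, hpΦ⟩ := h.mem.self_of_nhdsWithin hp
  have hνC := Circ.tangent_conormal htC.symm hντ
  have hνD := Circ.tangent_conormal htD.symm hντ
  obtain ⟨w, b, w1, w2, w3, w4⟩ := Circ.exists_side_quad hN hC hpC hνC hνN hν
  obtain ⟨v, d, v1, v2, v3, v4⟩ := Circ.exists_side_quad hN hD hpD hνD hνN hν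
  refine ⟨N, p, a, hN.1, fun x => 0 < quad w b p x ∧ 0 < quad v d p x, ?_, ?_, ?_⟩
  · exact (isOpen_lt continuous_const (continuous_quad w b p)).inter
      (isOpen_lt continuous_const (continuous_quad v d p))
  · obtain ⟨σ, s1, s2, s3⟩ := hσ
    have hder : ∀ (w : E3) (b : ℝ), 0 < inner ℝ w ν → ∀ᶠ t in 𝓝[>] (0 : ℝ), 0 < quad w b p (σ t) := by
      intro w b hw
      have h1 := s1.sub_const p
      have h2 : HasDerivAt (fun t => quad w b p (σ t)) (inner ℝ w ν) 0 := by
        have h3 := ((hasDerivAt_const (0 : ℝ) w).inner ℝ h1).add ((h1.norm_sq).const_mul b)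
        convert! h3 using 1
        simp [s2]
      have h4 := hasDerivAt_iff_tendsto_slope_zero.1 h2
      simp only [zero_add, s2, quad_self, sub_zero, smul_eq_mul] at h4
      have h5 := (h4.mono_left (nhdsWithin_mono _ fun t ht => ne_of_gt ht :
        𝓝[>] (0 : ℝ) ≤ 𝓝[≠] 0)).eventually_const_lt hw
      filter_upwards [h5, self_mem_nhdsWithin] with t ht ht0
      exact (pos_iff_pos_of_mul_pos ht).1 (inv_pos.2 ht0)
    have htend : Tendsto σ (𝓝[>] 0) (𝓝[Φ] p) := by
      refine tendsto_nhdsWithin_iff.2 ⟨?_, Eventually.of_forall s3⟩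
      have := s1.continuousAt.tendsto
      rw [s2] at this
      exact this.mono_left nhdsWithin_le_nhds
    exact htend.frequently ((hder w b w2).and (hder v d v2)).frequently
  · have := h.eventually_quad_eq_zero_of_touching (continuous_quad w b p)
      (continuous_quad v d p) w4 v4
      (fun t ht => Circ.quad_neg_of_curv_lt hN hC hpΦ hpC hpm htC hνC hνN hν w1 w2 w3 hltC ht)
      (fun t ht => Circ.quad_neg_of_curv_lt hN hD hpΦ hpD hpm htD hνD hνN hν v1 v2 v3 hltD ht)
      (fun x hx hx' => by
        by_contra hcon
        exact hCD (Circ.eq_of_tangent hpC hpD (htC.trans htD.symm) hx hx' hcon)) hqC hqD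
    filter_upwards [this] with x hx hx2 using hx hx2.1 hx2.2

end IsCircFamilyAt

/-- With `a` half the normal curvature, the sine coefficient vanishes by tangency and the other by
the choice of `a`. -/
theorem quad_eq_zero_of_carrier {Φ : Set E3} {p N : E3} {C : Circ} {a : ℝ}
    (hN : IsNormalAt Φ p N) (hC : C.carrier ⊆ Φ)
    (hp : p ∈ C.carrier) (ha : a = inner ℝ N (p - C.c) / C.r ^ 2 / 2) :
    ∀ x ∈ C.carrier, quad N a p x = 0 := by
  intro x hx
  obtain ⟨t, -, rfl⟩ := Circ.exists_pt_eq hp hx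
  have := C.r_pos.ne'
  rw [Circ.quad_pt hp, hN.inner_tan hC hp, ha]
  field_simp
  ring

/-- For touching circles this is Meusnier. Otherwise a second common point singles out one sphere or
plane among those tangent at `p`, and each circle lies in the one given by its normal curvature. -/
theorem normal_curvature_eq_of_evenAt {Φ : Set E3} {p N : E3} {C D : Circ}
    (hN : IsNormalAt Φ p N) (hC : C.carrier ⊆ Φ) (hD : D.carrier ⊆ Φ)
    (hpC : p ∈ C.carrier) (hpD : p ∈ D.carrier) (he : C.EvenAt D p) :
    inner ℝ N (p - C.c) / C.r ^ 2 = inner ℝ N (p - D.c) / D.r ^ 2 := by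
  rcases he with ht | ⟨q, hq, hqC, hqD⟩
  · exact hN.normal_curvature_eq hC hD hpC hpD ht
  · have h1 := quad_eq_zero_of_carrier hN hC hpC rfl q hqC
    have h2 := quad_eq_zero_of_carrier hN hD hpD rfl q hqD
    rw [quad] at h1 h2
    have h3 : ‖q - p‖ ^ 2 ≠ 0 := by simpa [sub_eq_zero] using hq
    have h4 : inner ℝ N (p - C.c) / C.r ^ 2 * ‖q - p‖ ^ 2 =
        inner ℝ N (p - D.c) / D.r ^ 2 * ‖q - p‖ ^ 2 := by linarith
    exact mul_right_cancel₀ h3 h4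

/-- Three families of circles that pairwise touch or meet twice force spherical pieces. -/
theorem sphericalNear_of_three {Φ : Set E3} {p : E3} {A B C : E3 → Circ}
    (hΦ : IsSmoothClosedSurface Φ) (hp : p ∈ Φ) (hA : IsCircFamilyAt Φ p A)
    (hB : IsCircFamilyAt Φ p B) (hC : IsCircFamilyAt Φ p C)
    (nAB : (A p).carrier ≠ (B p).carrier) (nAC : (A p).carrier ≠ (C p).carrier)
    (nBC : (B p).carrier ≠ (C p).carrier) (eAB : (A p).EvenAt (B p) p)
    (eAC : (A p).EvenAt (C p) p) (eBC : (B p).EvenAt (C p) p) : SphericalNear Φ p := by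
  obtain ⟨N, hN, hσ⟩ := hΦ.exists_normal hp
  obtain ⟨mA, sA⟩ := hA.mem.self_of_nhdsWithin hp
  obtain ⟨mB, sB⟩ := hB.mem.self_of_nhdsWithin hp
  obtain ⟨mC, sC⟩ := hC.mem.self_of_nhdsWithin hp
  have kAB := normal_curvature_eq_of_evenAt hN sA sB mA mB eAB
  have kAC := normal_curvature_eq_of_evenAt hN sA sC mA mC eAC
  set a := inner ℝ N (p - (A p).c) / (A p).r ^ 2 / 2 with ha
  have qA := quad_eq_zero_of_carrier hN sA mA ha
  have qB := quad_eq_zero_of_carrier hN sB mB (a := a) (by rw [ha, kAB])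
  have qC := quad_eq_zero_of_carrier hN sC mC (a := a) (by rw [ha, kAC])
  by_cases tAB : (A p).Tangent (B p) p
  · by_cases tAC : (A p).Tangent (C p) p
    · have tBC := tAB.symm.trans tAC
      obtain ⟨ντ, νN, ν0⟩ := Circ.crossE_conormal hN sA mA
      set ν := crossE N ((A p).tan p) with hν
      have hcurve := hσ ν (by rw [real_inner_comm]; exact νN)
      have ντB := Circ.tangent_conormal tAB ντ
      have ντC := Circ.tangent_conormal tAC ντ
      have c1 := Circ.curv_ne hN sA sB mA mB tAB ντ νN ν0 nAB
      have c2 := Circ.curv_ne hN sA sC mA mC tAC ντ νN ν0 nAC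
      have c3 := Circ.curv_ne hN sB sC mB mC tBC ντB νN ν0 nBC
      have caseA := hA.sphericalNear_of_touching (ν := ν) (a := a) hp hN sB sC mB mC nBC tAB.symm tAC.symm
        ντ νN ν0
      have caseB := hB.sphericalNear_of_touching (ν := ν) (a := a) hp hN sA sC mA mC nAC tAB tBC.symm
        ντB νN ν0
      have caseC := hC.sphericalNear_of_touching (ν := ν) (a := a) hp hN sA sB mA mB nAB tAC tBC
        ντC νN ν0
      -- The circle to be moved is the one with the largest `curv`, which lies on the negative side
      -- of the other two.
      rcases lt_or_gt_of_ne c1 with l1 | l1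
      · rcases lt_or_gt_of_ne c3 with l3 | l3
        · exact caseC (l1.trans l3) l3 hcurve qA qB
        · exact caseB l1 l3 hcurve qA qC
      · rcases lt_or_gt_of_ne c2 with l2 | l2
        · exact caseC l2 (lt_trans l1 l2) hcurve qA qB
        · exact caseA l1 l2 hcurve qB qC
    · have tBC : ¬ (B p).Tangent (C p) p := fun h => tAC (tAB.trans h)
      exact hC.sphericalNear_of_transversal hΦ hp hN sA sB mA mB nAB nAC nBC tAC tBC eAC eBC qA qB
  · by_cases tAC : (A p).Tangent (C p) p
    · have tBC : ¬ (C p).Tangent (B p) p := fun h => tAB (tAC.trans h)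
      exact hB.sphericalNear_of_transversal hΦ hp hN sA sC mA mC nAC nAB nBC.symm tAB tBC eAB
        eBC.symm qA qC
    · exact hA.sphericalNear_of_transversal hΦ hp hN sB sC mB mC nBC nAB.symm nAC.symm
        (fun h => tAB h.symm) (fun h => tAC h.symm) eAB.symm eAC.symm qB qC

theorem HasCirclesThroughEachPoint.exists_families {k : ℕ} {Φ : Set E3}
    (h : HasCirclesThroughEachPoint k Φ) {p : E3} (hp : p ∈ Φ) :
    ∃ Γ : Fin k → E3 → Circ, (∀ i, IsCircFamilyAt Φ p (Γ i)) ∧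
      Function.Injective fun i => (Γ i p).carrier := by
  classical
  obtain ⟨V, hV, hpV, γ, hγ, hγm⟩ := h p hp
  choose c n r hc hn hr hcirc using hγ
  -- Outside the given neighbourhood any circle will do, as only the germ at `p` matters.
  set Γ : Fin k → E3 → Circ := fun i x =>
    if hx : x ∈ Φ ∩ V then
      ⟨c i x, n i x, r i x, (hcirc i x hx).1, (hcirc i x hx).2.1⟩
    else ⟨0, EuclideanSpace.single 0 1, 1, one_pos, by simp⟩ with hΓ
  have hcar : ∀ i, ∀ x ∈ Φ ∩ V, (Γ i x).carrier = γ i x := by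
    intro i x hx
    rw [(hcirc i x hx).2.2]
    simp only [hΓ, dif_pos hx, Circ.carrier]
  have hcx : ∀ i, ∀ x ∈ Φ ∩ V, (Γ i x).c = c i x := by
    intro i x hx
    simp only [hΓ, dif_pos hx]
  have hnx : ∀ i, ∀ x ∈ Φ ∩ V, (Γ i x).n = n i x := by
    intro i x hx
    simp only [hΓ, dif_pos hx]
  have hnhds : 𝓝[Φ ∩ V] p = 𝓝[Φ] p :=
    nhdsWithin_inter_of_mem' (mem_nhdsWithin_of_mem_nhds (hV.mem_nhds hpV))
  have hmem : Φ ∩ V ∈ 𝓝[Φ] p := hnhds ▸ self_mem_nhdsWithin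
  refine ⟨Γ, fun i => ⟨?_, ?_, ?_⟩, ?_⟩
  · rw [hcx i p ⟨hp, hpV⟩]
    have := (hc i) p ⟨hp, hpV⟩
    rw [ContinuousWithinAt, hnhds] at this
    refine this.congr' ?_
    filter_upwards [hmem] with x hx using (hcx i x hx).symm
  · rw [hnx i p ⟨hp, hpV⟩]
    have := (hn i) p ⟨hp, hpV⟩
    rw [ContinuousWithinAt, hnhds] at this
    refine this.congr' ?_
    filter_upwards [hmem] with x hx using (hnx i x hx).symm
  · filter_upwards [hmem] with x hx
    rw [hcar i x hx]
    exact (hγm x hx).1 i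
  · intro i j hij
    simp only [hcar _ p ⟨hp, hpV⟩] at hij
    exact (hγm p ⟨hp, hpV⟩).2 hij

theorem HasCirclesThroughEachPoint.sphericalNear {Φ : Set E3} (hΦ : IsSmoothClosedSurface Φ)
    (htop : Nonempty (Φ ≃ₜ Metric.sphere (0 : E3) 1) ∨ Nonempty (Φ ≃ₜ Circle × Circle))
    (h : HasCirclesThroughEachPoint 7 Φ) {p : E3} (hp : p ∈ Φ) : SphericalNear Φ p := by
  obtain ⟨Γ, hΓ, hinj⟩ := h.exists_families hp
  have hm := fun i => (hΓ i).mem.self_of_nhdsWithin hp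
  have hd : ∀ i, Φ ⊆ closure (Φ \ (Γ i p).carrier) := by
    intro i
    refine Circ.subset_closure_sdiff fun b hb => ?_
    have hbΦ := (hm i).2 hb
    obtain ⟨Δ, hΔ, hΔinj⟩ := h.exists_families hbΦ
    have hΔm := fun i => (hΔ i).mem.self_of_nhdsWithin hbΦ
    by_cases h0 : (Δ 0 b).carrier = (Γ i p).carrier
    · refine ⟨Δ 1 b, (hΔm 1).1, (hΔm 1).2, fun h1 => ?_⟩
      exact absurd (hΔinj (h0.trans h1.symm)) (by decide)
    · exact ⟨Δ 0 b, (hΔm 0).1, (hΔm 0).2, h0⟩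
  obtain ⟨i, j, k, hij, hik, hjk, e1, e2, e3⟩ := Circ.exists_three_evenAt hΦ htop
    (fun i => Γ i p) (fun i => (hm i).1) (fun i => (hm i).2) hd
  exact sphericalNear_of_three hΦ hp (hΓ i) (hΓ j) (hΓ k) (hinj.ne hij) (hinj.ne hik)
    (hinj.ne hjk) e1 e2 e3

/-! ### Rigidity: from dense spherical pieces to a round sphere. -/

/-- Normalizing `N` makes the gradient a unit vector along the zero set, so on a spherical piece it
is the unit normal up to sign. -/
theorem norm_sq_gradient {N q x : E3} {a : ℝ} (hN : ‖N‖ = 1) (hx : quad N a q x = 0) :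
    ‖N + (2 * a) • (x - q)‖ ^ 2 = 1 := by
  rw [quad] at hx
  rw [norm_add_sq_real, inner_smul_right, norm_smul, mul_pow, hN, Real.norm_eq_abs, sq_abs]
  linear_combination 4 * a * hx

theorem contDiff_crossE {f g : E2 → E3} {n : WithTop ℕ∞} (hf : ContDiff ℝ n f)
    (hg : ContDiff ℝ n g) : ContDiff ℝ n fun u => crossE (f u) (g u) := by
  rw [contDiff_euclidean] at hf hg ⊢
  intro i
  fin_cases i
  · exact ((hf 1).mul (hg 2)).sub ((hf 2).mul (hg 1))
  · exact ((hf 2).mul (hg 0)).sub ((hf 0).mul (hg 2))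
  · exact ((hf 0).mul (hg 1)).sub ((hf 1).mul (hg 0))

theorem hasDerivAt_quad_comp {φ : E2 → E3} (hφ : Differentiable ℝ φ) (N q : E3) (a : ℝ) (u h : E2) :
    HasDerivAt (fun t : ℝ => quad N a q (φ (u + t • h)))
      (inner ℝ (N + (2 * a) • (φ u - q)) (fderiv ℝ φ u h)) 0 := by
  have h5 : HasDerivAt (fun t : ℝ => u + t • h) h 0 := by
    simpa using ((hasDerivAt_id (0 : ℝ)).smul_const h).const_add u
  have h6 : HasFDerivAt φ (fderiv ℝ φ u) (u + (0 : ℝ) • h) := by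
    simpa using (hφ u).hasFDerivAt
  have h1 := (h6.comp_hasDerivAt (0 : ℝ) h5).sub_const q
  have h3 := ((hasDerivAt_const (0 : ℝ) N).inner ℝ h1).add ((h1.norm_sq).const_mul a)
  convert! h3 using 1
  simp [inner_add_left, inner_smul_left]
  ring

/-- A chart in which spherical pieces are dense lies in any sphere containing one of its open
pieces. -/
theorem quad_eq_zero_of_eventually {φ : E2 → E3} (hφ : ContDiff ℝ ∞ φ)
    (hinj : ∀ u, Function.Injective (fderiv ℝ φ u))
    (hdense : ∀ u, ∃ᶠ v in 𝓝 u, ∃ (N q : E3) (a : ℝ), ‖N‖ = 1 ∧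
      ∀ᶠ v' in 𝓝 v, quad N a q (φ v') = 0)
    {N q : E3} {a : ℝ} {u₀ : E2} (hN : ‖N‖ = 1) (h : ∀ᶠ v in 𝓝 u₀, quad N a q (φ v) = 0) (u : E2) :
    quad N a q (φ u) = 0 := by
  set e₀ : E2 := EuclideanSpace.single 0 1 with he₀
  set e₁ : E2 := EuclideanSpace.single 1 1 with he₁
  have hd : Differentiable ℝ φ := hφ.differentiable (by simp)
  have hφ' : ContDiff ℝ ∞ (fderiv ℝ φ) := hφ.fderiv_right (by simp)
  have hφ₀ : ContDiff ℝ ∞ fun u => fderiv ℝ φ u e₀ := hφ'.clm_apply contDiff_const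
  have hφ₁ : ContDiff ℝ ∞ fun u => fderiv ℝ φ u e₁ := hφ'.clm_apply contDiff_const
  set φ₀ : E2 → E3 := fun u => fderiv ℝ φ u e₀ with hφ₀def
  have hφ₀₀ : ContDiff ℝ ∞ fun u => fderiv ℝ φ₀ u e₀ :=
    (hφ₀.fderiv_right (m := ∞) (by simp)).clm_apply contDiff_const
  set m : E2 → E3 := fun u => crossE (fderiv ℝ φ u e₀) (fderiv ℝ φ u e₁) with hm
  have hmc : ContDiff ℝ ∞ m := contDiff_crossE hφ₀ hφ₁
  have hm0 : ∀ u, m u ≠ 0 := fun u => crossE_ne_zero_of_injective (hinj u)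
  have hmn : ∀ u, ‖m u‖ ≠ 0 := fun u => norm_ne_zero_iff.2 (hm0 u)
  set ν : E2 → E3 := fun u => ‖m u‖⁻¹ • m u with hν
  have hνc : ContDiff ℝ ∞ ν := ((hmc.norm ℝ hm0).inv hmn).smul hmc
  have hν1 : ∀ u, ‖ν u‖ = 1 := fun u => by
    simp only [hν]
    rw [norm_smul, norm_inv, norm_norm, inv_mul_cancel₀ (hmn u)]
  have hνφ : ∀ u h, inner ℝ (ν u) (fderiv ℝ φ u h) = 0 := fun u h => by
    simp only [hν]
    rw [inner_smul_left, inner_crossE_apply, mul_zero]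
  have hφ₀0 : ∀ u, ‖φ₀ u‖ ^ 2 ≠ 0 := by
    intro u h0
    have h1 : fderiv ℝ φ u e₀ = 0 := by simpa using h0
    rw [map_eq_zero_iff _ (hinj u)] at h1
    simpa [he₀] using congrArg (fun v : E2 => v 0) h1
  -- On a spherical piece the gradient N + 2a(φ - q) equals sν with s = ±1 and is orthogonal to
  -- `φ₀`. Differentiating this orthogonality gives lam = 2as, whence ν - lam φ is constant as well.
  set lam : E2 → ℝ := fun u => -(inner ℝ (ν u) (fderiv ℝ φ₀ u e₀)) / ‖φ₀ u‖ ^ 2 with hlam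
  have hlamc : ContDiff ℝ ∞ lam := (hνc.inner ℝ hφ₀₀).neg.div (hφ₀.norm_sq ℝ) hφ₀0
  set B : E2 → E3 := fun u => ν u - lam u • φ u with hB
  have hBc : ContDiff ℝ ∞ B := hνc.sub (hlamc.smul hφ)
  -- the invariants `lam`, `B` of a spherical piece
  have key : ∀ (N q : E3) (a : ℝ) (v : E2), ‖N‖ = 1 → (∀ᶠ v' in 𝓝 v, quad N a q (φ v') = 0) →
      ∃ s : ℝ, s ^ 2 = 1 ∧ ∀ᶠ v' in 𝓝 v, lam v' = s * (2 * a) ∧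
        B v' = s • (N - (2 * a) • q) := by
    intro N q a v hN hv
    set g : E2 → E3 := fun u => N + (2 * a) • (φ u - q) with hg
    have hgc : Continuous g := by
      have := hφ.continuous
      fun_prop
    have hperp : ∀ᶠ v' in 𝓝 v, ∀ h, inner ℝ (g v') (fderiv ℝ φ v' h) = 0 := by
      filter_upwards [hv.eventually_nhds] with v' hv' h
      have h1 := hasDerivAt_quad_comp hd N q a v' h
      have h2 : (fun t : ℝ => quad N a q (φ (v' + t • h))) =ᶠ[𝓝 0] fun _ => (0 : ℝ) := by
        have hc : Tendsto (fun t : ℝ => v' + t • h) (𝓝 0) (𝓝 v') := by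
          have : Continuous fun t : ℝ => v' + t • h := by fun_prop
          simpa using this.tendsto 0
        exact hc.eventually hv'
      exact h1.unique ((hasDerivAt_const (0 : ℝ) (0 : ℝ)).congr_of_eventuallyEq h2)
    set s : E2 → ℝ := fun u => inner ℝ (ν u) (g u) with hs
    have hsc : Continuous s := hνc.continuous.inner hgc
    have hgs : ∀ᶠ v' in 𝓝 v, g v' = s v' • ν v' ∧ s v' ^ 2 = 1 := by
      filter_upwards [hv, hperp] with v' h1 h2
      have h3 := smul_eq_of_inner_eq_zero (h2 e₀) (h2 e₁)
      have h4 : g v' = s v' • ν v' := by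
        have h5 : ‖m v'‖ ^ 2 • g v' = (inner ℝ (m v') (g v') : ℝ) • m v' := h3
        have h6 : g v' = ((‖m v'‖ ^ 2)⁻¹ * inner ℝ (m v') (g v')) • m v' := by
          rw [mul_smul, ← h5, inv_smul_smul₀ (pow_ne_zero 2 (hmn v'))]
        simp only [hs, hν, inner_smul_left, smul_smul, conj_trivial]
        conv_lhs => rw [h6]
        congr 1
        field_simp
      refine ⟨h4, ?_⟩
      have h5 := norm_sq_gradient hN h1
      change ‖g v'‖ ^ 2 = 1 at h5
      rw [h4, norm_smul, hν1, mul_one, Real.norm_eq_abs, sq_abs] at h5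
      exact h5
    have hs1 := hgs.self_of_nhds.2
    have hsconst : ∀ᶠ v' in 𝓝 v, s v' = s v := by
      have h1 : ∀ᶠ v' in 𝓝 v, 0 < s v' * s v := by
        have : Tendsto (fun v' => s v' * s v) (𝓝 v) (𝓝 (s v * s v)) :=
          (hsc.tendsto v).mul_const _
        exact this.eventually_const_lt (by nlinarith)
      filter_upwards [h1, hgs] with v' h2 h3
      have h4 : (s v' - s v) * (s v' + s v) = 0 := by linear_combination h3.2 - hs1
      rcases mul_eq_zero.1 h4 with h5 | h5
      · linarith
      · nlinarith
    refine ⟨s v, hs1, ?_⟩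
    filter_upwards [hgs, hsconst, hperp.eventually_nhds] with v' h1 h2 h3
    have hνg : ν v' = s v • g v' := by
      rw [h1.1, h2, smul_smul, ← pow_two, hs1, one_smul]
    have hlam' : lam v' = s v * (2 * a) := by
      have d1 : HasDerivAt (fun t : ℝ => v' + t • e₀) e₀ 0 := by
        simpa using ((hasDerivAt_id (0 : ℝ)).smul_const e₀).const_add v'
      have d2 : HasDerivAt (fun t : ℝ => φ (v' + t • e₀)) (φ₀ v') 0 := by
        have : HasFDerivAt φ (fderiv ℝ φ v') (v' + (0 : ℝ) • e₀) := by
          simpa using (hd v').hasFDerivAt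
        exact this.comp_hasDerivAt (0 : ℝ) d1
      have d3 : HasDerivAt (fun t : ℝ => φ₀ (v' + t • e₀)) (fderiv ℝ φ₀ v' e₀) 0 := by
        have : HasFDerivAt φ₀ (fderiv ℝ φ₀ v') (v' + (0 : ℝ) • e₀) := by
          simpa using ((hφ₀.differentiable (by simp)) v').hasFDerivAt
        exact this.comp_hasDerivAt (0 : ℝ) d1
      have d4 : HasDerivAt (fun t : ℝ => g (v' + t • e₀)) ((2 * a) • φ₀ v') 0 :=
        ((d2.sub_const q).const_smul (2 * a)).const_add N
      have d5 := d4.inner ℝ d3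
      have d6 : (fun t : ℝ => (inner ℝ (g (v' + t • e₀)) (φ₀ (v' + t • e₀)) : ℝ)) =ᶠ[𝓝 0]
          fun _ => (0 : ℝ) := by
        have hc : Tendsto (fun t : ℝ => v' + t • e₀) (𝓝 0) (𝓝 v') := by
          have : Continuous fun t : ℝ => v' + t • e₀ := by fun_prop
          simpa using this.tendsto 0
        filter_upwards [hc.eventually h3] with t ht using ht e₀
      have d7 := d5.unique ((hasDerivAt_const (0 : ℝ) (0 : ℝ)).congr_of_eventuallyEq d6)
      simp only [zero_smul, add_zero, inner_smul_left, real_inner_self_eq_norm_sq,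
        conj_trivial] at d7
      simp only [hlam]
      rw [hνg, inner_smul_left, div_eq_iff (hφ₀0 v')]
      simp only [conj_trivial]
      linear_combination (-s v) * d7
    refine ⟨hlam', ?_⟩
    simp only [hB]
    rw [hlam', hνg]
    simp only [hg]
    module
  -- Different pieces may have different constants, but the differential vanishes on all of them,
  -- hence on their closure.
  have hlam0 : ∀ u, fderiv ℝ lam u = 0 := by
    intro u
    have hcl : IsClosed {u | fderiv ℝ lam u = 0} :=
      isClosed_eq (hlamc.continuous_fderiv (by simp)) continuous_const
    refine isClosed_iff_frequently.1 hcl u ((hdense u).mono ?_)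
    rintro v ⟨N, q, a, hN, hv⟩
    obtain ⟨s, -, hs⟩ := key N q a v hN hv
    have : lam =ᶠ[𝓝 v] fun _ => s * (2 * a) := hs.mono fun _ h => h.1
    change fderiv ℝ lam v = 0
    rw [this.fderiv_eq]
    simp
  have hB0 : ∀ u, fderiv ℝ B u = 0 := by
    intro u
    have hcl : IsClosed {u | fderiv ℝ B u = 0} :=
      isClosed_eq (hBc.continuous_fderiv (by simp)) continuous_const
    refine isClosed_iff_frequently.1 hcl u ((hdense u).mono ?_)
    rintro v ⟨N, q, a, hN, hv⟩
    obtain ⟨s, -, hs⟩ := key N q a v hN hv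
    have : B =ᶠ[𝓝 v] fun _ => s • (N - (2 * a) • q) := hs.mono fun _ h => h.2
    change fderiv ℝ B v = 0
    rw [this.fderiv_eq]
    simp
  have hlamK := fun x y => is_const_of_fderiv_eq_zero (hlamc.differentiable (by simp)) hlam0 x y
  have hBK := fun x y => is_const_of_fderiv_eq_zero (hBc.differentiable (by simp)) hB0 x y
  obtain ⟨s, hs1, hs⟩ := key N q a u₀ hN h
  obtain ⟨k1, k2⟩ := hs.self_of_nhds
  -- The constants found near `u₀` hold in the whole chart, so the gradient of the given equation
  -- stays normal to the surface.
  have hgrad : ∀ u, N + (2 * a) • (φ u - q) = s • ν u := by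
    intro u
    have h1 : ν u = lam u • φ u + B u := by simp only [hB]; module
    rw [h1, hlamK u u₀, hBK u u₀, k1, k2, smul_add, smul_smul, smul_smul, ← mul_assoc, ← pow_two,
      hs1]
    module
  have hder : ∀ u h, HasDerivAt (fun t : ℝ => quad N a q (φ (u + t • h))) 0 0 := by
    intro u h
    have h1 := hasDerivAt_quad_comp hd N q a u h
    rw [hgrad, inner_smul_left, hνφ, mul_zero] at h1
    exact h1
  have hdq : Differentiable ℝ fun u => quad N a q (φ u) := by
    have h1 : Differentiable ℝ fun u => φ u - q := hd.sub_const q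
    exact ((differentiable_const N).inner ℝ h1).add ((h1.norm_sq ℝ).const_mul a)
  have hfd : ∀ u, fderiv ℝ (fun u => quad N a q (φ u)) u = 0 := by
    intro u
    ext h
    have h5 : HasDerivAt (fun t : ℝ => u + t • h) h 0 := by
      simpa using ((hasDerivAt_id (0 : ℝ)).smul_const h).const_add u
    have h6 : HasFDerivAt (fun u => quad N a q (φ u)) (fderiv ℝ (fun u => quad N a q (φ u)) u)
        (u + (0 : ℝ) • h) := by simpa using (hdq u).hasFDerivAt
    have h7 := h6.comp_hasDerivAt (0 : ℝ) h5
    exact h7.unique (hder u h)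
  rw [is_const_of_fderiv_eq_zero hdq hfd u u₀]
  exact h.self_of_nhds

/-- Near each of its points, a spherical surface fills its sphere. -/
theorem eventually_mem_of_quad_eq_zero {Φ : Set E3} (hΦ : IsSmoothClosedSurface Φ) {N q p : E3}
    {a : ℝ} (hN : ‖N‖ = 1) (hS : ∀ x ∈ Φ, quad N a q x = 0) (hp : p ∈ Φ) :
    ∀ᶠ x in 𝓝 p, quad N a q x = 0 → x ∈ Φ := by
  obtain ⟨φ, u₀, h1, h2, -, h4, rfl⟩ := hΦ.exists_chart hp
  set m : E3 := N + (2 * a) • (φ u₀ - q) with hm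
  have hm1 : ‖m‖ ^ 2 = 1 := norm_sq_gradient hN (hS _ hp)
  set L := fderiv ℝ φ u₀ with hL
  have hperp : ∀ h, inner ℝ m (L h) = 0 := by
    intro h
    have h5 := hasDerivAt_quad_comp (h1.differentiable (by simp)) N q a u₀ h
    have h6 : (fun t : ℝ => quad N a q (φ (u₀ + t • h))) = fun _ => 0 :=
      funext fun t => hS _ (h4 _)
    rw [h6] at h5
    exact h5.unique (hasDerivAt_const _ _)
  have hφ : HasStrictFDerivAt φ L u₀ := h1.contDiffAt.hasStrictFDerivAt (by simp)
  -- The chart is thickened in the normal direction `m`; the invertible differential makes it cover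
  -- a full neighbourhood in space.
  set Λ : E2 × ℝ →L[ℝ] E3 := L.coprod (ContinuousLinearMap.toSpanSingleton ℝ m) with hΛ
  have hΨ : HasStrictFDerivAt (fun z : E2 × ℝ => φ z.1 + z.2 • m) Λ (u₀, 0) := by
    have h5 : HasStrictFDerivAt (fun z : E2 × ℝ => φ z.1) (L.comp (.fst ℝ E2 ℝ)) (u₀, 0) :=
      HasStrictFDerivAt.comp (u₀, (0 : ℝ)) (f := Prod.fst) hφ hasStrictFDerivAt_fst
    have h6 : HasStrictFDerivAt (fun z : E2 × ℝ => z.2 • m)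
        ((ContinuousLinearMap.toSpanSingleton ℝ m).comp (.snd ℝ E2 ℝ)) (u₀, 0) :=
      ((ContinuousLinearMap.toSpanSingleton ℝ m).comp (.snd ℝ E2 ℝ)).hasStrictFDerivAt
    exact h5.add h6
  have hinj : Function.Injective Λ := by
    rw [injective_iff_map_eq_zero]
    rintro ⟨d, s⟩ h0
    have h5 : L d + s • m = 0 := by simpa [hΛ] using h0
    have h6 := congrArg (fun x => (inner ℝ m x : ℝ)) h5
    simp only [inner_add_right, hperp, inner_smul_right, real_inner_self_eq_norm_sq, hm1,
      inner_zero_right, zero_add, mul_one] at h6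
    subst h6
    rw [zero_smul, add_zero, map_eq_zero_iff L (h2 u₀)] at h5
    rw [h5]
    rfl
  have hsurj : Function.Surjective Λ :=
    (LinearMap.injective_iff_surjective_of_finrank_eq_finrank (f := (Λ : E2 × ℝ →ₗ[ℝ] E3))
      (by simp)).1 hinj
  have hmap := hΨ.map_nhds_eq_of_surj (LinearMap.range_eq_top.2 hsurj)
  simp only [zero_smul, add_zero] at hmap
  rw [← hmap, eventually_map]
  have hc : Continuous fun z : E2 × ℝ =>
      (inner ℝ (N + (2 * a) • (φ z.1 - q)) m : ℝ) + a * z.2 * ‖m‖ ^ 2 := by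
    have := h1.continuous
    fun_prop
  have h7 := hc.tendsto (u₀, 0)
  simp only [← hm, real_inner_self_eq_norm_sq, hm1] at h7
  filter_upwards [h7.eventually_const_lt (u := 0) (by simp)] with z hz h0
  -- In these coordinates the equation is the normal coordinate times a factor close to 1, so it
  -- vanishes only on the chart.
  have h8 : quad N a q (φ z.1 + z.2 • m) = quad N a q (φ z.1) +
      z.2 * ((inner ℝ (N + (2 * a) • (φ z.1 - q)) m : ℝ) + a * z.2 * ‖m‖ ^ 2) := by
    rw [quad, quad, add_sub_right_comm, norm_add_sq_real, norm_smul, mul_pow, Real.norm_eq_abs,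
      sq_abs]
    simp only [inner_add_right, inner_add_left, inner_smul_left, inner_smul_right, conj_trivial]
    ring
  rw [h0, hS _ (h4 _), zero_add, hm1] at h8
  rcases mul_eq_zero.1 h8.symm with h9 | h9
  · rw [h9, zero_smul, add_zero]
    exact h4 _
  · exact absurd h9 hz.ne'

theorem setOf_quad_eq_zero {N q : E3} {a : ℝ} (hN : ‖N‖ = 1) (ha : a ≠ 0) :
    {x | quad N a q x = 0} = Metric.sphere (q - (1 / (2 * a)) • N) (1 / (2 * |a|)) := by
  ext x
  have h1 : ‖x - q + (1 / (2 * a)) • N‖ ^ 2 = quad N a q x / a + (1 / (2 * |a|)) ^ 2 := by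
    rw [quad, norm_add_sq_real, norm_smul, mul_pow, hN, inner_smul_right, Real.norm_eq_abs, sq_abs,
      real_inner_comm, div_pow, div_pow, mul_pow, mul_pow, sq_abs]
    field_simp
    ring
  rw [Set.mem_ofPred_eq, mem_sphere_iff_norm, sub_sub_eq_add_sub, add_sub_right_comm,
    ← sq_eq_sq₀ (norm_nonneg _) (by positivity), h1]
  simp [ha]

theorem isPreconnected_quad {N q : E3} {a : ℝ} (hN : ‖N‖ = 1) :
    IsPreconnected {x | quad N a q x = 0} := by
  by_cases ha : a = 0
  · subst ha
    refine Convex.isPreconnected ?_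
    intro x hx y hy s t _ _ hst
    simp only [Set.mem_ofPred_eq, quad, zero_mul, add_zero] at hx hy ⊢
    rw [show s • x + t • y - q = s • (x - q) + t • (y - q) by
      rw [show t = 1 - s by linarith]; module, inner_add_right, inner_smul_right, inner_smul_right,
      hx, hy]
    simp
  · rw [setOf_quad_eq_zero hN ha]
    refine isPreconnected_sphere ?_ _ _
    rw [← Module.finrank_eq_rank]
    simp

/-- A closed connected surface on which spherical pieces are dense is a round sphere. -/
theorem IsSmoothClosedSurface.eq_sphere_of_sphericalNear {Φ : Set E3}
    (hΦ : IsSmoothClosedSurface Φ) (hne : Φ.Nonempty) (hconn : IsPreconnected Φ)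
    (h : ∀ p ∈ Φ, SphericalNear Φ p) : ∃ (c : E3) (r : ℝ), 0 < r ∧ Φ = Metric.sphere c r := by
  have hdense : ∀ φ : E2 → E3, ContDiff ℝ ∞ φ → (∀ u, map φ (𝓝 u) = 𝓝[Φ] (φ u)) →
      (∀ u, φ u ∈ Φ) → ∀ u, ∃ᶠ v in 𝓝 u, ∃ (N q : E3) (a : ℝ), ‖N‖ = 1 ∧
        ∀ᶠ v' in 𝓝 v, quad N a q (φ v') = 0 := by
    intro φ h1 h3 h4 u
    obtain ⟨N, q, a, hN, P, hP, hf, he⟩ := h _ (h4 u)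
    rw [← h3 u] at hf he
    rw [eventually_map] at he
    rw [frequently_map] at hf
    refine (hf.and_eventually he.eventually_nhds).mono fun v hv => ⟨N, q, a, hN, ?_⟩
    filter_upwards [hv.2, h1.continuous.continuousAt.eventually (hP.mem_nhds hv.1)] with v' hv' hP'
    exact hv' hP'
  obtain ⟨p₀, hp₀⟩ := hne
  obtain ⟨N, q, a, hN, v₀, hv₀Φ, hv₀⟩ : ∃ (N q : E3) (a : ℝ), ‖N‖ = 1 ∧ ∃ p ∈ Φ,
      ∀ᶠ x in 𝓝[Φ] p, quad N a q x = 0 := by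
    obtain ⟨φ, u₀, h1, -, h3, h4, -⟩ := hΦ.exists_chart hp₀
    obtain ⟨v, N, q, a, hN, hv⟩ := (hdense φ h1 h3 h4 u₀).exists
    refine ⟨N, q, a, hN, φ v, h4 v, ?_⟩
    rw [← h3 v, eventually_map]
    exact hv
  have hS : ∀ x ∈ Φ, quad N a q x = 0 := by
    have hpre : PreconnectedSpace Φ := isPreconnected_iff_preconnectedSpace.1 hconn
    set A : Set Φ := {x : Φ | ∀ᶠ y : Φ in 𝓝 x, quad N a q (y : E3) = 0}
    have hAiff : ∀ x : Φ, x ∈ A ↔ ∀ᶠ y in 𝓝[Φ] (x : E3), quad N a q y = 0 := by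
      intro x
      rw [← map_nhds_subtype_val, eventually_map]
      rfl
    have hopen : IsOpen A := isOpen_setOfPred_eventually_nhds
    -- A chart around a limit point meets the open set where the equation holds, and rigidity
    -- spreads it over the chart.
    have hclosed : IsClosed A := by
      rw [isClosed_iff_frequently]
      rintro ⟨x, hx⟩ hf
      obtain ⟨φ, u₀, h1, h2, h3, h4, rfl⟩ := hΦ.exists_chart hx
      have hf' : ∃ᶠ y in 𝓝[Φ] (φ u₀), ∀ᶠ z in 𝓝[Φ] y, quad N a q z = 0 := by
        have h5 := map_nhds_subtype_val (s := Φ) ⟨φ u₀, hx⟩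
        rw [← h5, frequently_map]
        exact hf.mono fun y hy => (hAiff y).1 hy
      rw [← h3, frequently_map] at hf'
      obtain ⟨v, hv⟩ := hf'.exists
      rw [← h3, eventually_map] at hv
      rw [hAiff]
      change ∀ᶠ y in 𝓝[Φ] (φ u₀), quad N a q y = 0
      rw [← h3, eventually_map]
      exact Eventually.of_forall
        (quad_eq_zero_of_eventually h1 h2 (hdense φ h1 h3 h4) hN hv)
    have huniv : A = Set.univ :=
      IsClopen.eq_univ ⟨hclosed, hopen⟩ ⟨⟨v₀, hv₀Φ⟩, (hAiff _).2 hv₀⟩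
    intro x hx
    exact ((hAiff ⟨x, hx⟩).1 (huniv ▸ Set.mem_univ _)).self_of_nhdsWithin hx
  -- The surface is open in the connected sphere or plane, and closed by compactness.
  have heq : Φ = {x | quad N a q x = 0} := by
    refine Set.Subset.antisymm hS fun x hx => ?_
    by_contra hxΦ
    obtain ⟨y, hy, hyU, hyΦ⟩ := isPreconnected_quad (q := q) (a := a) hN
      {x | ∀ᶠ y in 𝓝 x, quad N a q y = 0 → y ∈ Φ} Φᶜ isOpen_setOfPred_eventually_nhds
      hΦ.1.isClosed.isOpen_compl
      (fun y _ => (em (y ∈ Φ)).imp (eventually_mem_of_quad_eq_zero hΦ hN hS) id)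
      ⟨p₀, hS _ hp₀, eventually_mem_of_quad_eq_zero hΦ hN hS hp₀⟩ ⟨x, hx, hxΦ⟩
    exact hyΦ (hyU.self_of_nhds hy)
  have ha : a ≠ 0 := by
    rintro rfl
    obtain ⟨v, hv, hNv⟩ : ∃ v : E3, v ≠ 0 ∧ inner ℝ N v = 0 := by
      have : (ℝ ∙ N)ᗮ ≠ ⊥ := by
        intro hbot
        have h1 := Submodule.finrank_add_finrank_orthogonal (ℝ ∙ N)
        rw [hbot, finrank_bot, finrank_span_singleton (by rintro rfl; simp at hN)] at h1
        simp at h1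
      obtain ⟨v, hv, hv0⟩ := Submodule.exists_mem_ne_zero_of_ne_bot this
      exact ⟨v, hv0, Submodule.mem_orthogonal_singleton_iff_inner_right.1 hv⟩
    -- A plane contains a point at distance |R| from `q`, which is outside the ball of radius `R`.
    obtain ⟨R, hR⟩ := hΦ.1.isBounded.subset_ball q
    have h1 : q + (|R| / ‖v‖) • v ∈ Φ := by
      rw [heq]
      simp [quad, inner_smul_right, hNv]
    have h2 := hR h1
    rw [Metric.mem_ball, dist_eq_norm, add_sub_cancel_left, norm_smul, norm_div, norm_norm,
      div_mul_cancel₀ _ (norm_ne_zero_iff.2 hv), Real.norm_eq_abs, abs_abs] at h2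
    exact absurd (le_abs_self R) (not_le.2 h2)
  exact ⟨_, 1 / (2 * |a|), by positivity, heq.trans (setOf_quad_eq_zero hN ha)⟩

theorem theorem2 (Φ : Set E3) (hΦ : IsSmoothClosedSurface Φ)
    (htop : Nonempty (Φ ≃ₜ Metric.sphere (0 : E3) 1) ∨ Nonempty (Φ ≃ₜ Circle × Circle))
    (hcirc : HasCirclesThroughEachPoint 7 Φ) :
    ∃ (c : E3) (r : ℝ), 0 < r ∧ Φ = Metric.sphere c r := by
  have hconn : ConnectedSpace Φ := by
    rcases htop with ⟨⟨e⟩⟩ | ⟨⟨e⟩⟩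
    · have : ConnectedSpace (Metric.sphere (0 : E3) 1) := by
        refine isConnected_iff_connectedSpace.1 (isConnected_sphere ?_ _ zero_le_one)
        rw [← Module.finrank_eq_rank]
        simp
      exact e.symm.surjective.connectedSpace e.symm.continuous
    · exact e.symm.surjective.connectedSpace e.symm.continuous
  have hc := isConnected_iff_connectedSpace.2 hconn
  exact hΦ.eq_sphere_of_sphericalNear hc.1 hc.2 fun p hp => hcirc.sphericalNear hΦ htop hp
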